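/- **Setting.** For $s\in\mathbb R$ let $\omega_0^s=1$, $\omega_k^s=k^s$ ($k\ge1$), and let $\Omega^s$ be the Banach space of real sequences $x=(x_k)_{k\ge0}$ with $\|x\|_s=\sup_k|x_k|\omega_k^s<\infty$; $B_0(r)=\{x\in\Omega^s:\|x\|_s\le r\}$. Put $(x*y)_k=\sum_{k_1+k_2=k,\ k_i\in\mathbb Z}x_{|k_1|}y_{|k_2|}$. Let $s>1$, $s_L>0$ and $f=\mathcal L+N$, where $\mathcal L_k(x)=\lambda_kx_{k-1}+\mu_kx_k+\beta_kx_{k+1}$ ($k\ge1$), $\mathcal L_0(x)=\mu_0x_0+\beta_0x_1$, and $N(x)=\sigma\,(x*x)+g$ with $\sigma\in\mathbb R$ and a constant sequence $g$ with $g_k=0$ for $k\ge 2m-1$ ($m$ below; e.g. $g=0$). Assume there are $0<C_1\le C_2$, $\delta\in(0,\frac12)$, $k_0\ge0$ with $|\lambda_k|,|\mu_k|,|\beta_k|\le C_2\,\omega_k^{s_L}$ for all $k\ge0$, and $|\mu_k|\ge C_1\omega_k^{s_L}$, $|\lambda_k/\mu_k|\le\delta$, $|\beta_k/\mu_k|\le\delta$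 for all $k\ge k_0$. Let $m\ge6$, $m\ge k_0$, let $\bar x=(\bar x_0,\dots,\bar x_{m-1},0,0,\dots)$, and let $L\ge1$ be an integer. Write $x_F=(x_0,\dots,x_{m-1})$, $x_I=(x_m,x_{m+1},\dots)$; $|\cdot|$ of vectors and matrices is entrywise; for an $m\times m$ matrix $B$ (rows and columns numbered $0,\dots,m-1$), $B_{c_{m-1}}$ and $B_{r_{m-1}}$ are its last column and row. **The operator $A$.** Put $a_n=\lambda_{m+n-1}$, $b_n=\mu_{m+n-1}$, $c_n=\beta_{m+n-1}$, $\delta_0=1$, $\delta_1=b_1$, $\delta_n=b_n\delta_{n-1}-a_nc_{n-1}\delta_{n-2}$. The tridiagonal tail factors as $L_IU_I$ with $L_I$ unit lower bidiagonal with subdiagonal $a_{n+1}\delta_{n-1}/\delta_n$ and $U_I$ upper bidiagonal with diagonal $\delta_n/\delta_{n-1}$ and superdiagonal $c_n$ ($n\ge1$); for sequences indexed from $0$, $$(L_I^{-1}y)_k=y_k+\sum_{l=1}^k(-1)^la_{k-l+2}\cdots a_{k+1}\tfrac{\delta_{k-l}}{\delta_k}y_{k-l},\qquad (U_I^{-1}z)_k=\sum_{l\ge0}(-1)^l\tfrac{\delta_k}{\delta_{k+l+1}}c_{k+1}\cdots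 c_{k+l}\,z_{k+l}.$$ Let $\mathcal T^{-1}=U_I^{-1}L_I^{-1}$, $w=\mathcal T^{-1}(1,0,0,\dots)$ and $$\tilde w=\frac{\delta_0}{\delta_1}+\sum_{l=1}^{L-1}\frac{\delta_0^2}{\delta_l\delta_{l+1}}c_1\cdots c_l\,a_2\cdots a_{l+1}.$$ Let $D=Df^{(m)}(\bar x)$, where $f^{(m)}:\mathbb R^m\to\mathbb R^m$ is $u\mapsto (f(u,0,0,\dots))_F$; let $\tilde K$ be $D$ with $\beta_{m-1}\lambda_m\tilde w$ subtracted from its entry $(m-1,m-1)$; let $A_m$ be any real $m\times m$ matrix (in practice a numerical inverse of $\tilde K$). Define $A$ by $$(Ay)_F=A_my_F-\beta_{m-1}(\mathcal T^{-1}y_I)_0(A_m)_{c_{m-1}},$$ $$(Ay)_I=-\lambda_m\big((A_m)_{r_{m-1}}y_F\big)w+\mathcal T^{-1}y_I+\beta_{m-1}\lambda_m(A_m)_{m-1,m-1}(\mathcal T^{-1}y_I)_0\,w .$$ **Constants.** $\gamma=\frac12+\sqrt{\frac14-\delta^2}$, $\theta=\delta/\gamma$, $\eta=\frac1{\gamma(1-\theta^2)}$,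 $p=s+s_L$. Let $M$ be an integer with $M\ge m$, $M\ge4/(\ln\theta)^2$, $M\ge-\frac{s}{\ln\theta}-m$ and $$M\ge\frac{-m\ln\sqrt\theta-p-1-\sqrt{(m\ln\sqrt\theta+p+1)^2-4m\ln\sqrt\theta}}{2\ln\sqrt\theta}.$$ Let $$\chi=\theta^{M/2}\tfrac M2\big(\tfrac{m+M}m\big)^p+\theta^{\sqrt M}\tfrac M2 2^p+\tfrac1{1-\theta}\big(\tfrac{m+M}{m+M-\sqrt M-1}\big)^p .$$ With $\zeta_L=2\sum_{l=1}^Ll^{-s}+\frac{2}{(s-1)L^{s-1}}$ let $\alpha_0=1+\zeta_L$, $\alpha_k=2+\zeta_L+\sum_{l=1}^{k-1}\frac{k^s}{l^s(k-l)^s}$ for $1\le k<m$, and $$\alpha_m=\begin{cases}2+\zeta_L+2\big(\frac m{m-1}\big)^s+\big(\frac{4\ln(m-2)}m+\frac{\pi^2-6}3\big)\big(\frac2m+\frac12\big)^{s-2},&s\ge2,\\ 2+\zeta_L+2^{s-1}\zeta_L,&1<s<2.\end{cases}$$ **The vector $Y$.** With $q_l=|f(\bar x)_{m+l}|/|\mu_{m+l}|$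 and $S=\sum_{l=0}^{m-2}\theta^lq_l$: $Y_F=|A_mf(\bar x)_F|+|\beta_{m-1}|\eta S\,|(A_m)_{c_{m-1}}|$, and for $0\le k\le M$ $$Y_{m+k}=\Big(|(A_m)_{r_{m-1}}f(\bar x)_F|+|\beta_{m-1}(A_m)_{m-1,m-1}|\eta S\Big)\eta\theta^k\tfrac{|\lambda_m|}{|\mu_m|}+R_k,$$ with $R_k=\eta\sum_{l=0}^k\theta^{k-l}q_l+\eta\sum_{l=k+1}^{m-2}\theta^{l-k}q_l$ for $k\le m-3$ and $R_k=\eta\theta^k\sum_{l=0}^{m-2}\theta^{-l}q_l$ for $m-2\le k\le M$; and $Y_{m+k}=Y_{m+M}\,\omega_{m+M}^s/\omega_{m+k}^s$ for $k>M$. **The vector $Z(r)$.** $Z(r)=Z^1(r)+D^1r+D^2r^2$, where each of $Z^1,D^1,D^2$ is continued by $V_{m+k}=V_{m+M}\,\omega_{m+M}^s/\omega_{m+k}^s$ for $k>M$, and the other entries are as follows. With $W=(1/\omega_0^s,\dots,1/\omega_{m-1}^s)^T$ and $\varepsilon=\frac{|\beta_{m-1}||\lambda_m|\theta^{2L}}{|\mu_m|\,\omega_{m-1}^s(1-\theta^2)}$,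 $$Z^1_F=\big(|I-A_m\tilde K|W+\varepsilon|A_m|_{c_{m-1}}\big)r,\quad Z^1_{m+k}=\big(|I-A_m\tilde K|_{r_{m-1}}W+\varepsilon|A_m|_{m-1,m-1}\big)\eta\theta^k\tfrac{|\lambda_m|}{|\mu_m|}r\quad(0\le k\le M).$$ For $j=1,2$ let $\nu_1=\|\bar x\|_s$, $\nu_2=1$, $C^1_k=2|\sigma|\sum_{l=m-k}^{m-1}|\bar x_l|/\omega_{k+l}^s$ (so $C^1_0=0$), $C^2_k=2|\sigma|\alpha_k/\omega_k^s$ for $0\le k<m$, and $h_j=\frac{2|\beta_{m-1}|\eta|\sigma|\alpha_m\nu_j}{C_1(1-\theta)\omega_m^{p}}$. Then $$D^j_F=|A_m|C^j_F+h_j|A_m|_{c_{m-1}},$$ $$D^j_{m+k}=\big(|A_m|_{r_{m-1}}C^j_F+h_j|A_m|_{m-1,m-1}\big)\eta\tfrac{|\lambda_m|}{|\mu_m|}\theta^k+\frac{2\eta|\sigma|\alpha_m\nu_j}{C_1\omega_{m+k}^p}\Big(X_k+\frac\theta{1-\theta}\Big)\quad(0\le k\le M),$$ with $X_k=\sum_{l=0}^k\theta^{k-l}\big(\frac{m+k}{m+l}\big)^p$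 for $k<M$ and $X_M=\chi$. **Theorem.** Under these assumptions $T(x)=x-Af(x)$ is a well-defined Fréchet differentiable map $\Omega^s\to\Omega^s$, and for all $k\ge0$ $$|(T(\bar x)-\bar x)_k|\le Y_k,\qquad\text{and for all } r>0:\quad \sup_{b_1,b_2\in B_0(r)}\big|[DT(\bar x+b_1)b_2]_k\big|\le Z_k(r).$$ -/

import Mathlib

noncomputable section

namespace TridiagNewton

/-- The weights `ω_k^s`: `1` for `k = 0` and `k^s` for `k ≥ 1`. -/
def wt (s : ℝ) (k : ℕ) : ℝ := if k = 0 then 1 else (k : ℝ) ^ s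

theorem wt_pos (s : ℝ) (k : ℕ) : 0 < wt s k := by
  unfold wt
  split_ifs with h
  · exact one_pos
  · exact Real.rpow_pos_of_pos (by exact_mod_cast Nat.pos_of_ne_zero h) s

/-- The weighted sup-norm `‖x‖_s = sup_k |x_k| ω_k^s` of a sequence
(meaningful when the set of these values is bounded). -/
def seqNorm (s : ℝ) (x : ℕ → ℝ) : ℝ := ⨆ k, |x k| * wt s k

/-- `Ω^s` as a linear subspace of the space of all real sequences. -/
def omegaSubmodule (s : ℝ) : Submodule ℝ (ℕ → ℝ) where
  carrier := {x | BddAbove (Set.range fun k => |x k| * wt s k)}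
  zero_mem' := ⟨0, by rintro _ ⟨k, rfl⟩; simp⟩
  add_mem' := by
    rintro x y ⟨B, hB⟩ ⟨C, hC⟩
    refine ⟨B + C, ?_⟩
    rintro _ ⟨k, rfl⟩
    have h1 := hB ⟨k, rfl⟩
    have h2 := hC ⟨k, rfl⟩
    have h3 := mul_le_mul_of_nonneg_right (abs_add_le (x k) (y k)) (wt_pos s k).le
    simp only [Pi.add_apply] at *
    linarith
  smul_mem' := by
    rintro c x ⟨B, hB⟩
    refine ⟨|c| * B, ?_⟩
    rintro _ ⟨k, rfl⟩
    have h1 := mul_le_mul_of_nonneg_left (hB ⟨k, rfl⟩) (abs_nonneg c)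
    simp only [Pi.smul_apply, smul_eq_mul, abs_mul] at *
    linarith

/-- The Banach space `Ω^s`, whose topology is the one of the norm `‖·‖_s`
(not the one induced by the product `ℕ → ℝ`). -/
def Omega (s : ℝ) : Type := omegaSubmodule s

instance (s : ℝ) : AddCommGroup (Omega s) := inferInstanceAs (AddCommGroup (omegaSubmodule s))

instance (s : ℝ) : Module ℝ (Omega s) := inferInstanceAs (Module ℝ (omegaSubmodule s))

instance (s : ℝ) : CoeFun (Omega s) (fun _ => ℕ → ℝ) := ⟨fun x => x.1⟩

instance (s : ℝ) : Norm (Omega s) := ⟨fun x => seqNorm s x⟩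

theorem Omega.norm_def {s : ℝ} (x : Omega s) : ‖x‖ = ⨆ k, |x k| * wt s k := rfl

theorem Omega.le_norm {s : ℝ} (x : Omega s) (k : ℕ) : |x k| * wt s k ≤ ‖x‖ :=
  le_ciSup x.2 k

theorem Omega.normCore (s : ℝ) : NormedSpace.Core ℝ (Omega s) where
  norm_nonneg x := Real.iSup_nonneg fun k => mul_nonneg (abs_nonneg _) (wt_pos s k).le
  norm_smul c x := by
    rw [Omega.norm_def, Omega.norm_def, Real.norm_eq_abs, Real.mul_iSup_of_nonneg (abs_nonneg c)]
    congr 1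
    funext k
    have : (c • x) k = c * x k := rfl
    rw [this, abs_mul, mul_assoc]
  norm_triangle x y := by
    rw [Omega.norm_def (x + y)]
    refine ciSup_le fun k => ?_
    have h0 : (x + y) k = x k + y k := rfl
    have h1 := Omega.le_norm x k
    have h2 := Omega.le_norm y k
    have h3 := mul_le_mul_of_nonneg_right (abs_add_le (x k) (y k)) (wt_pos s k).le
    rw [h0]
    linarith
  norm_eq_zero_iff x := by
    constructor
    · intro h
      refine Subtype.ext (funext fun k => ?_)
      have h1 := Omega.le_norm x k
      rw [h] at h1
      have h2 := wt_pos s k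
      have h3 := abs_nonneg (x k)
      have h4 : |x k| = 0 := by nlinarith
      exact abs_eq_zero.mp h4
    · rintro rfl
      rw [Omega.norm_def]
      have : ∀ k, |(0 : Omega s) k| * wt s k = 0 := fun k => by
        have h : (0 : Omega s) k = 0 := rfl
        rw [h]; simp
      simp [this]

instance (s : ℝ) : NormedAddCommGroup (Omega s) := NormedAddCommGroup.ofCore (Omega.normCore s)

instance (s : ℝ) : NormedSpace ℝ (Omega s) := NormedSpace.ofCore (Omega.normCore s)

/-- Discrete convolution of the symmetric extensions `x̃_j = x_{|j|}`, `ỹ_j = y_{|j|}`. -/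
def conv (x y : ℕ → ℝ) (k : ℕ) : ℝ :=
  ∑' j : ℤ, x j.natAbs * y ((k : ℤ) - j).natAbs

/-- Extension of a finite vector by zero. -/
def extend {m : ℕ} (u : Fin m → ℝ) (k : ℕ) : ℝ := if h : k < m then u ⟨k, h⟩ else 0

theorem extend_mem (s : ℝ) {m : ℕ} (u : Fin m → ℝ) : extend u ∈ omegaSubmodule s := by
  refine ⟨∑ k ∈ Finset.range m, |extend u k| * wt s k, ?_⟩
  rintro _ ⟨k, rfl⟩
  have hnn : ∀ i ∈ Finset.range m, 0 ≤ |extend u i| * wt s i :=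
    fun i _ => mul_nonneg (abs_nonneg _) (wt_pos s i).le
  by_cases h : k < m
  · exact Finset.single_le_sum hnn (Finset.mem_range.mpr h)
  · have : extend u k = 0 := by simp [extend, h]
    simpa [this] using Finset.sum_nonneg hnn

/-- The finite part `x_F = (x_0, …, x_{m-1})`. -/
def finPart (m : ℕ) (x : ℕ → ℝ) : Fin m → ℝ := fun i => x i

/-- The infinite part `x_I = (x_m, x_{m+1}, …)`, re-indexed from `0`. -/
def infPart (m : ℕ) (x : ℕ → ℝ) : ℕ → ℝ := fun k => x (m + k)

/-- `2 ∑_{l=1}^{L} l^{-s} + 2 / ((s-1) L^{s-1})`. -/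
def zetaUp (s : ℝ) (L : ℕ) : ℝ :=
  2 * ∑ l ∈ Finset.Icc 1 L, 1 / (l : ℝ) ^ s + 2 / ((s - 1) * (L : ℝ) ^ (s - 1))

/-- The convolution constants `α_k^s(n)`, with computational parameter `L`. -/
def alpha (s : ℝ) (L n k : ℕ) : ℝ :=
  if k = 0 then 1 + zetaUp s L
  else if k < n then
    2 + zetaUp s L
      + ∑ l ∈ Finset.Icc 1 (k - 1), (k : ℝ) ^ s / ((l : ℝ) ^ s * ((k : ℝ) - (l : ℝ)) ^ s)
  else if 2 ≤ s then
    2 + zetaUp s L + 2 * ((n : ℝ) / ((n : ℝ) - 1)) ^ s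
      + (4 * Real.log ((n : ℝ) - 2) / (n : ℝ) + (Real.pi ^ 2 - 6) / 3)
        * (2 / (n : ℝ) + 1 / 2) ^ (s - 2)
  else 2 + zetaUp s L + (2 : ℝ) ^ (s - 1) * zetaUp s L

/-- The raw data: the exponents `s`, `s_L`, the constants `C₁`, `δ`, the three diagonals, the
nonlinearity `N(x) = σ (x * x) + g`, the numbers `m`, `M`, `L`, the finite approximate zero and the
matrix `A_m`. Apart from `0 < m`, needed to speak of the last row and column, nothing is assumed
of them here. -/
structure Data where
  s : ℝ
  sL : ℝ
  C₁ : ℝ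
  δ : ℝ
  lam : ℕ → ℝ
  mu : ℕ → ℝ
  beta : ℕ → ℝ
  σ : ℝ
  g : ℕ → ℝ
  m : ℕ
  m_pos : 0 < m
  M : ℕ
  L : ℕ
  xF : Fin m → ℝ
  Am : Matrix (Fin m) (Fin m) ℝ

namespace Data

variable (P : Data)

/-- The index `m - 1` of the last row and column. -/
def last : Fin P.m := ⟨P.m - 1, Nat.sub_lt P.m_pos one_pos⟩

/-- The tridiagonal operator `𝓛`. -/
def lin (x : ℕ → ℝ) : ℕ → ℝ
  | 0 => P.mu 0 * x 0 + P.beta 0 * x 1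
  | k + 1 => P.lam (k + 1) * x k + P.mu (k + 1) * x (k + 1) + P.beta (k + 1) * x (k + 2)

/-- The quadratic nonlinearity `N`. -/
def nonlin (x : ℕ → ℝ) (k : ℕ) : ℝ := P.σ * conv x x k + P.g k

/-- `f = 𝓛 + N`. -/
def f (x : ℕ → ℝ) (k : ℕ) : ℝ := P.lin x k + P.nonlin x k

/-- The approximate zero `x̄ = (x̄_0, …, x̄_{m-1}, 0, 0, …)`. -/
def xbar : ℕ → ℝ := extend P.xF

/-- `x̄` as a point of `Ω^s`. -/
def xbarOmega : Omega P.s := ⟨P.xbar, extend_mem P.s P.xF⟩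

/-- The finite dimensional projection `f^{(m)} : ℝ^m → ℝ^m`. -/
def fProj (u : Fin P.m → ℝ) : Fin P.m → ℝ := finPart P.m (P.f (extend u))

/-- The Jacobian matrix `D = Df^{(m)}(x̄)`. -/
def D : Matrix (Fin P.m) (Fin P.m) ℝ :=
  LinearMap.toMatrix' (fderiv ℝ P.fProj P.xF : (Fin P.m → ℝ) →ₗ[ℝ] (Fin P.m → ℝ))

/-! The tridiagonal tail and its LU factorisation. -/

/-- Sub-diagonal of the tail, `a_n = λ_{m+n-1}` for `n ≥ 2`. -/
def a (n : ℕ) : ℝ := P.lam (P.m + n - 1)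

/-- Diagonal of the tail, `b_n = μ_{m+n-1}` for `n ≥ 1`. -/
def b (n : ℕ) : ℝ := P.mu (P.m + n - 1)

/-- Super-diagonal of the tail, `c_n = β_{m+n-1}` for `n ≥ 1`. -/
def c (n : ℕ) : ℝ := P.beta (P.m + n - 1)

/-- The principal minors `δ_n`. -/
def minor : ℕ → ℝ
  | 0 => 1
  | 1 => P.b 1
  | n + 2 => P.b (n + 2) * minor (n + 1) - P.a (n + 2) * P.c (n + 1) * minor n

/-- `L_I⁻¹`, where `L_I` is unit lower bidiagonal with sub-diagonal
`a_2 δ_0/δ_1, a_3 δ_1/δ_2, …`. -/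
def LIinv (y : ℕ → ℝ) (k : ℕ) : ℝ :=
  y k + ∑ l ∈ Finset.Icc 1 k,
    (-1) ^ l * (∏ i ∈ Finset.Icc (k - l + 2) (k + 1), P.a i) * (P.minor (k - l) / P.minor k)
      * y (k - l)

/-- `U_I⁻¹`, where `U_I` is upper bidiagonal with diagonal `δ_1/δ_0, δ_2/δ_1, …` and
super-diagonal `c_1, c_2, …`. -/
def UIinv (z : ℕ → ℝ) (k : ℕ) : ℝ :=
  ∑' l : ℕ, (-1) ^ l * (P.minor k / P.minor (k + l + 1))
    * (∏ i ∈ Finset.Icc (k + 1) (k + l), P.c i) * z (k + l)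

/-- `U_I⁻¹ L_I⁻¹`. -/
def tailInv (y : ℕ → ℝ) : ℕ → ℝ := P.UIinv (P.LIinv y)

/-- `w_I = U_I⁻¹ L_I⁻¹ e₁`, with first entry `w_I 0`. -/
def wI : ℕ → ℝ := P.tailInv (Pi.single 0 1)

/-- The truncation `w̃` of the series for `(w_I)_0`. -/
def wTilde : ℝ :=
  P.minor 0 / P.minor 1 + ∑ l ∈ Finset.Icc 1 (P.L - 1),
    P.minor 0 ^ 2 / (P.minor l * P.minor (l + 1))
      * (∏ i ∈ Finset.Icc 1 l, P.c i) * (∏ i ∈ Finset.Icc 2 (l + 1), P.a i)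

/-- `K̃`: the matrix `D` with `β_{m-1} λ_m w̃` subtracted from its last diagonal entry. -/
def KTilde : Matrix (Fin P.m) (Fin P.m) ℝ :=
  P.D - (P.beta (P.m - 1) * P.lam P.m) • Matrix.single P.last P.last P.wTilde

/-- The approximate inverse `A`, acting on a sequence `y`. -/
def A (y : ℕ → ℝ) (k : ℕ) : ℝ :=
  if h : k < P.m then
    P.Am.mulVec (finPart P.m y) ⟨k, h⟩
      - P.beta (P.m - 1) * P.tailInv (infPart P.m y) 0 * P.Am ⟨k, h⟩ P.last
  else
    -P.lam P.m * P.Am.mulVec (finPart P.m y) P.last * P.wI (k - P.m)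
      + P.tailInv (infPart P.m y) (k - P.m)
      + P.beta (P.m - 1) * P.lam P.m * P.Am P.last P.last
        * P.tailInv (infPart P.m y) 0 * P.wI (k - P.m)

/-! Constants. -/

def γ : ℝ := 1 / 2 + Real.sqrt (1 / 4 - P.δ ^ 2)

def θ : ℝ := P.δ / P.γ

def η : ℝ := 1 / (P.γ * (1 - P.θ ^ 2))

def χ : ℝ :=
  P.θ ^ ((P.M : ℝ) / 2) * ((P.M : ℝ) / 2) * (((P.m : ℝ) + P.M) / P.m) ^ (P.s + P.sL)
    + P.θ ^ Real.sqrt P.M * ((P.M : ℝ) / 2) * (2 : ℝ) ^ (P.s + P.sL)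
    + 1 / (1 - P.θ)
      * (((P.m : ℝ) + P.M) / ((P.m : ℝ) + P.M - Real.sqrt P.M - 1)) ^ (P.s + P.sL)

/-- The first lower bound on the computational parameter `M`. -/
def CondMA : Prop :=
  max (max
    ((-(P.m : ℝ) * Real.log (Real.sqrt P.θ) - P.s - P.sL - 1
        - Real.sqrt (((P.m : ℝ) * Real.log (Real.sqrt P.θ) + P.s + P.sL + 1) ^ 2
            - 4 * (P.m : ℝ) * Real.log (Real.sqrt P.θ)))
      / (2 * Real.log (Real.sqrt P.θ)))
    (4 / Real.log P.θ ^ 2)) (P.m : ℝ) ≤ (P.M : ℝ)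

/-- The second lower bound on the computational parameter `M`. -/
def CondMY : Prop :=
  max (-P.s / Real.log P.θ - (P.m : ℝ)) ((P.m : ℝ) - 2) ≤ (P.M : ℝ)

/-- A vector with entries `u_k` for `k < m`, `v_j` for `k = m + j`, `0 ≤ j ≤ M`, and
`v_M ω_{m+M}^s / ω_k^s` for `k > m + M`. -/
def glue (u : Fin P.m → ℝ) (v : ℕ → ℝ) (k : ℕ) : ℝ :=
  if h : k < P.m then u ⟨k, h⟩
  else if k ≤ P.m + P.M then v (k - P.m)
  else v P.M * wt P.s (P.m + P.M) / wt P.s k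

/-! The bound `Y`. -/

/-- `|f(x̄)|_{m+l} / |μ_{m+l}|`. -/
def q (l : ℕ) : ℝ := |P.f P.xbar (P.m + l)| / |P.mu (P.m + l)|

/-- `∑_{l=0}^{m-2} θ^l |f(x̄)|_{m+l} / |μ_{m+l}|`. -/
def S : ℝ := ∑ l ∈ Finset.Icc 0 (P.m - 2), P.θ ^ l * P.q l

def YF (i : Fin P.m) : ℝ :=
  |P.Am.mulVec (finPart P.m (P.f P.xbar)) i|
    + |P.beta (P.m - 1)| * P.η * P.S * |P.Am i P.last|

def YI (k : ℕ) : ℝ :=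
  (|P.Am.mulVec (finPart P.m (P.f P.xbar)) P.last|
      + |P.beta (P.m - 1) * P.Am P.last P.last| * P.η * P.S)
    * P.η * P.θ ^ k * (|P.lam P.m| / |P.mu P.m|)
  + (if k + 3 ≤ P.m then
      P.η * ∑ l ∈ Finset.Icc 0 k, P.θ ^ (k - l) * P.q l
        + P.η * ∑ l ∈ Finset.Icc (k + 1) (P.m - 2), P.θ ^ (l - k) * P.q l
    else
      P.η * P.θ ^ k * ∑ l ∈ Finset.Icc 0 (P.m - 2), P.q l / P.θ ^ l)

def Y : ℕ → ℝ := P.glue P.YF P.YI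

/-! The bound `Z(r) = Z¹(r) + Z²(r)`. -/

/-- `W_F^s = (1/ω_0^s, …, 1/ω_{m-1}^s)`. -/
def WF (i : Fin P.m) : ℝ := 1 / wt P.s i

/-- `|I - A_m K̃|`, entrywise. -/
def absDefect : Matrix (Fin P.m) (Fin P.m) ℝ := (1 - P.Am * P.KTilde).map abs

/-- `|A_m|`, entrywise. -/
def absAm : Matrix (Fin P.m) (Fin P.m) ℝ := P.Am.map abs

/-- `|β_{m-1}| |λ_m| θ^{2L} / (|μ_m| ω_{m-1}^s (1 - θ²))`. -/
def ε : ℝ :=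
  |P.beta (P.m - 1)| * |P.lam P.m| * P.θ ^ (2 * P.L)
    / (|P.mu P.m| * wt P.s (P.m - 1) * (1 - P.θ ^ 2))

def Z1F (r : ℝ) (i : Fin P.m) : ℝ :=
  (P.absDefect.mulVec P.WF i + P.ε * P.absAm i P.last) * r

def Z1I (r : ℝ) (k : ℕ) : ℝ :=
  (P.absDefect.mulVec P.WF P.last + P.ε * P.absAm P.last P.last)
    * P.η * P.θ ^ k * (|P.lam P.m| / |P.mu P.m|) * r

def Z1 (r : ℝ) : ℕ → ℝ := P.glue (P.Z1F r) (P.Z1I r)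

/-- `α_m^s(m)`. -/
def αm : ℝ := alpha P.s P.L P.m P.m

/-- The finite part of `C¹(x̄)`; the sum is empty for `k = 0`. -/
def C1F (k : Fin P.m) : ℝ :=
  2 * |P.σ| * ∑ l ∈ Finset.Icc (P.m - k) (P.m - 1), |P.xbar l| / wt P.s (k + l)

/-- The finite part of `C²`. -/
def C2F (k : Fin P.m) : ℝ := 2 * |P.σ| * alpha P.s P.L P.m k / wt P.s k

/-- Common form of the finite parts of `D¹` and `D²`, where `C` is the finite part and
`2 |σ| α_m^s(m) ν / ω_k^s`, `k ≥ m`, the tail of `C¹` (`ν = ‖x̄‖_s`) or `C²` (`ν = 1`). -/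
def DF (C : Fin P.m → ℝ) (ν : ℝ) (i : Fin P.m) : ℝ :=
  P.absAm.mulVec C i
    + 2 * |P.beta (P.m - 1)| * P.η * |P.σ| * P.αm * ν
        / (P.C₁ * (1 - P.θ) * wt (P.s + P.sL) P.m) * P.absAm i P.last

/-- Common form of the entries of `D¹` and `D²` of index `m + k`, `0 ≤ k ≤ M`. -/
def DI (C : Fin P.m → ℝ) (ν : ℝ) (k : ℕ) : ℝ :=
  (P.absAm.mulVec C P.last
      + 2 * |P.beta (P.m - 1)| * P.absAm P.last P.last * P.η * |P.σ| * P.αm * ν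
          / (P.C₁ * (1 - P.θ) * wt (P.s + P.sL) P.m))
    * P.η * (|P.lam P.m| / |P.mu P.m|) * P.θ ^ k
  + 2 * P.η * |P.σ| * P.αm * ν / (P.C₁ * wt (P.s + P.sL) (P.m + k))
    * ((if k < P.M then
          ∑ l ∈ Finset.Icc 0 k,
            P.θ ^ (k - l) * (((P.m : ℝ) + k) / ((P.m : ℝ) + l)) ^ (P.s + P.sL)
        else P.χ)
      + P.θ / (1 - P.θ))

def D1 : ℕ → ℝ :=
  P.glue (P.DF P.C1F (seqNorm P.s P.xbar)) (P.DI P.C1F (seqNorm P.s P.xbar))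

def D2 : ℕ → ℝ := P.glue (P.DF P.C2F 1) (P.DI P.C2F 1)

def Z2 (r : ℝ) (k : ℕ) : ℝ := P.D1 k * r + P.D2 k * r ^ 2

def Z (r : ℝ) (k : ℕ) : ℝ := P.Z1 r k + P.Z2 r k

end Data

end TridiagNewton

end

noncomputable section

namespace TridiagNewton

/-! ### Weights -/

/-! `f` maps `Ω^s` into `Ω^{s - s_L}` and `A` gains the lost `s_L` back, so `T = id - A f` is a
bounded affine map plus a bounded quadratic one, hence differentiable. All estimates then rest on an
entrywise bound for the inverse of the tridiagonal tail.

That bound comes from the minors: the normalised ratio `ρ_n = |δ_n| / (|b_n| |δ_{n-1}|)` satisfies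
`ρ_{n+1} ≥ 1 - δ² / ρ_n`, and `γ` is a fixed point of this recursion (`minor_step`). Both bidiagonal
inverses therefore decay geometrically with ratio `θ = δ / γ`, and composing the two kernels gives
`|𝒯⁻¹ y|_k ≤ η ∑_j θ^{|k-j|} |y_j| / |b_{j+1}|` (`abs_tailInv_le`). The growth of the diagonal never
enters, since the factors `|b|` of the two kernels cancel. For `Y` this is applied to `f(x̄)`, which
has finite support.

For `Z`, let `A†` (`dagger`) be the full operator `𝓛` plus the derivative of the nonlinearity
restricted to the finite block. Then `DT(x̄ + b₁) h = (h - A A† h) - A (Df(x̄ + b₁) h - A† h)`. The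
finite block and the tail of `A†` communicate only through `β_{m-1} h_m` and `λ_m h_{m-1}`. Block
elimination shows that `A` inverts `A†` up to two errors, `I - A_m K̃` and the truncation `w_0 - w̃`
(`sub_A_dagger_fin`, `sub_A_dagger_tail`). In the second term the linear parts cancel, leaving
convolutions, which the constants `α` control (`convWeight_add_zetaUp_le_alpha`).

Beyond index `m + M` the bounds are extrapolated like `1 / ω^s`. This is legitimate because `θ^k
ω_{m+k}^s` decreases from `M` on (`geom_mul_wt_antitone`), and because `χ` dominates the weighted
geometric sums at every index `k ≥ M` (`geomWeight_le_chiAt`, `chiAt_antitone`). -/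

theorem wt_eq_rpow (s : ℝ) {k : ℕ} (hk : k ≠ 0) : wt s k = (k : ℝ) ^ s := if_neg hk

theorem wt_zero_exp (s : ℝ) : wt s 0 = 1 := if_pos rfl

theorem wt_add (s t : ℝ) (k : ℕ) : wt (s + t) k = wt s k * wt t k := by
  rcases eq_or_ne k 0 with rfl | hk
  · simp [wt]
  · simp only [wt_eq_rpow _ hk]
    exact Real.rpow_add (by positivity) s t

theorem wt_mono {s : ℝ} (hs : 0 ≤ s) {j k : ℕ} (h : j ≤ k) : wt s j ≤ wt s k := by
  rcases eq_or_ne k 0 with rfl | hk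
  · obtain rfl : j = 0 := by omega
    exact le_rfl
  · rw [wt_eq_rpow s hk]
    rcases eq_or_ne j 0 with rfl | hj
    · rw [wt_zero_exp]
      exact Real.one_le_rpow (by exact_mod_cast Nat.one_le_iff_ne_zero.2 hk) hs
    · rw [wt_eq_rpow s hj]
      exact Real.rpow_le_rpow (by positivity) (by exact_mod_cast h) hs

theorem one_le_wt {s : ℝ} (hs : 0 ≤ s) (k : ℕ) : 1 ≤ wt s k := by
  simpa [wt_zero_exp] using wt_mono hs (Nat.zero_le k)

theorem wt_succ_le {s : ℝ} (hs : 0 ≤ s) (k : ℕ) : wt s (k + 1) ≤ 2 ^ s * wt s k := by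
  rcases eq_or_ne k 0 with rfl | hk
  · rw [wt_zero_exp, wt_eq_rpow s (by omega)]
    simpa using Real.one_le_rpow one_le_two hs
  · rw [wt_eq_rpow s hk, wt_eq_rpow s (by omega), ← Real.mul_rpow (by norm_num) (by positivity)]
    refine Real.rpow_le_rpow (by positivity) ?_ hs
    have : (1 : ℝ) ≤ k := by exact_mod_cast Nat.one_le_iff_ne_zero.2 hk
    push_cast
    linarith

theorem wt_div_wt (p : ℝ) {j k : ℕ} (hj : j ≠ 0) (hk : k ≠ 0) :
    wt p k / wt p j = ((k : ℝ) / j) ^ p := by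
  rw [wt_eq_rpow p hj, wt_eq_rpow p hk, Real.div_rpow (by positivity) (by positivity)]

theorem Omega.abs_le {s : ℝ} (x : Omega s) (k : ℕ) : |x k| ≤ ‖x‖ / wt s k := by
  rw [le_div_iff₀ (wt_pos s k)]
  exact x.le_norm k

theorem Omega.norm_le {s : ℝ} (x : Omega s) {C : ℝ} (h : ∀ k, |x k| * wt s k ≤ C) : ‖x‖ ≤ C :=
  ciSup_le h

/-! ### The two-sided geometric sum -/

/-- The sum `∑_j θ^{|k-j|} q_j`. -/
def greenSum (θ : ℝ) (q : ℕ → ℝ) (k : ℕ) : ℝ :=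
  ∑ j ∈ Finset.range k, θ ^ (k - j) * q j + ∑' i, θ ^ i * q (k + i)

theorem summable_geom_mul_of_bdd {θ : ℝ} (h0 : 0 ≤ θ) (h1 : θ < 1) {q : ℕ → ℝ} {B : ℝ}
    (hq : ∀ j, |q j| ≤ B) (k : ℕ) : Summable fun i => ‖θ ^ i * q (k + i)‖ := by
  refine Summable.of_nonneg_of_le (fun i => norm_nonneg _) (fun i => ?_)
    ((summable_geometric_of_lt_one h0 h1).mul_right B)
  rw [norm_mul, Real.norm_eq_abs, Real.norm_eq_abs, abs_of_nonneg (pow_nonneg h0 i)]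
  exact mul_le_mul_of_nonneg_left (hq _) (pow_nonneg h0 i)

/-- This composes the upper and lower geometric kernels. A source at `j < k` contributes `θ^{k-j}
θ^{2l}`. A source at `k + i` contributes `θ^i θ^{2(l-i)}`, which is the Cauchy product of `θ^i
q_{k+i}` with a geometric series in `θ²`. Both parts carry the factor `1 / (1 - θ²)`. -/
theorem hasSum_geom_geom {θ : ℝ} (h0 : 0 ≤ θ) (h1 : θ < 1) {q : ℕ → ℝ} {B : ℝ}
    (hq : ∀ j, |q j| ≤ B) (k : ℕ) :
    HasSum (fun l => θ ^ l * ∑ j ∈ Finset.range (k + l + 1), θ ^ (k + l - j) * q j)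
      (greenSum θ q k / (1 - θ ^ 2)) := by
  have hθ2 : θ ^ 2 < 1 := pow_lt_one₀ h0 h1 two_ne_zero
  have hgeo := hasSum_geometric_of_lt_one (sq_nonneg θ) hθ2
  have hgeo' : Summable fun n => ‖(θ ^ 2) ^ n‖ := by
    simpa using hgeo.summable.norm
  have hc := hasSum_sum_range_mul_of_summable_norm (summable_geom_mul_of_bdd h0 h1 hq k) hgeo'
  have hh := (hgeo.mul_left (∑ j ∈ Finset.range k, θ ^ (k - j) * q j)).add hc
  rw [hgeo.tsum_eq, ← add_mul, ← div_eq_mul_inv] at hh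
  have e : ∀ l, θ ^ l * ∑ j ∈ Finset.range (k + l + 1), θ ^ (k + l - j) * q j
      = (∑ j ∈ Finset.range k, θ ^ (k - j) * q j) * (θ ^ 2) ^ l
        + ∑ i ∈ Finset.range (l + 1), θ ^ i * q (k + i) * (θ ^ 2) ^ (l - i) := by
    intro l
    rw [add_assoc, Finset.sum_range_add, mul_add, Finset.mul_sum, Finset.sum_mul, Finset.mul_sum]
    congr 1
    · refine Finset.sum_congr rfl fun j hj => ?_
      have hj' := Finset.mem_range.1 hj
      rw [show k + l - j = (k - j) + l by omega, pow_add]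
      ring
    · refine Finset.sum_congr rfl fun i hi => ?_
      have hi' := Finset.mem_range.1 hi
      obtain ⟨n, rfl⟩ : ∃ n, l = i + n := ⟨l - i, by omega⟩
      rw [show k + (i + n) - (k + i) = n by omega, show i + n - i = n by omega, pow_add, ← pow_mul]
      ring
  simp only [e]
  exact hh

theorem greenSum_mono {θ : ℝ} (h0 : 0 ≤ θ) (h1 : θ < 1) {q q' : ℕ → ℝ} {B : ℝ}
    (hq : ∀ j, 0 ≤ q j) (hqq : ∀ j, q j ≤ q' j) (hB : ∀ j, q' j ≤ B) (k : ℕ) :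
    greenSum θ q k ≤ greenSum θ q' k := by
  have hB' : ∀ j, |q' j| ≤ B := fun j => by
    rw [abs_of_nonneg ((hq j).trans (hqq j))]; exact hB j
  have hB'' : ∀ j, |q j| ≤ B := fun j => by
    rw [abs_of_nonneg (hq j)]; exact (hqq j).trans (hB j)
  refine add_le_add (Finset.sum_le_sum fun j _ => ?_) (Summable.tsum_le_tsum (fun i => ?_)
    (summable_geom_mul_of_bdd h0 h1 hB'' k).of_norm (summable_geom_mul_of_bdd h0 h1 hB' k).of_norm)
  · exact mul_le_mul_of_nonneg_left (hqq _) (pow_nonneg h0 _)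
  · exact mul_le_mul_of_nonneg_left (hqq _) (pow_nonneg h0 _)

theorem greenSum_const_mul (θ : ℝ) (q : ℕ → ℝ) (c : ℝ) (k : ℕ) :
    greenSum θ (fun j => c * q j) k = c * greenSum θ q k := by
  unfold greenSum
  rw [mul_add, Finset.mul_sum, ← tsum_mul_left]
  simp only [mul_left_comm]

theorem greenSum_single (θ c : ℝ) (k : ℕ) :
    greenSum θ (fun j => if j = 0 then c else 0) k = θ ^ k * c := by
  unfold greenSum
  rcases k with _ | k
  · rw [tsum_eq_single 0 (fun i hi => by simp [hi])]
    simp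
  · simp

namespace Data

/-- The standing hypotheses on the linear part. -/
structure Regular (P : Data) (C₂ : ℝ) : Prop where
  one_lt_s : 1 < P.s
  sL_pos : 0 < P.sL
  C₁_pos : 0 < P.C₁
  δ_pos : 0 < P.δ
  δ_lt : P.δ < 1 / 2
  lam_le : ∀ k, |P.lam k| ≤ C₂ * wt P.sL k
  mu_le : ∀ k, |P.mu k| ≤ C₂ * wt P.sL k
  beta_le : ∀ k, |P.beta k| ≤ C₂ * wt P.sL k
  le_mu : ∀ k, P.m ≤ k → P.C₁ * wt P.sL k ≤ |P.mu k|
  lam_le_mu : ∀ k, P.m ≤ k → |P.lam k| ≤ P.δ * |P.mu k|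
  beta_le_mu : ∀ k, P.m ≤ k → |P.beta k| ≤ P.δ * |P.mu k|

namespace Regular

variable {P : Data} {C₂ : ℝ}

/-! ### The constants `γ`, `θ`, `η` -/

theorem half_lt_γ (H : P.Regular C₂) : 1 / 2 < P.γ := by
  have : 0 < Real.sqrt (1 / 4 - P.δ ^ 2) :=
    Real.sqrt_pos.2 (by nlinarith [H.δ_pos, H.δ_lt])
  unfold Data.γ
  linarith

theorem γ_pos (H : P.Regular C₂) : 0 < P.γ := by linarith [H.half_lt_γ]

/-- `γ` is the larger root of `t = 1 - δ² / t`, the fixed-point equation behind the recursion of the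
minors. -/
theorem γ_sq (H : P.Regular C₂) : P.γ ^ 2 = P.γ - P.δ ^ 2 := by
  have := Real.sq_sqrt (show 0 ≤ 1 / 4 - P.δ ^ 2 by nlinarith [H.δ_pos, H.δ_lt])
  unfold Data.γ
  nlinarith

theorem γ_le_one (H : P.Regular C₂) : P.γ ≤ 1 := by
  nlinarith [H.γ_sq, H.γ_pos, sq_nonneg P.δ]

theorem θ_pos (H : P.Regular C₂) : 0 < P.θ := div_pos H.δ_pos H.γ_pos

theorem θ_lt_one (H : P.Regular C₂) : P.θ < 1 := by
  unfold Data.θ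
  rw [div_lt_one H.γ_pos]
  linarith [H.half_lt_γ, H.δ_lt]

theorem θ_mul_γ (H : P.Regular C₂) : P.θ * P.γ = P.δ := div_mul_cancel₀ _ H.γ_pos.ne'

theorem one_sub_θ_pos (H : P.Regular C₂) : 0 < 1 - P.θ := by linarith [H.θ_lt_one]

theorem θ_sq_lt_one (H : P.Regular C₂) : P.θ ^ 2 < 1 :=
  pow_lt_one₀ H.θ_pos.le H.θ_lt_one two_ne_zero

theorem η_pos (H : P.Regular C₂) : 0 < P.η :=
  one_div_pos.2 (mul_pos H.γ_pos (by linarith [H.θ_sq_lt_one]))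

/-! ### The minors -/

theorem mu_pos (H : P.Regular C₂) {k : ℕ} (hk : P.m ≤ k) : 0 < |P.mu k| :=
  (mul_pos H.C₁_pos (wt_pos _ _)).trans_le (H.le_mu k hk)

theorem b_pos (H : P.Regular C₂) (n : ℕ) : 0 < |P.b (n + 1)| := H.mu_pos (by omega)

theorem a_le (H : P.Regular C₂) (n : ℕ) : |P.a (n + 1)| ≤ P.θ * P.γ * |P.b (n + 1)| := by
  rw [H.θ_mul_γ]; exact H.lam_le_mu _ (by omega)

theorem c_le (H : P.Regular C₂) (n : ℕ) : |P.c (n + 1)| ≤ P.θ * P.γ * |P.b (n + 1)| := by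
  rw [H.θ_mul_γ]; exact H.beta_le_mu _ (by omega)

/-- Induction on `ρ_{n+1} ≥ 1 - δ² / ρ_n ≥ 1 - δ² / γ = γ`, starting from `ρ_1 = 1 ≥ γ`.
Non-vanishing has to be carried along, as it is what makes the ratios meaningful. -/
theorem minor_step (H : P.Regular C₂) (n : ℕ) :
    0 < |P.minor n| ∧ P.γ * |P.b (n + 1)| * |P.minor n| ≤ |P.minor (n + 1)| := by
  induction n with
  | zero =>
    simp only [minor, abs_one, zero_lt_one, true_and, mul_one, zero_add]
    exact mul_le_of_le_one_left (abs_nonneg _) H.γ_le_one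
  | succ n ih =>
    obtain ⟨h0, h1⟩ := ih
    have hpos : 0 < |P.minor (n + 1)| :=
      (mul_pos (mul_pos H.γ_pos (H.b_pos n)) h0).trans_le h1
    refine ⟨hpos, ?_⟩
    have hb := H.b_pos (n + 1)
    have hac : |P.a (n + 2) * P.c (n + 1) * P.minor n|
        ≤ P.δ * |P.b (n + 2)| * (P.δ * |P.b (n + 1)|) * |P.minor n| := by
      rw [abs_mul, abs_mul, ← H.θ_mul_γ]
      exact mul_le_mul_of_nonneg_right (mul_le_mul (H.a_le (n + 1)) (H.c_le n) (abs_nonneg _)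
        (mul_nonneg (mul_pos H.θ_pos H.γ_pos).le hb.le)) h0.le
    have h2 : P.δ ^ 2 * (|P.b (n + 1)| * |P.minor n|) * P.γ ≤ P.δ ^ 2 * |P.minor (n + 1)| := by
      nlinarith [mul_le_mul_of_nonneg_left h1 (sq_nonneg P.δ)]
    have h3 := abs_sub_abs_le_abs_sub (P.b (n + 2) * P.minor (n + 1))
      (P.a (n + 2) * P.c (n + 1) * P.minor n)
    rw [abs_mul] at h3
    -- Everything is multiplied by `γ`, so that the fixed-point equation can be used in the
    -- polynomial form `γ² = γ - δ²`.
    have h4 : P.γ * (P.γ * |P.b (n + 2)| * |P.minor (n + 1)|)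
        ≤ P.γ * (|P.b (n + 2)| * |P.minor (n + 1)|
          - P.δ * |P.b (n + 2)| * (P.δ * |P.b (n + 1)|) * |P.minor n|) := by
      have h5 : P.γ * (P.γ * |P.b (n + 2)| * |P.minor (n + 1)|)
          = (P.γ - P.δ ^ 2) * (|P.b (n + 2)| * |P.minor (n + 1)|) := by rw [← H.γ_sq]; ring
      rw [h5]
      nlinarith [mul_le_mul_of_nonneg_left h2 hb.le]
    have h5 := le_of_mul_le_mul_left h4 H.γ_pos
    calc _ ≤ _ := h5
      _ ≤ _ := by linarith
      _ ≤ |P.minor (n + 1 + 1)| := h3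

theorem minor_ne (H : P.Regular C₂) (n : ℕ) : P.minor n ≠ 0 := abs_pos.1 (H.minor_step n).1

theorem minor_ratio_le (H : P.Regular C₂) (n : ℕ) :
    |P.minor n / P.minor (n + 1)| ≤ 1 / (P.γ * |P.b (n + 1)|) := by
  rw [abs_div, div_le_div_iff₀ (H.minor_step (n + 1)).1 (mul_pos H.γ_pos (H.b_pos n))]
  linarith [(H.minor_step n).2]

end Regular

/-! ### The lower factor -/

/-- The isolated diagonal term is the `l = 0` summand: its product is empty and its ratio of minors
is `1`. -/
theorem LIinv_eq_sum (P : Data) {k : ℕ} (hk : P.minor k ≠ 0) (y : ℕ → ℝ) :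
    P.LIinv y k = ∑ l ∈ Finset.range (k + 1),
      (-1) ^ l * (∏ i ∈ Finset.Icc (k - l + 2) (k + 1), P.a i) * (P.minor (k - l) / P.minor k)
        * y (k - l) := by
  unfold LIinv
  rw [Finset.sum_range_succ', Finset.range_eq_Ico, Finset.sum_Ico_add' (fun l => (-1) ^ l *
    (∏ i ∈ Finset.Icc (k - l + 2) (k + 1), P.a i) * (P.minor (k - l) / P.minor k) * y (k - l)) 0 k 1]
  simp [hk, add_comm]
  rfl

theorem LIinv_zero (P : Data) (y : ℕ → ℝ) : P.LIinv y 0 = y 0 := by simp [LIinv]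

theorem LIinv_add (P : Data) (y z : ℕ → ℝ) : P.LIinv (y + z) = P.LIinv y + P.LIinv z := by
  funext k
  simp only [LIinv, Pi.add_apply, mul_add, Finset.sum_add_distrib]
  ring

theorem LIinv_smul (P : Data) (r : ℝ) (y : ℕ → ℝ) : P.LIinv (r • y) = r • P.LIinv y := by
  funext k
  simp only [LIinv, Pi.smul_apply, smul_eq_mul, mul_add, Finset.mul_sum]
  congr 1
  exact Finset.sum_congr rfl fun l _ => by ring

/-- The coefficients of the series for `U_I⁻¹`. -/
def uCoeff (P : Data) (k l : ℕ) : ℝ :=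
  (-1) ^ l * (P.minor k / P.minor (k + l + 1)) * ∏ i ∈ Finset.Icc (k + 1) (k + l), P.c i

theorem UIinv_eq (P : Data) (z : ℕ → ℝ) (k : ℕ) :
    P.UIinv z k = ∑' l, P.uCoeff k l * z (k + l) := rfl

/-- The tridiagonal tail `L_I U_I`. -/
def tri (P : Data) (x : ℕ → ℝ) : ℕ → ℝ
  | 0 => P.b 1 * x 0 + P.c 1 * x 1
  | k + 1 => P.a (k + 2) * x k + P.b (k + 2) * x (k + 1) + P.c (k + 2) * x (k + 2)

namespace Regular

variable {P : Data} {C₂ : ℝ}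

/-- Forward substitution for `L_I`; the later facts about `L_I⁻¹` are inductions on this recurrence.
-/
theorem LIinv_succ (H : P.Regular C₂) (y : ℕ → ℝ) (k : ℕ) :
    P.LIinv y (k + 1)
      = y (k + 1) - P.a (k + 2) * (P.minor k / P.minor (k + 1)) * P.LIinv y k := by
  rw [P.LIinv_eq_sum (H.minor_ne (k + 1)), P.LIinv_eq_sum (H.minor_ne k), Finset.sum_range_succ',
    Finset.mul_sum, sub_eq_add_neg, add_comm, ← Finset.sum_neg_distrib]
  congr 1
  · simp [H.minor_ne (k + 1)]
  · refine Finset.sum_congr rfl fun l hl => ?_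
    have hl' := Finset.mem_range.1 hl
    rw [show k + 1 - (l + 1) = k - l by omega, Finset.prod_Icc_succ_top (by omega)]
    have := H.minor_ne k
    have := H.minor_ne (k + 1)
    field_simp
    ring

/-- One substitution step multiplies by at most `θ |b_{k+2}| / |b_{k+1}|`, so after division by the
diagonal it is a contraction with factor `θ`. -/
theorem abs_LIinv_le (H : P.Regular C₂) (y : ℕ → ℝ) (k : ℕ) :
    |P.LIinv y k| ≤ |P.b (k + 1)| *
      ∑ j ∈ Finset.range (k + 1), P.θ ^ (k - j) * (|y j| / |P.b (j + 1)|) := by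
  induction k with
  | zero =>
    have := (H.b_pos 0).ne'
    simp only [zero_add] at this
    simp [LIinv_zero]
    field_simp
    exact le_rfl
  | succ k ih =>
    have hb := H.b_pos (k + 1)
    have hb' := H.b_pos k
    have hsum : ∑ j ∈ Finset.range (k + 1 + 1), P.θ ^ (k + 1 - j) * (|y j| / |P.b (j + 1)|)
        = |y (k + 1)| / |P.b (k + 2)|
          + P.θ * ∑ j ∈ Finset.range (k + 1), P.θ ^ (k - j) * (|y j| / |P.b (j + 1)|) := by
      rw [Finset.sum_range_succ, Finset.mul_sum, add_comm]
      congr 1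
      · simp
      · refine Finset.sum_congr rfl fun j hj => ?_
        have hj' := Finset.mem_range.1 hj
        rw [show k + 1 - j = (k - j) + 1 by omega, pow_succ]
        ring
    rw [H.LIinv_succ, hsum]
    set u := ∑ j ∈ Finset.range (k + 1), P.θ ^ (k - j) * (|y j| / |P.b (j + 1)|)
    have h1 : |P.a (k + 2) * (P.minor k / P.minor (k + 1)) * P.LIinv y k|
        ≤ (P.θ * P.γ * |P.b (k + 2)|) * (1 / (P.γ * |P.b (k + 1)|)) * (|P.b (k + 1)| * u) := by
      rw [abs_mul, abs_mul]
      refine mul_le_mul (mul_le_mul (H.a_le (k + 1)) (H.minor_ratio_le k) (abs_nonneg _) ?_) ih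
        (abs_nonneg _) ?_
      · have := H.θ_pos; have := H.γ_pos; positivity
      · have := H.θ_pos; have := H.γ_pos; positivity
    have h2 : (P.θ * P.γ * |P.b (k + 2)|) * (1 / (P.γ * |P.b (k + 1)|)) * (|P.b (k + 1)| * u)
        = |P.b (k + 2)| * (P.θ * u) := by
      have := H.γ_pos.ne'
      field_simp
    have h3 : |P.b (k + 2)| * (|y (k + 1)| / |P.b (k + 2)|) = |y (k + 1)| :=
      mul_div_cancel₀ _ hb.ne'
    calc _ ≤ |y (k + 1)| + |P.a (k + 2) * (P.minor k / P.minor (k + 1)) * P.LIinv y k| :=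
          abs_sub _ _
      _ ≤ |y (k + 1)| + |P.b (k + 2)| * (P.θ * u) := by linarith
      _ = _ := by rw [mul_add]; linarith

/-- The tail is `L_I U_I`, so what remains is the bidiagonal `U_I x`. -/
theorem LIinv_tri (H : P.Regular C₂) (x : ℕ → ℝ) (k : ℕ) :
    P.LIinv (P.tri x) k = P.minor (k + 1) / P.minor k * x k + P.c (k + 1) * x (k + 1) := by
  induction k with
  | zero => simp [LIinv_zero, tri, minor]
  | succ k ih =>
    have h0 := H.minor_ne k
    have h1 := H.minor_ne (k + 1)
    rw [H.LIinv_succ, ih]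
    simp only [tri, minor]
    field_simp
    ring

/-! ### The upper factor -/

theorem uCoeff_zero (P : Data) (k : ℕ) : P.uCoeff k 0 = P.minor k / P.minor (k + 1) := by
  simp [uCoeff]

theorem uCoeff_succ (H : P.Regular C₂) (k l : ℕ) :
    P.uCoeff k (l + 1)
      = -(P.uCoeff k l * P.c (k + l + 1) * (P.minor (k + l + 1) / P.minor (k + l + 2))) := by
  have h1 := H.minor_ne (k + l + 1)
  have h2 := H.minor_ne (k + l + 2)
  unfold uCoeff
  rw [show k + (l + 1) = k + l + 1 by ring, Finset.prod_Icc_succ_top (by omega)]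
  field_simp
  ring

theorem abs_uCoeff_le (H : P.Regular C₂) (k l : ℕ) :
    |P.uCoeff k l| ≤ P.θ ^ l / (P.γ * |P.b (k + l + 1)|) := by
  induction l with
  | zero => simpa [uCoeff_zero] using H.minor_ratio_le k
  | succ l ih =>
    have hθ := H.θ_pos
    have hγ := H.γ_pos
    have hb := H.b_pos (k + l)
    rw [H.uCoeff_succ, abs_neg, abs_mul, abs_mul]
    calc _ ≤ P.θ ^ l / (P.γ * |P.b (k + l + 1)|) * (P.θ * P.γ * |P.b (k + l + 1)|)
          * (1 / (P.γ * |P.b (k + l + 1 + 1)|)) :=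
          mul_le_mul (mul_le_mul ih (H.c_le _) (abs_nonneg _) (by positivity))
            (H.minor_ratio_le _) (abs_nonneg _) (by positivity)
      _ = _ := by
          have := H.b_pos (k + l + 1)
          rw [show k + (l + 1) + 1 = k + l + 1 + 1 by ring, pow_succ]
          field_simp

/-- The factor `|b_{k+l+1}|` in the bound of `L_I⁻¹` cancels against the one in the denominator of
the `U_I⁻¹` coefficient; no growth of the diagonal survives. -/
theorem abs_uCoeff_mul_le (H : P.Regular C₂) (y : ℕ → ℝ) (k l : ℕ) :
    |P.uCoeff k l * P.LIinv y (k + l)| ≤ 1 / P.γ * (P.θ ^ l *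
      ∑ j ∈ Finset.range (k + l + 1), P.θ ^ (k + l - j) * (|y j| / |P.b (j + 1)|)) := by
  have hθ := H.θ_pos
  have hγ := H.γ_pos
  have hb := H.b_pos (k + l)
  rw [abs_mul]
  refine (mul_le_mul (H.abs_uCoeff_le k l) (H.abs_LIinv_le y (k + l)) (abs_nonneg _)
    (by positivity)).trans_eq ?_
  field_simp

/-! ### The inverse of the tail -/

theorem summable_tailInv (H : P.Regular C₂) {y : ℕ → ℝ} {B : ℝ}
    (hy : ∀ j, |y j| / |P.b (j + 1)| ≤ B) (k : ℕ) :
    Summable fun l => P.uCoeff k l * P.LIinv y (k + l) := by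
  have hy' : ∀ j, |(|y j| / |P.b (j + 1)|)| ≤ B := fun j => by
    rw [abs_of_nonneg (by positivity)]; exact hy j
  exact Summable.of_norm_bounded
    ((hasSum_geom_geom H.θ_pos.le H.θ_lt_one hy' k).mul_left (1 / P.γ)).summable
    (fun l => H.abs_uCoeff_mul_le y k l)

theorem abs_tailInv_le (H : P.Regular C₂) {y : ℕ → ℝ} {B : ℝ}
    (hy : ∀ j, |y j| / |P.b (j + 1)| ≤ B) (k : ℕ) :
    |P.tailInv y k| ≤ P.η * greenSum P.θ (fun j => |y j| / |P.b (j + 1)|) k := by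
  have hy' : ∀ j, |(|y j| / |P.b (j + 1)|)| ≤ B := fun j => by
    rw [abs_of_nonneg (by positivity)]; exact hy j
  have hs := (hasSum_geom_geom H.θ_pos.le H.θ_lt_one hy' k).mul_left (1 / P.γ)
  have := tsum_of_norm_bounded (f := fun l => P.uCoeff k l * P.LIinv y (k + l)) hs
    (fun l => H.abs_uCoeff_mul_le y k l)
  rw [Real.norm_eq_abs] at this
  refine this.trans_eq ?_
  have hγ := H.γ_pos.ne'
  have h2 : 1 - P.θ ^ 2 ≠ 0 := by linarith [H.θ_sq_lt_one]
  unfold Data.η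
  field_simp

theorem tailInv_add (H : P.Regular C₂) {y z : ℕ → ℝ} {B B' : ℝ}
    (hy : ∀ j, |y j| / |P.b (j + 1)| ≤ B) (hz : ∀ j, |z j| / |P.b (j + 1)| ≤ B') :
    P.tailInv (y + z) = P.tailInv y + P.tailInv z := by
  funext k
  unfold tailInv
  rw [LIinv_add, Pi.add_apply, UIinv_eq, UIinv_eq, UIinv_eq,
    ← (H.summable_tailInv hy k).tsum_add (H.summable_tailInv hz k)]
  simp only [Pi.add_apply, mul_add]

theorem _root_.TridiagNewton.Data.tailInv_smul (P : Data) (r : ℝ) (y : ℕ → ℝ) :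
    P.tailInv (r • y) = r • P.tailInv y := by
  funext k
  unfold tailInv
  rw [LIinv_smul, Pi.smul_apply, UIinv_eq, UIinv_eq, smul_eq_mul, ← tsum_mul_left]
  simp only [Pi.smul_apply, smul_eq_mul, mul_left_comm]

/-- The series telescopes: each term is `t l - t (l + 1)` with `|t l| ≤ θ^l B`, and `t 0 = x k`.
Only this left-inverse property is needed later, to evaluate `𝒯⁻¹` on the tail of `A† h`. -/
theorem tailInv_tri (H : P.Regular C₂) {x : ℕ → ℝ} {B : ℝ} (hx : ∀ j, |x j| ≤ B) :
    P.tailInv (P.tri x) = x := by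
  funext k
  unfold tailInv
  rw [UIinv_eq]
  set t : ℕ → ℝ := fun l =>
    P.uCoeff k l * (P.minor (k + l + 1) / P.minor (k + l)) * x (k + l) with ht
  have hterm : ∀ l, P.uCoeff k l * P.LIinv (P.tri x) (k + l) = t l - t (l + 1) := fun l => by
    have h0 := H.minor_ne (k + l)
    have h1 := H.minor_ne (k + l + 1)
    have h2 := H.minor_ne (k + l + 2)
    simp only [ht]
    rw [H.LIinv_tri, H.uCoeff_succ, show k + (l + 1) = k + l + 1 by ring]
    field_simp
    ring
  have hc : ∀ l, |P.uCoeff k l * (P.minor (k + l + 1) / P.minor (k + l))| ≤ P.θ ^ l := by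
    intro l
    induction l with
    | zero =>
      have h0 := H.minor_ne k
      have h1 := H.minor_ne (k + 1)
      simp only [uCoeff_zero, add_zero, pow_zero]
      rw [div_mul_div_cancel₀ h1, div_self h0, abs_one]
    | succ l ih =>
      have h1 := H.minor_ne (k + l + 1)
      have h0 := H.minor_ne (k + l)
      have h2 := H.minor_ne (k + l + 2)
      have hb := H.b_pos (k + l)
      have hθ := H.θ_pos
      have hγ := H.γ_pos
      have e : P.uCoeff k (l + 1) * (P.minor (k + (l + 1) + 1) / P.minor (k + (l + 1)))
          = -((P.uCoeff k l * (P.minor (k + l + 1) / P.minor (k + l))) *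
            (P.c (k + l + 1) * (P.minor (k + l) / P.minor (k + l + 1)))) := by
        rw [H.uCoeff_succ, show k + (l + 1) = k + l + 1 by ring]
        field_simp
      rw [e, abs_neg, abs_mul, abs_mul (P.c _), pow_succ]
      refine mul_le_mul ih ?_ (by positivity) (by positivity)
      calc _ ≤ (P.θ * P.γ * |P.b (k + l + 1)|) * (1 / (P.γ * |P.b (k + l + 1)|)) :=
            mul_le_mul (H.c_le _) (H.minor_ratio_le _) (abs_nonneg _) (by positivity)
        _ = P.θ := by field_simp
  have hts : Summable t := by
    refine Summable.of_norm_bounded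
      ((summable_geometric_of_lt_one H.θ_pos.le H.θ_lt_one).mul_right B) (fun l => ?_)
    rw [Real.norm_eq_abs, abs_mul]
    exact mul_le_mul (hc l) (hx _) (abs_nonneg _) (pow_nonneg H.θ_pos.le _)
  simp only [hterm]
  rw [hts.tsum_sub ((summable_nat_add_iff 1).2 hts), hts.tsum_eq_zero_add]
  have h0 := H.minor_ne k
  have h1 := H.minor_ne (k + 1)
  simp only [ht, uCoeff_zero, add_zero]
  field_simp
  ring

/-! ### The vector `w` -/

theorem single_div_b (P : Data) :
    (fun j => |(Pi.single 0 1 : ℕ → ℝ) j| / |P.b (j + 1)|)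
      = fun j => if j = 0 then 1 / |P.mu P.m| else 0 := by
  funext j
  rcases j with _ | j
  · simp [b]
  · simp

theorem single_bdd (P : Data) (j : ℕ) :
    |(Pi.single 0 1 : ℕ → ℝ) j| / |P.b (j + 1)| ≤ 1 / |P.mu P.m| := by
  rw [congrFun (single_div_b P) j]
  split_ifs
  · exact le_rfl
  · positivity

theorem abs_wI_le (H : P.Regular C₂) (k : ℕ) : |P.wI k| ≤ P.η * P.θ ^ k / |P.mu P.m| := by
  have := H.abs_tailInv_le (single_bdd P) k
  rw [single_div_b, greenSum_single] at this
  refine this.trans_eq ?_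
  ring

theorem LIinv_single (H : P.Regular C₂) (k : ℕ) :
    P.LIinv (Pi.single 0 1) k
      = (-1) ^ k * (∏ i ∈ Finset.Icc 2 (k + 1), P.a i) * (1 / P.minor k) := by
  induction k with
  | zero => simp [LIinv_zero, minor]
  | succ k ih =>
    have h0 := H.minor_ne k
    have h1 := H.minor_ne (k + 1)
    rw [H.LIinv_succ, ih,
      show ∏ i ∈ Finset.Icc 2 (k + 1 + 1), P.a i = (∏ i ∈ Finset.Icc 2 (k + 1), P.a i) * P.a (k + 2)
        from Finset.prod_Icc_succ_top (by omega) _, Pi.single_eq_of_ne (by omega), pow_succ]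
    field_simp
    ring

/-- In the row `k = 0` the first ratio `δ_0 / δ_1 = 1 / b_1` is exact and loses no factor `γ`. Hence
the general bound improves by `1 / γ` for the coefficient and there is no `η` in `ε`. The two
kernels together give `θ²` per index. -/
theorem wI_term_le (H : P.Regular C₂) (l : ℕ) :
    |P.uCoeff 0 (l + 1) * P.LIinv (Pi.single 0 1) (l + 1)|
      ≤ (P.θ ^ 2) ^ (l + 1) / |P.mu P.m| := by
  have hγ := H.γ_pos
  have hθ := H.θ_pos
  have hm := H.mu_pos le_rfl
  have hb1 : P.b 1 = P.mu P.m := rfl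
  have hu : ∀ l, |P.uCoeff 0 (l + 1)| ≤ P.θ ^ (l + 1) / |P.b (l + 2)| := by
    intro l
    induction l with
    | zero =>
      have hb := H.b_pos 1
      have e : P.uCoeff 0 1 = -(P.c 1 / P.b 1 * (P.minor 1 / P.minor 2)) := by
        rw [H.uCoeff_succ, uCoeff_zero, show P.minor (0 + 1) = P.b 1 from rfl,
            show P.minor 0 = 1 from rfl]; ring
      rw [zero_add, e, abs_neg, abs_mul, abs_div]
      calc _ ≤ (P.θ * P.γ * |P.b 1|) / |P.b 1| * (1 / (P.γ * |P.b 2|)) :=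
            mul_le_mul (div_le_div_of_nonneg_right (H.c_le 0) (abs_nonneg _)) (H.minor_ratio_le 1)
              (abs_nonneg _) (by positivity)
        _ = _ := by rw [hb1]; field_simp
    | succ l ih =>
      have hb := H.b_pos (l + 1)
      have hb' := H.b_pos (l + 2)
      rw [H.uCoeff_succ, abs_neg, abs_mul, abs_mul]
      simp only [zero_add]
      calc _ ≤ P.θ ^ (l + 1) / |P.b (l + 1 + 1)| * (P.θ * P.γ * |P.b (l + 1 + 1)|)
            * (1 / (P.γ * |P.b (l + 1 + 1 + 1)|)) :=
            mul_le_mul (mul_le_mul ih (H.c_le _) (abs_nonneg _) (by positivity))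
              (H.minor_ratio_le _) (abs_nonneg _) (by positivity)
        _ = _ := by rw [pow_succ P.θ (l + 1)]; field_simp
  have hL : |P.LIinv (Pi.single 0 1) (l + 1)| ≤ |P.b (l + 2)| * P.θ ^ (l + 1) / |P.mu P.m| := by
    refine (H.abs_LIinv_le _ _).trans_eq ?_
    simp only [congrFun (single_div_b P) _]
    simp [div_eq_mul_inv, mul_assoc]
  have hb := H.b_pos (l + 1)
  rw [abs_mul]
  refine (mul_le_mul (hu l) hL (abs_nonneg _) (by positivity)).trans_eq ?_
  rw [← pow_mul, two_mul, pow_add]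
  field_simp
  ring

/-- `w̃` is the partial sum with `L` terms of the series for `w_0`; the signs `(-1)^l` of the two
factors cancel. -/
theorem wTilde_eq (H : P.Regular C₂) (hL : 1 ≤ P.L) :
    P.wTilde = ∑ l ∈ Finset.range P.L, P.uCoeff 0 l * P.LIinv (Pi.single 0 1) l := by
  obtain ⟨n, hn⟩ : ∃ n, P.L = n + 1 := ⟨P.L - 1, by omega⟩
  unfold wTilde
  rw [hn, Finset.sum_range_succ', Nat.add_sub_cancel, add_comm]
  congr 1
  · rw [Finset.range_eq_Ico, Finset.sum_Ico_add'
      (fun l => P.uCoeff 0 l * P.LIinv (Pi.single 0 1) l) 0 n 1, zero_add]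
    refine Finset.sum_congr (by ext; simp) fun l hl => ?_
    have h1 := H.minor_ne l
    have h2 := H.minor_ne (l + 1)
    rw [H.LIinv_single]
    simp only [uCoeff, zero_add]
    have hm : ((-1 : ℝ) ^ l) * (-1) ^ l = 1 := by rw [← mul_pow]; simp
    simp only [minor]
    field_simp
    linear_combination (-(∏ i ∈ Finset.Icc 1 l, P.c i) * ∏ i ∈ Finset.Icc 2 (l + 1), P.a i) * hm
  · simp [uCoeff_zero, LIinv_zero]

theorem abs_wI_sub_wTilde_le (H : P.Regular C₂) (hL : 1 ≤ P.L) :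
    |P.wI 0 - P.wTilde| ≤ P.θ ^ (2 * P.L) / (|P.mu P.m| * (1 - P.θ ^ 2)) := by
  have hs := H.summable_tailInv (single_bdd P) 0
  have h1 : P.wI 0 - P.wTilde
      = ∑' l, P.uCoeff 0 (l + P.L) * P.LIinv (Pi.single 0 1) (l + P.L) := by
    have e := hs.sum_add_tsum_nat_add P.L
    simp only [zero_add] at e
    have e2 : P.wI 0 = ∑' l, P.uCoeff 0 l * P.LIinv (Pi.single 0 1) l := by
      simp only [wI, tailInv, UIinv_eq, zero_add]
    rw [H.wTilde_eq hL, e2, ← e]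
    ring
  have hg := ((hasSum_geometric_of_lt_one (sq_nonneg P.θ) H.θ_sq_lt_one).mul_left
    ((P.θ ^ 2) ^ P.L / |P.mu P.m|))
  rw [h1, ← Real.norm_eq_abs]
  refine (tsum_of_norm_bounded hg fun l => ?_).trans_eq ?_
  · obtain ⟨n, hn⟩ : ∃ n, l + P.L = n + 1 := ⟨l + P.L - 1, by omega⟩
    rw [hn, Real.norm_eq_abs]
    refine (H.wI_term_le n).trans_eq ?_
    rw [← hn, pow_add]
    ring
  · rw [← pow_mul, div_mul_eq_div_div, div_eq_mul_inv _ (1 - P.θ ^ 2)]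

end Regular

end Data

/-! ### Zeta sums -/

theorem summable_one_div_rpow {s : ℝ} (hs : 1 < s) :
    Summable fun l : ℕ => 1 / ((l : ℝ) + 1) ^ s := by
  have := (summable_nat_add_iff 1).2 (Real.summable_one_div_nat_rpow.2 hs)
  simpa using this

/-- `∑_{l > n} l^{-s} ≤ n^{1-s} / (s - 1)`. -/
theorem tsum_tail_le {s : ℝ} (hs : 1 < s) {n : ℕ} (hn : 1 ≤ n) :
    ∑' l : ℕ, 1 / (((l + n : ℕ) : ℝ) + 1) ^ s ≤ 1 / ((s - 1) * (n : ℝ) ^ (s - 1)) := by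
  have hstep : ∀ k : ℕ, 1 ≤ k → 1 / ((k : ℝ) + 1) ^ s
      ≤ 1 / ((s - 1) * (k : ℝ) ^ (s - 1)) - 1 / ((s - 1) * ((k : ℝ) + 1) ^ (s - 1)) := by
    intro k hk
    have hk' : (0 : ℝ) < k := by exact_mod_cast hk
    have h1 : 0 < s - 1 := by linarith
    set x : ℝ := (k : ℝ) + 1 with hx
    have hx0 : 0 < x := by positivity
    have hlog := Real.one_sub_inv_le_log_of_pos (div_pos hx0 hk')
    -- From `e^t ≥ 1 + t` and `log (x / k) ≥ 1 - k / x = 1 / x`.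
    have hexp : 1 + (s - 1) * (1 / x) ≤ (x / k) ^ (s - 1) := by
      rw [Real.rpow_def_of_pos (div_pos hx0 hk')]
      have h2 := Real.add_one_le_exp (Real.log (x / k) * (s - 1))
      have h3 : 1 - (x / k)⁻¹ = 1 / x := by rw [inv_div, hx]; field_simp; ring
      rw [h3] at hlog
      nlinarith
    rw [Real.div_rpow hx0.le hk'.le, le_div_iff₀ (by positivity)] at hexp
    have hxs : x ^ s = x ^ (s - 1) * x := by
      rw [← Real.rpow_add_one hx0.ne']; ring_nf
    have hp : 0 < x ^ (s - 1) := by positivity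
    have hq : 0 < (k : ℝ) ^ (s - 1) := by positivity
    rw [hxs, div_sub_div _ _ (by positivity) (by positivity), div_le_div_iff₀ (by positivity)
      (by positivity)]
    have h4 : x * (k : ℝ) ^ (s - 1) + (s - 1) * (k : ℝ) ^ (s - 1) ≤ x * x ^ (s - 1) := by
      have := mul_le_mul_of_nonneg_left hexp hx0.le
      field_simp at this
      nlinarith
    nlinarith [mul_le_mul_of_nonneg_left h4 (mul_pos h1 hp).le]
  refine Real.tsum_le_of_sum_range_le (fun l => by positivity) fun N => ?_
  have h : ∀ N : ℕ, ∑ i ∈ Finset.range N, 1 / (((i + n : ℕ) : ℝ) + 1) ^ s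
      ≤ 1 / ((s - 1) * (n : ℝ) ^ (s - 1)) - 1 / ((s - 1) * ((n + N : ℕ) : ℝ) ^ (s - 1)) := by
    intro N
    induction N with
    | zero => simp
    | succ N ih =>
      rw [Finset.sum_range_succ]
      have := hstep (N + n) (by omega)
      push_cast at this ih ⊢
      rw [show (n : ℝ) + (N + 1) = N + n + 1 by ring]
      rw [show (n : ℝ) + N = N + n by ring] at ih
      linarith
  have h2 : 0 ≤ 1 / ((s - 1) * ((n + N : ℕ) : ℝ) ^ (s - 1)) := by
    have : 0 < s - 1 := by linarith
    positivity
  linarith [h N]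

theorem two_mul_tsum_le_zetaUp {s : ℝ} (hs : 1 < s) {L : ℕ} (hL : 1 ≤ L) :
    2 * ∑' l : ℕ, 1 / ((l : ℝ) + 1) ^ s ≤ zetaUp s L := by
  rw [← (summable_one_div_rpow hs).sum_add_tsum_nat_add L]
  have h := tsum_tail_le hs hL
  have e : ∑ l ∈ Finset.Icc 1 L, 1 / (l : ℝ) ^ s = ∑ l ∈ Finset.range L, 1 / ((l : ℝ) + 1) ^ s := by
    rw [Finset.range_eq_Ico]
    have := Finset.sum_Ico_add' (fun l : ℕ => 1 / (l : ℝ) ^ s) 0 L 1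
    push_cast at this
    rw [this]
    exact Finset.sum_congr (by ext; simp) fun _ _ => rfl
  unfold zetaUp
  rw [e, show 2 / ((s - 1) * (L : ℝ) ^ (s - 1)) = 2 * (1 / ((s - 1) * (L : ℝ) ^ (s - 1))) by ring]
  linarith

theorem sum_le_tsum_rpow {s : ℝ} (hs : 1 < s) (n : ℕ) :
    ∑ l ∈ Finset.Icc 1 n, 1 / (l : ℝ) ^ s ≤ ∑' l : ℕ, 1 / ((l : ℝ) + 1) ^ s := by
  have e : ∑ l ∈ Finset.Icc 1 n, 1 / (l : ℝ) ^ s = ∑ l ∈ Finset.range n, 1 / ((l : ℝ) + 1) ^ s := by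
    rw [Finset.range_eq_Ico]
    have := Finset.sum_Ico_add' (fun l : ℕ => 1 / (l : ℝ) ^ s) 0 n 1
    push_cast at this
    rw [this]
    exact Finset.sum_congr (by ext; simp) fun _ _ => rfl
  rw [e]
  exact (summable_one_div_rpow hs).sum_le_tsum _ fun _ _ => by positivity

/-! ### Estimates for the convolution -/

/-- `∑_{n=0}^k ω_k / (ω_n ω_{k-n})`. -/
def convWeight (s : ℝ) (k : ℕ) : ℝ :=
  ∑ n ∈ Finset.range (k + 1), wt s k / (wt s n * wt s (k - n))

/-- The terms of the convolution of the sequence `1 / ω` with itself, multiplied by `ω_k`. -/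
def convTerm (s : ℝ) (k : ℕ) (j : ℤ) : ℝ :=
  wt s k / (wt s j.natAbs * wt s ((k : ℤ) - j).natAbs)

theorem convTerm_nonneg (s : ℝ) (k : ℕ) (j : ℤ) : 0 ≤ convTerm s k j :=
  div_nonneg (wt_pos _ _).le (mul_pos (wt_pos _ _) (wt_pos _ _)).le

/-- For negative `j` one has `|k - j| ≥ k`, so one weight of the denominator absorbs `ω_k`. The
range `j > k` is symmetric; the two outer ranges give the two zeta sums in `zetaUp`. -/
theorem convTerm_neg_le {s : ℝ} (hs : 0 ≤ s) (k n : ℕ) :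
    convTerm s k (-((n : ℤ) + 1)) ≤ 1 / ((n : ℝ) + 1) ^ s := by
  have e1 : (-((n : ℤ) + 1)).natAbs = n + 1 := by omega
  have e2 : ((k : ℤ) - -((n : ℤ) + 1)).natAbs = k + n + 1 := by omega
  have h1 : ((n : ℝ) + 1) ^ s = wt s (n + 1) := by rw [wt_eq_rpow s (by omega)]; push_cast; rfl
  have hw := wt_mono hs (show k ≤ k + n + 1 by omega)
  have hn := wt_pos s (n + 1)
  have hk := wt_pos s (k + n + 1)
  rw [convTerm, e1, e2, h1, div_le_div_iff₀ (by positivity) hn]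
  nlinarith

theorem convTerm_add_le {s : ℝ} (hs : 0 ≤ s) (k n : ℕ) :
    convTerm s k ((n + (k + 1) : ℕ) : ℤ) ≤ 1 / ((n : ℝ) + 1) ^ s := by
  have e1 : (((n + (k + 1) : ℕ) : ℤ)).natAbs = k + n + 1 := by omega
  have e2 : ((k : ℤ) - ((n + (k + 1) : ℕ) : ℤ)).natAbs = n + 1 := by omega
  have h1 : ((n : ℝ) + 1) ^ s = wt s (n + 1) := by rw [wt_eq_rpow s (by omega)]; push_cast; rfl
  have hw := wt_mono hs (show k ≤ k + n + 1 by omega)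
  have hn := wt_pos s (n + 1)
  have hk := wt_pos s (k + n + 1)
  rw [convTerm, e1, e2, h1, div_le_div_iff₀ (by positivity) hn]
  nlinarith

theorem summable_convTerm_neg {s : ℝ} (hs : 1 < s) (k : ℕ) :
    Summable fun n : ℕ => convTerm s k (-((n : ℤ) + 1)) :=
  Summable.of_nonneg_of_le (fun _ => convTerm_nonneg _ _ _)
    (fun n => convTerm_neg_le (by linarith) k n) (summable_one_div_rpow hs)

theorem summable_convTerm_nat {s : ℝ} (hs : 1 < s) (k : ℕ) :
    Summable fun n : ℕ => convTerm s k n :=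
  (summable_nat_add_iff (k + 1)).1 (Summable.of_nonneg_of_le (fun _ => convTerm_nonneg _ _ _)
    (fun n => convTerm_add_le (by linarith) k n) (summable_one_div_rpow hs))

theorem summable_convTerm {s : ℝ} (hs : 1 < s) (k : ℕ) : Summable (convTerm s k) :=
  Summable.of_nat_of_neg_add_one (summable_convTerm_nat hs k) (summable_convTerm_neg hs k)

theorem tsum_convTerm_le {s : ℝ} (hs : 1 < s) {L : ℕ} (hL : 1 ≤ L) (k : ℕ) :
    ∑' j, convTerm s k j ≤ convWeight s k + zetaUp s L := by
  have hZ := two_mul_tsum_le_zetaUp hs hL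
  have hnat := summable_convTerm_nat hs k
  rw [tsum_of_nat_of_neg_add_one hnat (summable_convTerm_neg hs k),
    ← hnat.sum_add_tsum_nat_add (k + 1)]
  have h1 := (summable_convTerm_neg hs k).tsum_le_tsum
    (fun n => convTerm_neg_le (by linarith) k n) (summable_one_div_rpow hs)
  have h2 := ((summable_nat_add_iff (k + 1)).2 hnat).tsum_le_tsum
    (fun n => convTerm_add_le (by linarith) k n) (summable_one_div_rpow hs)
  have h3 : ∑ n ∈ Finset.range (k + 1), convTerm s k n = convWeight s k := by
    refine Finset.sum_congr rfl fun n hn => ?_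
    have := Finset.mem_range.1 hn
    rw [convTerm, show ((k : ℤ) - n).natAbs = k - n by omega, Int.natAbs_natCast]
  linarith

theorem abs_conv_term_le {s : ℝ} (x y : Omega s) (k : ℕ) (j : ℤ) :
    |x j.natAbs * y ((k : ℤ) - j).natAbs| ≤ ‖x‖ * ‖y‖ / wt s k * convTerm s k j := by
  rw [abs_mul]
  refine (mul_le_mul (x.abs_le _) (y.abs_le _) (abs_nonneg _)
    (div_nonneg (norm_nonneg _) (wt_pos _ _).le)).trans_eq ?_
  have h1 := (wt_pos s k).ne'
  have h2 := (wt_pos s j.natAbs).ne'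
  have h3 := (wt_pos s ((k : ℤ) - j).natAbs).ne'
  unfold convTerm
  field_simp

theorem summable_conv {s : ℝ} (hs : 1 < s) (x y : Omega s) (k : ℕ) :
    Summable fun j : ℤ => x j.natAbs * y ((k : ℤ) - j).natAbs :=
  Summable.of_norm_bounded ((summable_convTerm hs k).mul_left _) (abs_conv_term_le x y k)

theorem abs_conv_le {s : ℝ} (hs : 1 < s) {L : ℕ} (hL : 1 ≤ L) (x y : Omega s) (k : ℕ) :
    |conv x y k| ≤ (convWeight s k + zetaUp s L) * ‖x‖ * ‖y‖ / wt s k := by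
  have := tsum_of_norm_bounded (f := fun j : ℤ => x j.natAbs * y ((k : ℤ) - j).natAbs)
    ((summable_convTerm hs k).hasSum.mul_left _) (abs_conv_term_le x y k)
  refine (this.trans (mul_le_mul_of_nonneg_left (tsum_convTerm_le hs hL k)
    (div_nonneg (by positivity) (wt_pos _ _).le))).trans_eq ?_
  ring

/-- The substitution `j ↦ k - j`; as a bijection of `ℤ` it needs no summability. -/
theorem conv_comm (x y : ℕ → ℝ) (k : ℕ) : conv x y k = conv y x k := by
  unfold conv
  rw [← (Equiv.subLeft (k : ℤ)).tsum_eq]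
  refine tsum_congr fun j => ?_
  simp [mul_comm]

theorem conv_add_right {s : ℝ} (hs : 1 < s) (x y z : Omega s) (k : ℕ) :
    conv x (y + z : Omega s) k = conv x y k + conv x z k := by
  unfold conv
  rw [← (summable_conv hs x y k).tsum_add (summable_conv hs x z k)]
  exact tsum_congr fun j => mul_add _ _ _

theorem conv_smul_right {s : ℝ} (x y : Omega s) (c : ℝ) (k : ℕ) :
    conv x (c • y : Omega s) k = c * conv x y k := by
  unfold conv
  rw [← tsum_mul_left]
  exact tsum_congr fun j => mul_left_comm _ _ _

/-! ### The constants `α` -/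

theorem convWeight_zero (s : ℝ) : convWeight s 0 = 1 := by simp [convWeight, wt_zero_exp]

theorem convWeight_eq (s : ℝ) {k : ℕ} (hk : k ≠ 0) :
    convWeight s k = 2 +
      ∑ l ∈ Finset.Icc 1 (k - 1), (k : ℝ) ^ s / ((l : ℝ) ^ s * ((k : ℝ) - (l : ℝ)) ^ s) := by
  obtain ⟨n, rfl⟩ := Nat.exists_eq_succ_of_ne_zero hk
  have h0 := (wt_pos s (n + 1)).ne'
  have e : ∑ l ∈ Finset.Icc 1 n, ((n + 1 : ℕ) : ℝ) ^ s / ((l : ℝ) ^ s * (((n + 1 : ℕ) : ℝ) - l) ^ s)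
      = ∑ l ∈ Finset.range n, wt s (n + 1) / (wt s (l + 1) * wt s (n + 1 - (l + 1))) := by
    rw [Finset.range_eq_Ico, Finset.sum_Ico_add'
      (fun l => wt s (n + 1) / (wt s l * wt s (n + 1 - l))) 0 n 1]
    refine Finset.sum_congr (by ext; simp) fun l hl => ?_
    rw [Finset.mem_Ico] at hl
    rw [wt_eq_rpow s (by omega), wt_eq_rpow s (by omega), wt_eq_rpow s (by omega),
      Nat.cast_sub (by omega)]
  simp only [Nat.succ_eq_add_one, Nat.add_sub_cancel]
  rw [e, convWeight, Finset.sum_range_succ', Finset.sum_range_succ]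
  simp [wt_zero_exp, h0]
  ring

theorem convWeight_add_zetaUp_eq_alpha (s : ℝ) (L : ℕ) {n k : ℕ} (hk : k < n) :
    convWeight s k + zetaUp s L = alpha s L n k := by
  unfold alpha
  split_ifs with h
  · rw [h, convWeight_zero]
  · rw [convWeight_eq s h]; ring

theorem sum_reflect_Icc (f : ℕ → ℝ) {i k : ℕ} (h : i ≤ k) :
    ∑ l ∈ Finset.Icc i (k - i), f (k - l) = ∑ l ∈ Finset.Icc i (k - i), f l := by
  refine Finset.sum_nbij' (k - ·) (k - ·) ?_ ?_ ?_ ?_ ?_ <;>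
    simp only [Finset.mem_Icc] <;> intros <;> first | omega | trivial

theorem add_rpow_le {a b p : ℝ} (ha : 0 ≤ a) (hb : 0 ≤ b) (hp : 1 ≤ p) :
    (a + b) ^ p ≤ 2 ^ (p - 1) * (a ^ p + b ^ p) := by
  have := NNReal.rpow_add_le_mul_rpow_add_rpow ⟨a, ha⟩ ⟨b, hb⟩ hp
  exact_mod_cast this

/-- Partial fractions, `k / (l (k - l)) = 1 / l + 1 / (k - l)`; both bounds on the inner sum start
here. -/
theorem rpow_div_eq {s : ℝ} {k l : ℕ} (hl : 1 ≤ l) (hlk : l + 1 ≤ k) :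
    (k : ℝ) ^ s / ((l : ℝ) ^ s * ((k : ℝ) - (l : ℝ)) ^ s)
      = (1 / (l : ℝ) + 1 / ((k - l : ℕ) : ℝ)) ^ s := by
  have h1 : (0 : ℝ) < l := by exact_mod_cast hl
  have h2 : (0 : ℝ) < ((k - l : ℕ) : ℝ) := by exact_mod_cast (by omega : 0 < k - l)
  rw [← Nat.cast_sub (by omega), ← Real.mul_rpow h1.le h2.le,
    ← Real.div_rpow (by positivity) (by positivity)]
  congr 1
  have : (k : ℝ) = l + ((k - l : ℕ) : ℝ) := by exact_mod_cast (by omega : k = l + (k - l))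
  rw [this]
  field_simp
  simp [add_comm]

/-- Convexity of `t^s` separates the two partial fractions, and reflection `l ↦ k - l` identifies
their sums. -/
theorem sum_Icc_le_of_lt_two {s : ℝ} (hs : 1 < s) {L : ℕ} (hL : 1 ≤ L) {k : ℕ} (hk : 1 ≤ k) :
    ∑ l ∈ Finset.Icc 1 (k - 1), (k : ℝ) ^ s / ((l : ℝ) ^ s * ((k : ℝ) - (l : ℝ)) ^ s)
      ≤ 2 ^ (s - 1) * zetaUp s L := by
  have h1 : ∀ l ∈ Finset.Icc 1 (k - 1),
      (k : ℝ) ^ s / ((l : ℝ) ^ s * ((k : ℝ) - (l : ℝ)) ^ s)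
        ≤ 2 ^ (s - 1) * (1 / (l : ℝ) ^ s + 1 / ((k - l : ℕ) : ℝ) ^ s) := by
    intro l hl
    rw [Finset.mem_Icc] at hl
    rw [rpow_div_eq hl.1 (by omega)]
    refine (add_rpow_le (by positivity) (by positivity) hs.le).trans_eq ?_
    rw [Real.div_rpow (by positivity) (by positivity), Real.div_rpow (by positivity) (by positivity),
      Real.one_rpow]
  refine (Finset.sum_le_sum h1).trans ?_
  rw [← Finset.mul_sum, Finset.sum_add_distrib, sum_reflect_Icc (fun l => 1 / (l : ℝ) ^ s) hk]
  refine mul_le_mul_of_nonneg_left ?_ (by positivity)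
  linarith [sum_le_tsum_rpow hs (k - 1), two_mul_tsum_le_zetaUp hs hL]

theorem sum_one_div_le_log (n : ℕ) : ∑ l ∈ Finset.Icc 2 (n + 1), 1 / (l : ℝ) ≤ Real.log (n + 1) := by
  induction n with
  | zero => simp
  | succ n ih =>
    rw [Finset.sum_Icc_succ_top (by omega)]
    have h := Real.one_sub_inv_le_log_of_pos (show (0 : ℝ) < ((n : ℝ) + 2) / (n + 1) by positivity)
    rw [Real.log_div (by positivity) (by positivity)] at h
    have e : 1 - (((n : ℝ) + 2) / (n + 1))⁻¹ = 1 / (n + 2) := by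
      rw [inv_div]; field_simp; ring
    push_cast
    rw [show (n : ℝ) + 1 + 1 = n + 2 by ring]
    linarith

theorem sum_one_div_sq_le (n : ℕ) :
    ∑ l ∈ Finset.Icc 2 n, 1 / (l : ℝ) ^ 2 ≤ Real.pi ^ 2 / 6 - 1 := by
  have h := sum_le_hasSum (insert 1 (Finset.Icc 2 n)) (fun l _ => by positivity) hasSum_zeta_two
  rw [Finset.sum_insert (by simp)] at h
  simp only [Nat.cast_one, one_pow, div_one] at h
  linarith

/-- The step from `k` to `k + 1` follows from `k / (k - 2) ≤ log (k - 2)`. This holds for `k ≥ 7`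
but not at `k = 6`. -/
theorem log_sub_two_div_antitone {m k : ℕ} (hm : 6 ≤ m) (hk : m ≤ k) :
    Real.log ((k : ℝ) - 2) / k ≤ Real.log ((m : ℝ) - 2) / m := by
  induction k, hk using Nat.le_induction with
  | base => exact le_rfl
  | succ k hk ih =>
    refine le_trans ?_ ih
    have hk6 : 6 ≤ k := hm.trans hk
    have hk' : (6 : ℝ) ≤ k := by exact_mod_cast hk6
    rw [div_le_div_iff₀ (by positivity) (by positivity)]
    push_cast
    rcases hk6.eq_or_lt with rfl | h7
    -- The exceptional step from `6` to `7` is the numerical fact `5^6 ≤ 4^7`.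
    · have h1 : Real.log ((5 : ℝ) ^ 6) ≤ Real.log ((4 : ℝ) ^ 7) :=
        Real.log_le_log (by norm_num) (by norm_num)
      rw [Real.log_pow, Real.log_pow] at h1
      norm_num at h1 ⊢
      linarith
    · have h7' : (7 : ℝ) ≤ k := by exact_mod_cast h7
      have h1 : Real.log ((k : ℝ) + 1 - 2) ≤ Real.log ((k : ℝ) - 2) + 1 / ((k : ℝ) - 2) := by
        have h2 : (k : ℝ) + 1 - 2 = ((k : ℝ) - 2) * (1 + 1 / ((k : ℝ) - 2)) := by
          have : (k : ℝ) - 2 ≠ 0 := by linarith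
          field_simp; ring
        have h3 : 0 < 1 / ((k : ℝ) - 2) := by apply one_div_pos.2; linarith
        rw [h2, Real.log_mul (by linarith) (by linarith)]
        linarith [Real.log_le_sub_one_of_pos (show 0 < 1 + 1 / ((k : ℝ) - 2) by linarith)]
      have h4 : (k : ℝ) * (1 / ((k : ℝ) - 2)) ≤ 7 / 5 := by
        rw [mul_one_div, div_le_div_iff₀ (by linarith) (by norm_num)]
        linarith
      have h5 : (7 : ℝ) / 5 ≤ Real.log ((k : ℝ) - 2) := by
        have h6 : Real.log 5 ≤ Real.log ((k : ℝ) - 2) := Real.log_le_log (by norm_num) (by linarith)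
        have h8 : 2 * Real.log 2 + Real.log (5 / 4) = Real.log 5 := by
          rw [show (5 : ℝ) = 2 ^ 2 * (5 / 4) by norm_num, Real.log_mul (by norm_num) (by norm_num),
            Real.log_pow]
          norm_num
        have h9 := Real.one_sub_inv_le_log_of_pos (show (0 : ℝ) < 5 / 4 by norm_num)
        norm_num at h9
        linarith [Real.log_two_gt_d9]
      nlinarith [mul_le_mul_of_nonneg_left h1 (show (0 : ℝ) ≤ k by linarith)]

/-- The end terms `l = 1` and `l = k - 1` are kept apart. In between, `(1/u + 1/v)^s` is split into
a square and an `(s - 2)`-th power. The square expands, using `u + v = k`, into sums controlled by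
`ζ(2)` and the logarithm; the power is bounded by its extreme value. -/
theorem sum_Icc_le_of_two_le {s : ℝ} (hs : 2 ≤ s) {m k : ℕ} (hm : 6 ≤ m) (hk : m ≤ k) :
    ∑ l ∈ Finset.Icc 1 (k - 1), (k : ℝ) ^ s / ((l : ℝ) ^ s * ((k : ℝ) - (l : ℝ)) ^ s)
      ≤ 2 * ((m : ℝ) / ((m : ℝ) - 1)) ^ s
        + (4 * Real.log ((m : ℝ) - 2) / (m : ℝ) + (Real.pi ^ 2 - 6) / 3)
          * (2 / (m : ℝ) + 1 / 2) ^ (s - 2) := by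
  have hm' : (6 : ℝ) ≤ m := by exact_mod_cast hm
  have hk' : (m : ℝ) ≤ k := by exact_mod_cast hk
  set F : ℕ → ℝ := fun l => (k : ℝ) ^ s / ((l : ℝ) ^ s * ((k : ℝ) - (l : ℝ)) ^ s) with hF
  have hsplit : ∑ l ∈ Finset.Icc 1 (k - 1), F l
      = F 1 + F (k - 1) + ∑ l ∈ Finset.Icc 2 (k - 2), F l := by
    obtain ⟨n, rfl⟩ : ∃ n, k = n + 3 := ⟨k - 3, by omega⟩
    rw [show n + 3 - 1 = n + 1 + 1 by omega, Finset.sum_Icc_succ_top (by omega),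
      ← Finset.add_sum_Ioc_eq_sum_Icc (by omega), show n + 3 - 2 = n + 1 by omega,
      show Finset.Ioc 1 (n + 1) = Finset.Icc 2 (n + 1) from rfl]
    ring
  have hend : ((k : ℝ) / ((k : ℝ) - 1)) ^ s ≤ ((m : ℝ) / ((m : ℝ) - 1)) ^ s := by
    refine Real.rpow_le_rpow (div_nonneg (by linarith) (by linarith)) ?_ (by linarith)
    rw [div_le_div_iff₀ (by linarith) (by linarith)]
    nlinarith
  have hF1 : F 1 = ((k : ℝ) / ((k : ℝ) - 1)) ^ s := by
    simp only [hF, Nat.cast_one, Real.one_rpow, one_mul]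
    rw [Real.div_rpow (by linarith) (by linarith)]
  have hF2 : F (k - 1) = ((k : ℝ) / ((k : ℝ) - 1)) ^ s := by
    simp only [hF]
    rw [Nat.cast_sub (by omega), Nat.cast_one, sub_sub_cancel, Real.one_rpow, mul_one,
      Real.div_rpow (by linarith) (by linarith)]
  have hmid : ∀ l ∈ Finset.Icc 2 (k - 2), F l
      ≤ (1 / (l : ℝ) ^ 2 + 1 / ((k - l : ℕ) : ℝ) ^ 2
          + 2 / k * (1 / (l : ℝ) + 1 / ((k - l : ℕ) : ℝ))) * (2 / (m : ℝ) + 1 / 2) ^ (s - 2) := by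
    intro l hl
    rw [Finset.mem_Icc] at hl
    have h1 : (2 : ℝ) ≤ l := by exact_mod_cast hl.1
    have h2 : (2 : ℝ) ≤ ((k - l : ℕ) : ℝ) := by exact_mod_cast (by omega : 2 ≤ k - l)
    have h3 : (k : ℝ) = l + ((k - l : ℕ) : ℝ) := by exact_mod_cast (by omega : k = l + (k - l))
    simp only [hF]
    rw [rpow_div_eq (by omega) (by omega)]
    set u : ℝ := (l : ℝ)
    set v : ℝ := ((k - l : ℕ) : ℝ)
    have hpos : 0 < 1 / u + 1 / v := by positivity
    have hle : 1 / u + 1 / v ≤ 2 / (m : ℝ) + 1 / 2 := by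
      -- For `u + v = k` and `u, v ≥ 2` the maximum is attained at `u = 2`, `v = k - 2`.
      have h4 : 1 / u + 1 / v ≤ 1 / 2 + 1 / (k - 2 : ℝ) := by
        rw [div_add_div _ _ (by positivity) (by positivity),
          div_add_div _ _ (by norm_num) (by linarith),
          div_le_div_iff₀ (by positivity) (by nlinarith), h3]
        nlinarith [mul_nonneg (sub_nonneg.2 h1) (sub_nonneg.2 h2)]
      have h5 : 1 / (k - 2 : ℝ) ≤ 2 / m := by
        rw [div_le_div_iff₀ (by linarith) (by linarith)]
        linarith
      linarith
    have e : (1 / u + 1 / v) ^ s = (1 / u + 1 / v) ^ 2 * (1 / u + 1 / v) ^ (s - 2) := by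
      rw [← Real.rpow_natCast, ← Real.rpow_add hpos]
      congr 1
      norm_num
    rw [e]
    have e2 : (1 / u + 1 / v) ^ 2 = 1 / u ^ 2 + 1 / v ^ 2 + 2 / k * (1 / u + 1 / v) := by
      rw [h3]; field_simp; ring
    rw [← e2]
    exact mul_le_mul_of_nonneg_left (Real.rpow_le_rpow hpos.le hle (by linarith)) (by positivity)
  have hsum := Finset.sum_le_sum hmid
  rw [← Finset.sum_mul, Finset.sum_add_distrib, Finset.sum_add_distrib, ← Finset.mul_sum,
    Finset.sum_add_distrib, sum_reflect_Icc (fun l => 1 / (l : ℝ) ^ 2) (by omega),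
    sum_reflect_Icc (fun l => 1 / (l : ℝ)) (by omega)] at hsum
  have hlog : ∑ l ∈ Finset.Icc 2 (k - 2), 1 / (l : ℝ) ≤ Real.log ((k : ℝ) - 2) := by
    have := sum_one_div_le_log (k - 3)
    rw [show k - 3 + 1 = k - 2 by omega] at this
    refine this.trans_eq ?_
    rw [Nat.cast_sub (by omega)]
    congr 1
    push_cast
    ring
  have hfin : ∑ l ∈ Finset.Icc 2 (k - 2), 1 / (l : ℝ) ^ 2 + ∑ l ∈ Finset.Icc 2 (k - 2), 1 / (l : ℝ) ^ 2
      + 2 / k * (∑ l ∈ Finset.Icc 2 (k - 2), 1 / (l : ℝ) + ∑ l ∈ Finset.Icc 2 (k - 2), 1 / (l : ℝ))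
      ≤ 4 * Real.log ((m : ℝ) - 2) / (m : ℝ) + (Real.pi ^ 2 - 6) / 3 := by
    have h1 := sum_one_div_sq_le (k - 2)
    have h2 := log_sub_two_div_antitone hm hk
    have h3 : 2 / k * (∑ l ∈ Finset.Icc 2 (k - 2), 1 / (l : ℝ)
        + ∑ l ∈ Finset.Icc 2 (k - 2), 1 / (l : ℝ)) ≤ 2 / k * (2 * Real.log ((k : ℝ) - 2)) :=
      mul_le_mul_of_nonneg_left (by linarith) (by positivity)
    have h4 : 2 / k * (2 * Real.log ((k : ℝ) - 2)) = 4 * (Real.log ((k : ℝ) - 2) / k) := by ring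
    rw [mul_div_assoc]
    linarith
  have := mul_le_mul_of_nonneg_right hfin
    (show 0 ≤ (2 / (m : ℝ) + 1 / 2) ^ (s - 2) by positivity)
  rw [hsplit, hF1, hF2]
  linarith

theorem convWeight_add_zetaUp_le_alpha {s : ℝ} (hs : 1 < s) {L : ℕ} (hL : 1 ≤ L) {m k : ℕ}
    (hm : 6 ≤ m) (hk : m ≤ k) : convWeight s k + zetaUp s L ≤ alpha s L m m := by
  rw [convWeight_eq s (by omega)]
  unfold alpha
  rw [if_neg (by omega), if_neg (lt_irrefl _)]
  split_ifs with h2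
  · linarith [sum_Icc_le_of_two_le h2 hm hk]
  · linarith [sum_Icc_le_of_lt_two hs hL (show 1 ≤ k by omega)]

/-! ### Geometric sums with algebraic weights -/

/-- `∑_{l=0}^k θ^{k-l} ((m+k)/(m+l))^p`. -/
def geomWeight (θ p : ℝ) (m k : ℕ) : ℝ :=
  ∑ l ∈ Finset.range (k + 1), θ ^ (k - l) * (((m : ℝ) + k) / ((m : ℝ) + l)) ^ p

theorem summable_geom_mul_rpow {θ : ℝ} (h0 : 0 ≤ θ) (h1 : θ < 1) (p : ℝ) :
    Summable fun n : ℕ => θ ^ n * (1 + (n : ℝ)) ^ p := by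
  obtain ⟨N, hN⟩ := exists_nat_ge p
  have hs : Summable fun n : ℕ => (n : ℝ) ^ N * θ ^ n :=
    summable_pow_mul_geometric_of_norm_lt_one N (by rwa [Real.norm_of_nonneg h0])
  have hb : Summable fun n : ℕ => θ ^ n + (2 : ℝ) ^ N * ((n : ℝ) ^ N * θ ^ n) :=
    (summable_geometric_of_lt_one h0 h1).add (hs.mul_left _)
  refine Summable.of_nonneg_of_le (fun n => by positivity) (fun n => ?_) hb
  rcases Nat.eq_zero_or_pos n with rfl | hn
  · simp
  · have hn' : (1 : ℝ) ≤ n := by exact_mod_cast hn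
    have h2 : (1 + (n : ℝ)) ^ p ≤ (2 : ℝ) ^ N * (n : ℝ) ^ N := by
      calc (1 + (n : ℝ)) ^ p ≤ (1 + (n : ℝ)) ^ (N : ℝ) :=
            Real.rpow_le_rpow_of_exponent_le (by linarith) hN
        _ = (1 + (n : ℝ)) ^ N := Real.rpow_natCast _ _
        _ ≤ (2 * (n : ℝ)) ^ N := pow_le_pow_left₀ (by positivity) (by linarith) _
        _ = _ := mul_pow _ _ _
    nlinarith [mul_le_mul_of_nonneg_left h2 (pow_nonneg h0 n), pow_nonneg h0 n]

/-- Since `m ≥ 1`, `(m + k) / (m + l) ≤ 1 + (k - l)`. The bound is uniform in `k`, as boundedness of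
the tail inverse into `Ω^s` requires. -/
theorem geomWeight_le_tsum {θ p : ℝ} (h0 : 0 ≤ θ) (h1 : θ < 1) (hp : 0 ≤ p) {m : ℕ} (hm : 1 ≤ m)
    (k : ℕ) : geomWeight θ p m k ≤ ∑' n : ℕ, θ ^ n * (1 + (n : ℝ)) ^ p := by
  have hm' : (1 : ℝ) ≤ m := by exact_mod_cast hm
  refine le_trans ?_ ((summable_geom_mul_rpow h0 h1 p).sum_le_tsum (Finset.range (k + 1))
    fun _ _ => by positivity)
  rw [← Finset.sum_range_reflect]
  refine Finset.sum_le_sum fun l hl => ?_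
  have hl' := Finset.mem_range.1 hl
  rw [show k + 1 - 1 - l = k - l by omega]
  refine mul_le_mul_of_nonneg_left (Real.rpow_le_rpow (by positivity) ?_ hp) (by positivity)
  rw [div_le_iff₀ (by positivity), Nat.cast_sub (by omega)]
  have : (l : ℝ) ≤ k := by exact_mod_cast (by omega : l ≤ k)
  nlinarith [mul_nonneg (sub_nonneg.2 this) (show (0 : ℝ) ≤ m + l - 1 by
    have : (0 : ℝ) ≤ l := by positivity
    linarith)]

/-- To the right of `k` the weights only grow, so that half is at most a geometric series `1 + θ /
(1 - θ)`. Its `1` is the diagonal term, which `geomWeight` already contains. -/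
theorem greenSum_wt_le {θ p : ℝ} (h0 : 0 ≤ θ) (h1 : θ < 1) (hp : 0 ≤ p) {m : ℕ} (hm : 1 ≤ m)
    (k : ℕ) : greenSum θ (fun j => 1 / wt p (m + j)) k
      ≤ 1 / wt p (m + k) * (geomWeight θ p m k + θ / (1 - θ)) := by
  have hw := wt_pos p (m + k)
  have hX : geomWeight θ p m k
      = wt p (m + k) * ∑ j ∈ Finset.range k, θ ^ (k - j) * (1 / wt p (m + j)) + 1 := by
    unfold geomWeight
    rw [Finset.sum_range_succ, Finset.mul_sum]
    congr 1
    · refine Finset.sum_congr rfl fun j _ => ?_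
      have := wt_div_wt p (show m + j ≠ 0 by omega) (show m + k ≠ 0 by omega)
      push_cast at this
      rw [← this]
      ring
    · have : (m : ℝ) + k ≠ 0 := by exact_mod_cast (by omega : m + k ≠ 0)
      simp [this]
  have hT : ∑' i, θ ^ i * (1 / wt p (m + (k + i))) ≤ 1 / wt p (m + k) * (1 + θ / (1 - θ)) := by
    have hg := (hasSum_geometric_of_lt_one h0 h1).mul_right (1 / wt p (m + k))
    have e : (1 - θ)⁻¹ = 1 + θ / (1 - θ) := by
      have : 1 - θ ≠ 0 := by linarith
      field_simp
      ring
    rw [e, mul_comm] at hg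
    have hle : ∀ i, θ ^ i * (1 / wt p (m + (k + i))) ≤ θ ^ i * (1 / wt p (m + k)) := fun i =>
      mul_le_mul_of_nonneg_left
        (one_div_le_one_div_of_le hw (wt_mono hp (by omega))) (pow_nonneg h0 i)
    rw [← hg.tsum_eq]
    exact Summable.tsum_le_tsum hle (Summable.of_nonneg_of_le
      (fun i => mul_nonneg (pow_nonneg h0 i) (one_div_nonneg.2 (wt_pos _ _).le)) hle hg.summable)
      hg.summable
  unfold greenSum
  rw [hX]
  refine (add_le_add_right hT _).trans_eq ?_
  field_simp
  ring

theorem greenSum_wt_zero_le {θ p : ℝ} (h0 : 0 ≤ θ) (h1 : θ < 1) (hp : 0 ≤ p) {m : ℕ} (hm : 1 ≤ m) :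
    greenSum θ (fun j => 1 / wt p (m + j)) 0 ≤ 1 / (wt p m * (1 - θ)) := by
  refine (greenSum_wt_le h0 h1 hp hm 0).trans_eq ?_
  have : 1 - θ ≠ 0 := by linarith
  have hm' : (m : ℝ) ≠ 0 := by exact_mod_cast (by omega : m ≠ 0)
  have := (wt_pos p m).ne'
  simp [geomWeight, hm']
  field_simp
  ring

/-- The bound `χ` at a general index. -/
def chiAt (θ p : ℝ) (m k : ℕ) : ℝ :=
  θ ^ ((k : ℝ) / 2) * ((k : ℝ) / 2) * (((m : ℝ) + k) / m) ^ p
    + θ ^ Real.sqrt k * ((k : ℝ) / 2) * (2 : ℝ) ^ p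
    + 1 / (1 - θ) * (((m : ℝ) + k) / ((m : ℝ) + k - Real.sqrt k - 1)) ^ p

theorem geom_sum_le {θ : ℝ} (h0 : 0 ≤ θ) (h1 : θ < 1) (N : ℕ) :
    ∑ i ∈ Finset.range N, θ ^ (N - 1 - i) ≤ 1 / (1 - θ) := by
  rw [Finset.sum_range_reflect (fun i => θ ^ i) N, one_div, ← tsum_geometric_of_lt_one h0 h1]
  exact (summable_geometric_of_lt_one h0 h1).sum_le_tsum _ fun _ _ => by positivity

/-- The range of `l` is cut at `k / 2` and about `√k` below `k`. In the first piece the power of `θ`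
is tiny, in the second the weight ratio is at most `2^p`, and in the third the ratio is close to `1`
and the geometric series is summed. -/
theorem geomWeight_le_chiAt {θ p : ℝ} (h0 : 0 < θ) (h1 : θ < 1) (hp : 0 ≤ p) {m k : ℕ}
    (hm : 1 ≤ m) (hk : 4 ≤ k) : geomWeight θ p m k ≤ chiAt θ p m k := by
  have hm' : (1 : ℝ) ≤ m := by exact_mod_cast hm
  have hk' : (4 : ℝ) ≤ k := by exact_mod_cast hk
  set u := Real.sqrt k with hu
  have huu : u * u = k := Real.mul_self_sqrt (by linarith)
  have hu2 : 2 ≤ u := Real.le_sqrt_of_sq_le (by norm_num; linarith)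
  set N := ⌈u⌉₊ with hN
  have hN1 : u ≤ N := Nat.le_ceil u
  have hN2 : (N : ℝ) < u + 1 := Nat.ceil_lt_add_one (by linarith)
  have hN3 : 2 ≤ N := by exact_mod_cast hu2.trans hN1
  set n := k / 2 with hn
  have hn1 : (n : ℝ) ≤ k / 2 := by
    rw [le_div_iff₀ two_pos]; exact_mod_cast (by omega : n * 2 ≤ k)
  have hn2 : (k : ℝ) ≤ 2 * n + 1 := by exact_mod_cast (by omega : k ≤ 2 * n + 1)
  -- This uses `√k ≤ k / 2`, that is `k ≥ 4`, so that the three pieces fit.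
  have hNn : N + n < k + 1 := by
    have : (N : ℝ) + n < k + 1 := by nlinarith
    exact_mod_cast this
  obtain ⟨r, hr⟩ : ∃ r, k + 1 = n + r + N := ⟨k + 1 - N - n, by omega⟩
  have hr2 : (r : ℝ) ≤ k / 2 := by
    rw [le_div_iff₀ two_pos]; exact_mod_cast (by omega : r * 2 ≤ k)
  have hpow : ∀ (l : ℕ) (x : ℝ), l ≤ k → x + l ≤ k → θ ^ (k - l) ≤ θ ^ x := fun l x hl hx => by
    rw [← Real.rpow_natCast]
    refine Real.rpow_le_rpow_of_exponent_ge h0 h1.le ?_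
    rw [Nat.cast_sub hl]
    linarith
  unfold geomWeight chiAt
  rw [hr, Finset.sum_range_add, Finset.sum_range_add]
  refine add_le_add (add_le_add ?_ ?_) ?_
  · have hb : ∀ l ∈ Finset.range n, θ ^ (k - l) * (((m : ℝ) + k) / ((m : ℝ) + l)) ^ p
        ≤ θ ^ ((k : ℝ) / 2) * (((m : ℝ) + k) / m) ^ p := by
      intro l hl
      have hl' : l < n := Finset.mem_range.1 hl
      have hl2 : (l : ℝ) ≤ n := by exact_mod_cast hl'.le
      refine mul_le_mul (hpow l _ (by omega) (by linarith)) ?_ (by positivity) (by positivity)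
      refine Real.rpow_le_rpow (by positivity) ?_ hp
      exact div_le_div_of_nonneg_left (by positivity) (by positivity) (by simp)
    refine (Finset.sum_le_card_nsmul _ _ _ hb).trans ?_
    rw [Finset.card_range, nsmul_eq_mul]
    have hc : 0 ≤ θ ^ ((k : ℝ) / 2) * (((m : ℝ) + k) / m) ^ p := by positivity
    nlinarith [mul_le_mul_of_nonneg_right hn1 hc]
  · have hb : ∀ i ∈ Finset.range r, θ ^ (k - (n + i)) *
        (((m : ℝ) + k) / ((m : ℝ) + (n + i : ℕ))) ^ p ≤ θ ^ u * 2 ^ p := by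
      intro i hi
      have hi' : i < r := Finset.mem_range.1 hi
      refine mul_le_mul (hpow _ _ (by omega) ?_) ?_ (by positivity) (by positivity)
      · have : ((n + i : ℕ) : ℝ) + N ≤ k := by exact_mod_cast (by omega : n + i + N ≤ k)
        linarith
      · refine Real.rpow_le_rpow (by positivity) ?_ hp
        rw [div_le_iff₀ (by positivity)]
        push_cast
        have : (0 : ℝ) ≤ i := by positivity
        linarith
    refine (Finset.sum_le_card_nsmul _ _ _ hb).trans ?_
    rw [Finset.card_range, nsmul_eq_mul]
    have hc : 0 ≤ θ ^ u * (2 : ℝ) ^ p := by positivity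
    nlinarith [mul_le_mul_of_nonneg_right hr2 hc]
  · have hden : 0 < (m : ℝ) + k - u - 1 := by nlinarith
    have hb : ∀ i ∈ Finset.range N, θ ^ (k - (n + r + i)) *
        (((m : ℝ) + k) / ((m : ℝ) + (n + r + i : ℕ))) ^ p
          ≤ θ ^ (N - 1 - i) * (((m : ℝ) + k) / ((m : ℝ) + k - u - 1)) ^ p := by
      intro i hi
      rw [show k - (n + r + i) = N - 1 - i by omega]
      refine mul_le_mul_of_nonneg_left (Real.rpow_le_rpow (by positivity) ?_ hp) (by positivity)
      refine div_le_div_of_nonneg_left (by positivity) hden ?_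
      have : (k : ℝ) + 1 = n + r + N := by exact_mod_cast hr
      push_cast
      have : (0 : ℝ) ≤ i := by positivity
      linarith
    refine (Finset.sum_le_sum hb).trans ?_
    rw [← Finset.sum_mul]
    exact mul_le_mul_of_nonneg_right (geom_sum_le h0.le h1 N) (by positivity)

/-! ### Monotonicity -/

/-- From `log t ≤ t - 1`. It replaces derivative tests: algebraic growth from `M` to `k` becomes the
exponential of an increment, to be compared with the decay of `θ`. -/
theorem div_rpow_le_exp {x y p : ℝ} (hx : 0 < x) (hy : 0 < y) (hp : 0 ≤ p) :
    (x / y) ^ p ≤ Real.exp (p * ((x - y) / y)) := by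
  rw [Real.rpow_def_of_pos (div_pos hx hy), Real.exp_le_exp, mul_comm]
  refine mul_le_mul_of_nonneg_left ((Real.log_le_sub_one_of_pos (div_pos hx hy)).trans_eq ?_) hp
  field_simp

theorem geom_mul_wt_antitone {θ s : ℝ} (h0 : 0 < θ) (hs : 0 ≤ s) {m M k : ℕ} (hm : 1 ≤ m)
    (hM : s / ((m : ℝ) + M) ≤ -Real.log θ) (hk : M ≤ k) :
    θ ^ k ≤ θ ^ M * wt s (m + M) / wt s (m + k) := by
  obtain ⟨n, rfl⟩ := Nat.exists_eq_add_of_le hk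
  have hmM : (0 : ℝ) < (m : ℝ) + M := by positivity
  rw [pow_add, mul_div_assoc]
  refine mul_le_mul_of_nonneg_left ?_ (pow_nonneg h0.le _)
  rw [le_div_iff₀ (wt_pos _ _), ← le_div_iff₀' (pow_pos h0 n), div_eq_mul_inv,
    ← div_le_iff₀' (wt_pos _ _), wt_div_wt s (by omega) (by omega)]
  push_cast
  refine (div_rpow_le_exp (by positivity) hmM hs).trans ?_
  have e : (θ ^ n)⁻¹ = Real.exp (n * -Real.log θ) := by
    rw [mul_neg, Real.exp_neg, Real.exp_nat_mul, Real.exp_log h0]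
  rw [e, Real.exp_le_exp]
  have : (0 : ℝ) ≤ n := by positivity
  calc s * (((m : ℝ) + (M + n) - (m + M)) / (m + M)) = n * (s / (m + M)) := by ring
    _ ≤ _ := mul_le_mul_of_nonneg_left hM this

/-- The hypotheses `h2` and `h3` make the total exponent of the first and second terms nonpositive
for `k ≥ M`; the third term is monotone by algebra. -/
theorem chiAt_antitone {θ p : ℝ} (h0 : 0 < θ) (h1 : θ < 1) (hp : 0 ≤ p) {m M k : ℕ} (hm : 1 ≤ m)
    (hM4 : 4 ≤ M) (hmM : m ≤ M)
    (h2 : p / ((m : ℝ) + M) + 1 / M ≤ -Real.log θ / 2)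
    (h3 : 2 / Real.sqrt M ≤ -Real.log θ) (hk : M ≤ k) : chiAt θ p m k ≤ chiAt θ p m M := by
  have hm' : (1 : ℝ) ≤ m := by exact_mod_cast hm
  have hM' : (4 : ℝ) ≤ M := by exact_mod_cast hM4
  have hmM' : (m : ℝ) ≤ M := by exact_mod_cast hmM
  have hk' : (M : ℝ) ≤ k := by exact_mod_cast hk
  set u := Real.sqrt k with hu
  set v := Real.sqrt M with hv
  have huu : u * u = k := Real.mul_self_sqrt (by linarith)
  have hvv : v * v = M := Real.mul_self_sqrt (by linarith)
  have hv2 : 2 ≤ v := Real.le_sqrt_of_sq_le (by norm_num; linarith)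
  have huv : v ≤ u := Real.sqrt_le_sqrt hk'
  have hθ : ∀ x y : ℝ, θ ^ x = θ ^ y * Real.exp (Real.log θ * (x - y)) := fun x y => by
    rw [Real.rpow_def_of_pos h0, Real.rpow_def_of_pos h0, ← Real.exp_add]
    ring_nf
  unfold chiAt
  refine add_le_add (add_le_add ?_ ?_) ?_
  · have e1 : (k : ℝ) / 2 ≤ (M : ℝ) / 2 * Real.exp (1 * (((k : ℝ) - M) / M)) := by
      have := div_rpow_le_exp (show (0 : ℝ) < k by linarith) (show (0 : ℝ) < M by linarith)
        zero_le_one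
      rw [Real.rpow_one, div_le_iff₀ (by linarith)] at this
      linarith
    have e2 : (((m : ℝ) + k) / m) ^ p
        ≤ (((m : ℝ) + M) / m) ^ p * Real.exp (p * (((m : ℝ) + k - (m + M)) / (m + M))) := by
      have := div_rpow_le_exp (show (0 : ℝ) < m + k by linarith) (show (0 : ℝ) < m + M by linarith)
        hp
      rw [show ((m : ℝ) + k) / m = ((m : ℝ) + M) / m * (((m : ℝ) + k) / (m + M)) by field_simp,
        Real.mul_rpow (by positivity) (by positivity)]
      exact mul_le_mul_of_nonneg_left this (by positivity)
    calc _ ≤ θ ^ ((k : ℝ) / 2) * ((M : ℝ) / 2 * Real.exp (1 * (((k : ℝ) - M) / M)))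
          * ((((m : ℝ) + M) / m) ^ p * Real.exp (p * (((m : ℝ) + k - (m + M)) / (m + M)))) :=
          mul_le_mul (mul_le_mul_of_nonneg_left e1 (by positivity)) e2 (by positivity)
            (by positivity)
      _ = θ ^ ((M : ℝ) / 2) * ((M : ℝ) / 2) * (((m : ℝ) + M) / m) ^ p
          * Real.exp (Real.log θ * ((k : ℝ) / 2 - M / 2) + 1 * (((k : ℝ) - M) / M)
            + p * (((m : ℝ) + k - (m + M)) / (m + M))) := by
          rw [hθ ((k : ℝ) / 2) ((M : ℝ) / 2), Real.exp_add, Real.exp_add]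
          ring
      _ ≤ _ := by
          refine mul_le_of_le_one_right (by positivity) (Real.exp_le_one_iff.2 ?_)
          have : Real.log θ * ((k : ℝ) / 2 - M / 2) + 1 * (((k : ℝ) - M) / M)
              + p * (((m : ℝ) + k - (m + M)) / (m + M))
              = (k - M) * (p / ((m : ℝ) + M) + 1 / M - -Real.log θ / 2) := by ring
          rw [this]
          exact mul_nonpos_of_nonneg_of_nonpos (by linarith) (by linarith)
  · refine mul_le_mul_of_nonneg_right ?_ (by positivity)
    have e1 : (k : ℝ) / 2 ≤ (M : ℝ) / 2 * Real.exp (2 * ((u - v) / v)) := by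
      have := div_rpow_le_exp (show 0 < u by linarith) (show 0 < v by linarith) zero_le_two
      rw [Real.rpow_two, div_pow, div_le_iff₀ (by positivity), pow_two, pow_two, huu, hvv] at this
      linarith
    calc _ ≤ θ ^ u * ((M : ℝ) / 2 * Real.exp (2 * ((u - v) / v))) :=
          mul_le_mul_of_nonneg_left e1 (by positivity)
      _ = θ ^ v * ((M : ℝ) / 2) * Real.exp (Real.log θ * (u - v) + 2 * ((u - v) / v)) := by
          rw [hθ u v, Real.exp_add]
          ring
      _ ≤ _ := by
          refine mul_le_of_le_one_right (by positivity) (Real.exp_le_one_iff.2 ?_)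
          have : Real.log θ * (u - v) + 2 * ((u - v) / v)
              = (u - v) * (2 / v - -Real.log θ) := by ring
          rw [this]
          exact mul_nonpos_of_nonneg_of_nonpos (by linarith) (by linarith)
  · have hd1 : 0 < (m : ℝ) + k - u - 1 := by nlinarith
    have hd2 : 0 < (m : ℝ) + M - v - 1 := by nlinarith
    refine mul_le_mul_of_nonneg_left (Real.rpow_le_rpow (by positivity) ?_ hp)
      (one_div_nonneg.2 (by linarith))
    rw [div_le_div_iff₀ hd1 hd2, ← huu, ← hvv]
    -- Cross-multiplication leaves exactly this product; its second factor is nonnegative because `u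
    -- v ≥ v² = M ≥ m`.
    have : 0 ≤ (u - v) * (u * v + u + v - m) := by
      refine mul_nonneg (by linarith) ?_
      nlinarith
    nlinarith

namespace Data.Regular

variable {P : Data} {C₂ : ℝ}

theorem log_θ_neg (H : P.Regular C₂) : Real.log P.θ < 0 := Real.log_neg H.θ_pos H.θ_lt_one

theorem m_le_M (hMA : P.CondMA) : P.m ≤ P.M := by
  have := (le_max_right _ _).trans hMA
  exact_mod_cast this

theorem s_div_le (H : P.Regular C₂) (hMY : P.CondMY) :
    P.s / ((P.m : ℝ) + P.M) ≤ -Real.log P.θ := by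
  have h := (le_max_left _ _).trans hMY
  have hl := H.log_θ_neg
  have hm : (0 : ℝ) < P.m := by exact_mod_cast P.m_pos
  rw [div_le_iff₀ (by positivity)]
  have h2 : -P.s / Real.log P.θ ≤ P.m + P.M := by linarith
  rw [div_le_iff_of_neg hl] at h2
  linarith

theorem geomWeight_le_χ (H : P.Regular C₂) (hm : 6 ≤ P.m) (hMA : P.CondMA) {k : ℕ}
    (hk : P.M ≤ k) : geomWeight P.θ (P.s + P.sL) P.m k ≤ P.χ := by
  have hp : 0 < P.s + P.sL := by linarith [H.one_lt_s, H.sL_pos]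
  have hl := H.log_θ_neg
  have hmM := m_le_M hMA
  have hm' : (6 : ℝ) ≤ P.m := by exact_mod_cast hm
  have hM' : (P.m : ℝ) ≤ P.M := by exact_mod_cast hmM
  have hM0 : (0 : ℝ) < P.M := by linarith
  have hc1 := ((le_max_left _ _).trans (le_max_left _ _)).trans hMA
  have hc2 := ((le_max_right _ _).trans (le_max_left _ _)).trans hMA
  refine (geomWeight_le_chiAt H.θ_pos H.θ_lt_one hp.le (by omega) (by omega)).trans
    (chiAt_antitone H.θ_pos H.θ_lt_one hp.le (by omega) (by omega) hmM ?_ ?_ hk)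
  · rw [Real.log_sqrt H.θ_pos.le] at hc1
    set ℓ := Real.log P.θ / 2 with hℓ
    have hℓ0 : ℓ < 0 := by linarith
    rw [div_le_iff_of_neg (by linarith)] at hc1
    have hc3 : Real.sqrt (((P.m : ℝ) * ℓ + P.s + P.sL + 1) ^ 2 - 4 * (P.m : ℝ) * ℓ)
        ≤ -(P.m : ℝ) * ℓ - P.s - P.sL - 1 - P.M * (2 * ℓ) := by linarith
    -- Squaring the lower bound on `M` undoes the quadratic formula. After cancelling `-ℓ > 0` it
    -- reads `(p + 1) M + m ≤ -ℓ M (m + M)` with `p = s + s_L`, which is `h2` of `chiAt_antitone`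
    -- cleared of denominators.
    have hc4 := (Real.sqrt_le_iff.1 hc3).2
    have hc5 : (-ℓ) * ((P.s + P.sL + 1) * P.M + P.m) ≤ (-ℓ) * (-ℓ * P.M * (P.m + P.M)) := by
      nlinarith
    have hc6 := le_of_mul_le_mul_left hc5 (by linarith)
    rw [show -Real.log P.θ / 2 = -ℓ by rw [hℓ]; ring, div_add_div _ _ (by positivity) hM0.ne',
      div_le_iff₀ (by positivity)]
    linarith
  · have hv : 0 < Real.sqrt P.M := Real.sqrt_pos.2 hM0
    rw [div_le_iff₀ hv]
    have hl' := hl.ne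
    rw [div_le_iff₀ (by positivity)] at hc2
    refine le_of_sq_le_sq ?_ (mul_nonneg (by linarith) hv.le)
    rw [mul_pow, Real.sq_sqrt hM0.le, neg_sq]
    linarith

end Data.Regular

/-! ### Bounded maps on `Ω^s` -/

theorem Omega.add_apply {s : ℝ} (x y : Omega s) (k : ℕ) : (x + y) k = x k + y k := rfl

theorem Omega.sub_apply {s : ℝ} (x y : Omega s) (k : ℕ) : (x - y) k = x k - y k := rfl

theorem Omega.smul_apply {s : ℝ} (c : ℝ) (x : Omega s) (k : ℕ) : (c • x) k = c * x k := rfl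

theorem Omega.ext {s : ℝ} {x y : Omega s} (h : ∀ k, x k = y k) : x = y :=
  Subtype.ext (funext h)

/-- A linear map into a space of sequences whose values are bounded in the weighted norm. -/
def Omega.mkCLM {E : Type*} [NormedAddCommGroup E] [NormedSpace ℝ E] {s : ℝ}
    (F : E →ₗ[ℝ] (ℕ → ℝ)) (C : ℝ) (hC : ∀ x k, |F x k| * wt s k ≤ C * ‖x‖) : E →L[ℝ] Omega s :=
  LinearMap.mkContinuous
    { toFun := fun x => ⟨F x, ⟨C * ‖x‖, by rintro _ ⟨k, rfl⟩; exact hC x k⟩⟩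
      map_add' := fun x y => Omega.ext fun k => congrFun (F.map_add x y) k
      map_smul' := fun c x => Omega.ext fun k => congrFun (F.map_smul c x) k }
    C (fun x => Omega.norm_le _ (hC x))

/-- Evaluation at an index. -/
def Omega.eval (s : ℝ) (k : ℕ) : Omega s →L[ℝ] ℝ :=
  LinearMap.mkContinuous
    { toFun := fun x => x k
      map_add' := fun _ _ => rfl
      map_smul' := fun _ _ => rfl }
    (1 / wt s k) (fun x => by
      rw [one_div_mul_eq_div]
      exact x.abs_le k)

/-- The finite part as a continuous linear map. -/
def Omega.finCLM (s : ℝ) (m : ℕ) : Omega s →L[ℝ] (Fin m → ℝ) :=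
  ContinuousLinearMap.pi fun i => Omega.eval s i

/-- Extension by zero as a continuous linear map. -/
def extendCLM (s : ℝ) (m : ℕ) : (Fin m → ℝ) →L[ℝ] Omega s :=
  LinearMap.toContinuousLinearMap
    { toFun := fun u => ⟨extend u, extend_mem s u⟩
      map_add' := fun u v => Omega.ext fun k => by
        change extend (u + v) k = extend u k + extend v k
        unfold extend
        split_ifs <;> simp
      map_smul' := fun c u => Omega.ext fun k => by
        change extend (c • u) k = c * extend u k
        unfold extend
        split_ifs <;> simp }

theorem extend_of_lt {m : ℕ} (u : Fin m → ℝ) {k : ℕ} (h : k < m) : extend u k = u ⟨k, h⟩ :=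
  dif_pos h

theorem extend_of_le {m : ℕ} (u : Fin m → ℝ) {k : ℕ} (h : m ≤ k) : extend u k = 0 :=
  dif_neg (by omega)

namespace Data

theorem lin_eq (P : Data) (x : ℕ → ℝ) (k : ℕ) :
    P.lin x k = (if k = 0 then 0 else P.lam k * x (k - 1)) + P.mu k * x k
      + P.beta k * x (k + 1) := by
  cases k <;> simp [lin]

namespace Regular

variable {P : Data} {C₂ : ℝ}

/-- The exponent `s - s_L` may be negative, and its weights need not be monotone. Estimates in `Ω^{s
- s_L}` are therefore routed through the weights of exponents `s` and `s_L`. -/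
theorem wt_split (P : Data) (k : ℕ) : wt P.s k = wt P.sL k * wt (P.s - P.sL) k := by
  rw [← wt_add]; congr 1; ring

theorem C₂_nonneg (H : P.Regular C₂) : 0 ≤ C₂ := by
  have := (abs_nonneg _).trans (H.mu_le 0)
  rwa [wt_zero_exp, mul_one] at this

theorem abs_lin_le (H : P.Regular C₂) (x : Omega P.s) (k : ℕ) :
    |P.lin x k| * wt (P.s - P.sL) k ≤ C₂ * (2 ^ P.s + 1 + 1) * ‖x‖ := by
  have hs0 : 0 ≤ P.s := by linarith [H.one_lt_s]
  have hC := H.C₂_nonneg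
  have hw := wt_pos (P.s - P.sL) k
  have hn := norm_nonneg x
  have key : ∀ (c : ℝ) (j : ℕ) (D : ℝ), |c| ≤ C₂ * wt P.sL k → wt P.s k ≤ D * wt P.s j → 0 ≤ D →
      |c * x j| * wt (P.s - P.sL) k ≤ C₂ * D * ‖x‖ := by
    intro c j D hc hj hD
    have hxj := x.le_norm j
    rw [abs_mul]
    calc |c| * |x j| * wt (P.s - P.sL) k ≤ C₂ * wt P.sL k * |x j| * wt (P.s - P.sL) k := by
          gcongr
      _ = C₂ * |x j| * wt P.s k := by rw [wt_split]; ring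
      _ ≤ C₂ * |x j| * (D * wt P.s j) := by gcongr
      _ = C₂ * D * (|x j| * wt P.s j) := by ring
      _ ≤ _ := by gcongr
  rw [lin_eq]
  have h1 : |if k = 0 then 0 else P.lam k * x (k - 1)| * wt (P.s - P.sL) k
      ≤ C₂ * 2 ^ P.s * ‖x‖ := by
    split_ifs with h
    · simp only [abs_zero, zero_mul]; positivity
    · refine key _ _ _ (H.lam_le k) ?_ (by positivity)
      have := wt_succ_le hs0 (k - 1)
      rwa [Nat.sub_add_cancel (by omega)] at this
  have h2 := key _ k 1 (H.mu_le k) (by simp) zero_le_one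
  have h3 := key _ (k + 1) 1 (H.beta_le k) (by simpa using wt_mono hs0 (Nat.le_succ k)) zero_le_one
  have h4 := abs_add_le ((if k = 0 then 0 else P.lam k * x (k - 1)) + P.mu k * x k)
    (P.beta k * x (k + 1))
  have h5 := abs_add_le (if k = 0 then 0 else P.lam k * x (k - 1)) (P.mu k * x k)
  nlinarith

/-- `𝓛 : Ω^s → Ω^{s - s_L}`. -/
def linCLM (H : P.Regular C₂) : Omega P.s →L[ℝ] Omega (P.s - P.sL) :=
  Omega.mkCLM
    { toFun := fun x => P.lin x
      map_add' := fun x y => funext fun k => by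
        simp only [lin_eq, Omega.add_apply, Pi.add_apply]
        split_ifs <;> ring
      map_smul' := fun c x => funext fun k => by
        simp only [lin_eq, Omega.smul_apply, Pi.smul_apply, smul_eq_mul, RingHom.id_apply]
        split_ifs <;> ring }
    (C₂ * (2 ^ P.s + 1 + 1)) H.abs_lin_le

/-! ### The convolution as a bounded bilinear map -/

theorem abs_conv_le_alpha (H : P.Regular C₂) (hL : 1 ≤ P.L) (x y : Omega P.s) {k : ℕ}
    (hk : k < P.m) : |conv x y k| ≤ alpha P.s P.L P.m k * ‖x‖ * ‖y‖ / wt P.s k := by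
  rw [← convWeight_add_zetaUp_eq_alpha _ _ hk]
  exact abs_conv_le H.one_lt_s hL x y k

theorem abs_conv_le_αm (H : P.Regular C₂) (hL : 1 ≤ P.L) (hm : 6 ≤ P.m) (x y : Omega P.s) {k : ℕ}
    (hk : P.m ≤ k) : |conv x y k| ≤ P.αm * ‖x‖ * ‖y‖ / wt P.s k := by
  refine (abs_conv_le H.one_lt_s hL x y k).trans ?_
  have hw := wt_pos P.s k
  gcongr
  exact convWeight_add_zetaUp_le_alpha H.one_lt_s hL hm hk

theorem conv_bound (H : P.Regular C₂) (hL : 1 ≤ P.L) (hm : 6 ≤ P.m) :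
    ∃ C, 0 ≤ C ∧ ∀ (x y : Omega P.s) (k : ℕ),
      |conv x y k| * wt (P.s - P.sL) k ≤ C * ‖x‖ * ‖y‖ := by
  set S := ∑ k ∈ Finset.range P.m, |alpha P.s P.L P.m k| with hS
  have hS0 : 0 ≤ S := Finset.sum_nonneg fun _ _ => abs_nonneg _
  refine ⟨S + |P.αm|, by positivity, fun x y k => ?_⟩
  have hw := wt_pos (P.s - P.sL) k
  have hw' := wt_pos P.s k
  have hle : wt (P.s - P.sL) k ≤ wt P.s k := by
    rw [wt_split]
    exact le_mul_of_one_le_left hw.le (one_le_wt H.sL_pos.le k)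
  have h : |conv x y k| * wt P.s k ≤ (S + |P.αm|) * ‖x‖ * ‖y‖ := by
    rcases lt_or_ge k P.m with hk | hk
    · have h1 := H.abs_conv_le_alpha hL x y hk
      rw [le_div_iff₀ hw'] at h1
      refine h1.trans ?_
      gcongr
      have := Finset.single_le_sum (f := fun k => |alpha P.s P.L P.m k|)
        (fun _ _ => abs_nonneg _) (Finset.mem_range.2 hk)
      exact (le_abs_self _).trans (this.trans (le_add_of_nonneg_right (abs_nonneg _)))
    · have h1 := H.abs_conv_le_αm hL hm x y hk
      rw [le_div_iff₀ hw'] at h1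
      refine h1.trans ?_
      gcongr
      exact (le_abs_self _).trans (le_add_of_nonneg_left hS0)
  exact (mul_le_mul_of_nonneg_left hle (abs_nonneg _)).trans h

/-- The convolution as a bounded bilinear map `Ω^s × Ω^s → Ω^{s - s_L}`. -/
def convCLM (H : P.Regular C₂) (hL : 1 ≤ P.L) (hm : 6 ≤ P.m) :
    Omega P.s →L[ℝ] Omega P.s →L[ℝ] Omega (P.s - P.sL) :=
  LinearMap.mkContinuous₂
    (LinearMap.mk₂ ℝ
      (fun x y => ⟨conv x y, ⟨(H.conv_bound hL hm).choose * ‖x‖ * ‖y‖, by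
        rintro _ ⟨k, rfl⟩
        exact (H.conv_bound hL hm).choose_spec.2 x y k⟩⟩)
      (fun x x' y => Omega.ext fun k => by
        change conv (x + x' : Omega P.s) y k = conv x y k + conv x' y k
        rw [conv_comm, conv_add_right H.one_lt_s, conv_comm y x, conv_comm y x'])
      (fun c x y => Omega.ext fun k => by
        change conv (c • x : Omega P.s) y k = c * conv x y k
        rw [conv_comm, conv_smul_right, conv_comm y x])
      (fun x y y' => Omega.ext fun k => conv_add_right H.one_lt_s x y y' k)
      (fun c x y => Omega.ext fun k => conv_smul_right x y c k))
    (H.conv_bound hL hm).choose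
    (fun x y => Omega.norm_le _ ((H.conv_bound hL hm).choose_spec.2 x y))

/-! ### The tail inverse as a bounded map -/

theorem b_succ (P : Data) (j : ℕ) : P.b (j + 1) = P.mu (P.m + j) := rfl

/-- Division by the diagonal gains `s_L` powers. It serves with `t = s - s_L` for boundedness of
`A`, and with `t = s` for the convolution remainder. -/
theorem abs_div_b_le (H : P.Regular C₂) {t C : ℝ} {y : ℕ → ℝ}
    (hy : ∀ j, |y j| ≤ C / wt t (P.m + j)) (hC : 0 ≤ C) (j : ℕ) :
    |y j| / |P.b (j + 1)| ≤ C / P.C₁ * (1 / wt (t + P.sL) (P.m + j)) := by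
  have hb := H.le_mu (P.m + j) (by omega)
  have h1 := wt_pos P.sL (P.m + j)
  have h2 := wt_pos t (P.m + j)
  have h3 := H.C₁_pos
  rw [b_succ, wt_add]
  calc |y j| / |P.mu (P.m + j)| ≤ C / wt t (P.m + j) / (P.C₁ * wt P.sL (P.m + j)) :=
        div_le_div₀ (by positivity) (hy j) (by positivity) hb
    _ = _ := by field_simp

theorem abs_tailInv_le_of_le (H : P.Regular C₂) {t C : ℝ} (ht : 0 ≤ t + P.sL) {y : ℕ → ℝ}
    (hy : ∀ j, |y j| ≤ C / wt t (P.m + j)) (hC : 0 ≤ C) (k : ℕ) :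
    |P.tailInv y k| ≤ P.η * (C / P.C₁)
      * greenSum P.θ (fun j => 1 / wt (t + P.sL) (P.m + j)) k := by
  have h3 := H.C₁_pos
  have hq := H.abs_div_b_le hy hC
  have hB : ∀ j, C / P.C₁ * (1 / wt (t + P.sL) (P.m + j)) ≤ C / P.C₁ := fun j =>
    mul_le_of_le_one_right (by positivity) (div_le_one_of_le₀ (one_le_wt ht _) (wt_pos _ _).le)
  refine (H.abs_tailInv_le (fun j => (hq j).trans (hB j)) k).trans ?_
  rw [mul_assoc]
  refine mul_le_mul_of_nonneg_left ?_ H.η_pos.le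
  rw [← greenSum_const_mul]
  exact greenSum_mono H.θ_pos.le H.θ_lt_one (fun j => by positivity) hq hB k

theorem infPart_le (y : Omega (P.s - P.sL)) (j : ℕ) :
    |infPart P.m y j| ≤ ‖y‖ / wt (P.s - P.sL) (P.m + j) := y.abs_le _

theorem infPart_bdd (H : P.Regular C₂) (y : Omega (P.s - P.sL)) (j : ℕ) :
    |infPart P.m y j| / |P.b (j + 1)| ≤ ‖y‖ / P.C₁ := by
  have h3 := H.C₁_pos
  refine (H.abs_div_b_le (infPart_le y) (norm_nonneg _) j).trans ?_
  refine mul_le_of_le_one_right (by positivity) (div_le_one_of_le₀ (one_le_wt ?_ _) (wt_pos _ _).le)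
  linarith [H.one_lt_s]

/-- The sequence `(0, …, 0, U_I⁻¹ L_I⁻¹ y_I)`. -/
def _root_.TridiagNewton.Data.tailSeq (P : Data) (y : ℕ → ℝ) (k : ℕ) : ℝ :=
  if k < P.m then 0 else P.tailInv (infPart P.m y) (k - P.m)

theorem abs_tailSeq_le (H : P.Regular C₂) (y : Omega (P.s - P.sL)) (k : ℕ) :
    |P.tailSeq y k| * wt P.s k ≤ P.η * (1 / P.C₁) *
      (∑' n : ℕ, P.θ ^ n * (1 + (n : ℝ)) ^ P.s + P.θ / (1 - P.θ)) * ‖y‖ := by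
  have hs0 : 0 ≤ P.s := by linarith [H.one_lt_s]
  have hη := H.η_pos
  have hC := H.C₁_pos
  have hθ := H.θ_pos
  have hθ' := H.one_sub_θ_pos
  have hT : 0 ≤ ∑' n : ℕ, P.θ ^ n * (1 + (n : ℝ)) ^ P.s := tsum_nonneg fun n => by positivity
  unfold tailSeq
  split_ifs with hk
  · rw [abs_zero, zero_mul]; positivity
  · obtain ⟨n, rfl⟩ := Nat.exists_eq_add_of_le (not_lt.1 hk)
    rw [Nat.add_sub_cancel_left]
    have h1 := H.abs_tailInv_le_of_le (by linarith) (infPart_le y) (norm_nonneg y) n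
    rw [sub_add_cancel] at h1
    have h2 := greenSum_wt_le hθ.le H.θ_lt_one hs0 P.m_pos n
    have h3 := geomWeight_le_tsum hθ.le H.θ_lt_one hs0 P.m_pos n
    have hw := wt_pos P.s (P.m + n)
    calc _ ≤ P.η * (‖y‖ / P.C₁) * (1 / wt P.s (P.m + n) *
          (∑' n : ℕ, P.θ ^ n * (1 + (n : ℝ)) ^ P.s + P.θ / (1 - P.θ))) * wt P.s (P.m + n) := by
          refine mul_le_mul_of_nonneg_right (h1.trans ?_) hw.le
          refine mul_le_mul_of_nonneg_left (h2.trans ?_) (by positivity)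
          gcongr
      _ = _ := by field_simp

/-- `y ↦ (0, …, 0, U_I⁻¹ L_I⁻¹ y_I)` as a bounded map `Ω^{s - s_L} → Ω^s`. -/
def tailCLM (H : P.Regular C₂) : Omega (P.s - P.sL) →L[ℝ] Omega P.s :=
  Omega.mkCLM
    { toFun := fun y => P.tailSeq y
      map_add' := fun y z => funext fun k => by
        have e : infPart P.m (y + z : Omega (P.s - P.sL)) = infPart P.m y + infPart P.m z := rfl
        simp only [tailSeq, Pi.add_apply, e, H.tailInv_add (H.infPart_bdd y) (H.infPart_bdd z)]
        split_ifs <;> simp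
      map_smul' := fun c y => funext fun k => by
        have e : infPart P.m (c • y : Omega (P.s - P.sL)) = c • infPart P.m y := rfl
        simp only [tailSeq, Pi.smul_apply, e, tailInv_smul, RingHom.id_apply]
        split_ifs <;> simp }
    _ H.abs_tailSeq_le

theorem tailCLM_apply (H : P.Regular C₂) (y : Omega (P.s - P.sL)) (k : ℕ) :
    H.tailCLM y k = P.tailSeq y k := rfl

theorem _root_.TridiagNewton.Data.tailSeq_add (P : Data) (y : ℕ → ℝ) (k : ℕ) :
    P.tailSeq y (P.m + k) = P.tailInv (infPart P.m y) k := by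
  simp [tailSeq]

/-- The sequence `e_m`. -/
def _root_.TridiagNewton.Data.unitTail (P : Data) : Omega (P.s - P.sL) :=
  extendCLM _ (P.m + 1) (Pi.single (Fin.last P.m) 1)

theorem infPart_unitTail (P : Data) : infPart P.m P.unitTail = Pi.single 0 1 := by
  funext k
  change extend (Pi.single (Fin.last P.m) (1 : ℝ)) (P.m + k) = _
  rcases k with _ | k
  · rw [extend_of_lt _ (by omega)]
    exact Pi.single_eq_same _ _
  · rw [extend_of_le _ (by omega)]
    simp

/-- The sequence `(0, …, 0, w_I)`. -/
def wSeq (H : P.Regular C₂) : Omega P.s := H.tailCLM P.unitTail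

theorem wSeq_add (H : P.Regular C₂) (k : ℕ) : H.wSeq (P.m + k) = P.wI k := by
  rw [wSeq, tailCLM_apply, tailSeq_add, infPart_unitTail, wI]

theorem wSeq_of_lt (H : P.Regular C₂) {k : ℕ} (hk : k < P.m) : H.wSeq k = 0 := by
  rw [wSeq, tailCLM_apply, tailSeq, if_pos hk]

/-! ### The operator `A` -/

/-- The functional `y ↦ (U_I⁻¹ L_I⁻¹ y_I)_0`. -/
def headCLM (H : P.Regular C₂) : Omega (P.s - P.sL) →L[ℝ] ℝ :=
  (Omega.eval P.s P.m).comp H.tailCLM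

theorem headCLM_apply (H : P.Regular C₂) (y : Omega (P.s - P.sL)) :
    H.headCLM y = P.tailInv (infPart P.m y) 0 := P.tailSeq_add y 0

/-- `y ↦ A_m y_F`. -/
def amCLM (P : Data) : Omega (P.s - P.sL) →L[ℝ] (Fin P.m → ℝ) :=
  (LinearMap.toContinuousLinearMap (Matrix.toLin' P.Am)).comp (Omega.finCLM _ P.m)

/-- The operator `A` as a bounded map `Ω^{s - s_L} → Ω^s`. -/
def ACLM (H : P.Regular C₂) : Omega (P.s - P.sL) →L[ℝ] Omega P.s :=
  (extendCLM P.s P.m).comp (amCLM P)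
    - P.beta (P.m - 1) • (H.headCLM.smulRight (extendCLM P.s P.m fun i => P.Am i P.last))
    - P.lam P.m • (((ContinuousLinearMap.proj P.last).comp (amCLM P)).smulRight H.wSeq)
    + H.tailCLM
    + (P.beta (P.m - 1) * P.lam P.m * P.Am P.last P.last) • (H.headCLM.smulRight H.wSeq)

theorem ACLM_apply (H : P.Regular C₂) (y : Omega (P.s - P.sL)) (k : ℕ) :
    H.ACLM y k = P.A y k := by
  have e : H.ACLM y k = extend (P.Am.mulVec (finPart P.m y)) k
      - P.beta (P.m - 1) * (H.headCLM y * extend (fun i => P.Am i P.last) k)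
      - P.lam P.m * (P.Am.mulVec (finPart P.m y) P.last * H.wSeq k)
      + P.tailSeq y k
      + P.beta (P.m - 1) * P.lam P.m * P.Am P.last P.last * (H.headCLM y * H.wSeq k) := rfl
  rw [e, headCLM_apply, A]
  split_ifs with hk
  · rw [extend_of_lt _ hk, extend_of_lt _ hk, H.wSeq_of_lt hk, tailSeq, if_pos hk]
    ring
  · obtain ⟨n, rfl⟩ := Nat.exists_eq_add_of_le (not_lt.1 hk)
    rw [extend_of_le _ (by omega), extend_of_le _ (by omega), H.wSeq_add, tailSeq_add,
      Nat.add_sub_cancel_left]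
    ring

/-! ### The map `T` -/

/-- Length `2 m` instead of `2 m - 1` is harmless, as the additional entry is zero; finite support
puts `g` in `Ω^{s - s_L}`. -/
theorem g_eq_extend (hg : ∀ k, 2 * P.m - 1 ≤ k → P.g k = 0) (k : ℕ) :
    extend (fun i : Fin (2 * P.m) => P.g i) k = P.g k := by
  unfold extend
  split_ifs with h
  · rfl
  · exact (hg k (by omega)).symm

/-- `f : Ω^s → Ω^{s - s_L}`. -/
def fMap (H : P.Regular C₂) (hL : 1 ≤ P.L) (hm : 6 ≤ P.m) (x : Omega P.s) : Omega (P.s - P.sL) :=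
  H.linCLM x + (P.σ • H.convCLM hL hm x x + extendCLM _ (2 * P.m) fun i => P.g i)

theorem fMap_apply (H : P.Regular C₂) (hL : 1 ≤ P.L) (hm : 6 ≤ P.m)
    (hg : ∀ k, 2 * P.m - 1 ≤ k → P.g k = 0) (x : Omega P.s) (k : ℕ) :
    H.fMap hL hm x k = P.f x k := by
  have e : H.fMap hL hm x k
      = P.lin x k + (P.σ * conv x x k + extend (fun i : Fin (2 * P.m) => P.g i) k) := rfl
  rw [e, g_eq_extend hg]
  rfl

/-- The derivative `Df(x) h = 𝓛 h + 2σ x * h`. -/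
def fDeriv (H : P.Regular C₂) (hL : 1 ≤ P.L) (hm : 6 ≤ P.m) (x : Omega P.s) :
    Omega P.s →L[ℝ] Omega (P.s - P.sL) :=
  H.linCLM + (2 * P.σ) • H.convCLM hL hm x

theorem hasFDerivAt_fMap (H : P.Regular C₂) (hL : 1 ≤ P.L) (hm : 6 ≤ P.m) (x : Omega P.s) :
    HasFDerivAt (H.fMap hL hm) (H.fDeriv hL hm x) x := by
  have hB := (H.convCLM hL hm).hasFDerivAt_of_bilinear (hasFDerivAt_id x) (hasFDerivAt_id x)
  have h := H.linCLM.hasFDerivAt.add ((hB.const_smul P.σ).add_const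
    (extendCLM (P.s - P.sL) (2 * P.m) fun i => P.g i))
  refine h.congr_fderiv ?_
  ext y
  refine Omega.ext fun k => ?_
  change P.lin y k + P.σ * (conv x y k + conv y x k) = P.lin y k + 2 * P.σ * conv x y k
  rw [conv_comm y x]
  ring

/-- The Newton-like operator `T = id - A f`. -/
def newton (H : P.Regular C₂) (hL : 1 ≤ P.L) (hm : 6 ≤ P.m) (x : Omega P.s) : Omega P.s :=
  x - H.ACLM (H.fMap hL hm x)

theorem hasFDerivAt_newton (H : P.Regular C₂) (hL : 1 ≤ P.L) (hm : 6 ≤ P.m) (x : Omega P.s) :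
    HasFDerivAt (H.newton hL hm)
      (ContinuousLinearMap.id ℝ _ - H.ACLM.comp (H.fDeriv hL hm x)) x :=
  (hasFDerivAt_id x).sub (H.ACLM.hasFDerivAt.comp x (H.hasFDerivAt_fMap hL hm x))

theorem newton_apply (H : P.Regular C₂) (hL : 1 ≤ P.L) (hm : 6 ≤ P.m)
    (hg : ∀ k, 2 * P.m - 1 ≤ k → P.g k = 0) (x : Omega P.s) (k : ℕ) :
    H.newton hL hm x k = x k - P.A (P.f x) k := by
  change x k - H.ACLM (H.fMap hL hm x) k = _
  rw [ACLM_apply]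
  congr 2
  exact funext (H.fMap_apply hL hm hg x)

/-- The Jacobian matrix of the projection. -/
theorem D_mulVec (H : P.Regular C₂) (hL : 1 ≤ P.L) (hm : 6 ≤ P.m)
    (hg : ∀ k, 2 * P.m - 1 ≤ k → P.g k = 0) (v : Fin P.m → ℝ) (i : Fin P.m) :
    P.D.mulVec v i = P.lin (extend v) i + 2 * P.σ * conv P.xbar (extend v) i := by
  -- The projection factors as extension, `f` on `Ω^s`, restriction, so its Jacobian comes from the
  -- chain rule.
  have e : P.fProj = fun u => Omega.finCLM _ P.m (H.fMap hL hm (extendCLM P.s P.m u)) := by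
    funext u i
    change P.f (extend u) i = H.fMap hL hm (extendCLM P.s P.m u) i
    rw [H.fMap_apply hL hm hg]
    rfl
  have hd : HasFDerivAt P.fProj ((Omega.finCLM _ P.m).comp
      ((H.fDeriv hL hm (extendCLM P.s P.m P.xF)).comp (extendCLM P.s P.m))) P.xF := by
    rw [e]
    exact (Omega.finCLM _ P.m).hasFDerivAt.comp P.xF
      ((H.hasFDerivAt_fMap hL hm _).comp P.xF (extendCLM P.s P.m).hasFDerivAt)
  rw [D, hd.fderiv, LinearMap.toMatrix'_mulVec]
  rfl

end Regular

end Data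

/-! ### Two-sided sums of finitely supported data, and entrywise bounds for `A` -/

theorem greenSum_of_support {θ : ℝ} {q : ℕ → ℝ} {N : ℕ} (hq : ∀ j, N ≤ j → q j = 0) (k : ℕ) :
    greenSum θ q k = ∑ j ∈ Finset.range k, θ ^ (k - j) * q j
      + ∑ l ∈ Finset.Ico k N, θ ^ (l - k) * q l := by
  unfold greenSum
  rw [Finset.sum_Ico_eq_sum_range, tsum_eq_sum (s := Finset.range (N - k))]
  · simp only [Nat.add_sub_cancel_left]
  · intro i hi
    rw [Finset.mem_range, not_lt] at hi
    rw [hq _ (by omega), mul_zero]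

theorem greenSum_of_le {θ : ℝ} {q : ℕ → ℝ} {N : ℕ} (hq : ∀ j, N ≤ j → q j = 0) {k : ℕ}
    (hk : k + 1 ≤ N) :
    greenSum θ q k = ∑ j ∈ Finset.Icc 0 k, θ ^ (k - j) * q j
      + ∑ l ∈ Finset.Icc (k + 1) (N - 1), θ ^ (l - k) * q l := by
  rw [greenSum_of_support hq, Finset.sum_eq_sum_Ico_succ_bot (by omega), ← add_assoc]
  congr 1
  · rw [show Finset.Icc 0 k = Finset.range (k + 1) from Finset.ext fun _ => by simp,
      Finset.sum_range_succ]
  · exact Finset.sum_congr (by ext; simp; omega) fun _ _ => rfl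

theorem greenSum_of_ge {θ : ℝ} (hθ : θ ≠ 0) {q : ℕ → ℝ} {N : ℕ} (hN : 1 ≤ N)
    (hq : ∀ j, N ≤ j → q j = 0) {k : ℕ} (hk : N ≤ k + 1) :
    greenSum θ q k = θ ^ k * ∑ l ∈ Finset.Icc 0 (N - 1), q l / θ ^ l := by
  have h1 : greenSum θ q k = ∑ j ∈ Finset.range (k + 1), θ ^ (k - j) * q j := by
    rw [greenSum_of_support (N := k + 1) (fun j hj => hq j (by omega)), Finset.sum_range_succ,
      Finset.sum_Ico_succ_top le_rfl]
    simp
  rw [h1, show Finset.Icc 0 (N - 1) = Finset.range N by ext; simp; omega, Finset.mul_sum]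
  rw [← Finset.sum_subset (Finset.range_mono hk) fun j _ hj => by
    rw [hq j (by simpa using hj), mul_zero]]
  refine Finset.sum_congr rfl fun j hj => ?_
  have := Finset.mem_range.1 hj
  rw [pow_sub₀ _ hθ (by omega)]
  field_simp

theorem abs_mulVec_le {m : ℕ} (B : Matrix (Fin m) (Fin m) ℝ) {u v : Fin m → ℝ}
    (h : ∀ j, |u j| ≤ v j) (i : Fin m) : |B.mulVec u i| ≤ (B.map abs).mulVec v i := by
  refine (Finset.abs_sum_le_sum_abs (fun j => B i j * u j) Finset.univ).trans
    (Finset.sum_le_sum fun j _ => ?_)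
  rw [abs_mul]
  exact mul_le_mul_of_nonneg_left (h j) (abs_nonneg _)

namespace Data

theorem forall_index (P : Data) {p : ℕ → Prop} (h1 : ∀ i : Fin P.m, p i)
    (h2 : ∀ n, n ≤ P.M → p (P.m + n)) (h3 : ∀ n, P.M < n → p (P.m + n)) (k : ℕ) : p k := by
  rcases lt_or_ge k P.m with hk | hk
  · exact h1 ⟨k, hk⟩
  · obtain ⟨n, rfl⟩ := Nat.exists_eq_add_of_le hk
    rcases le_or_gt n P.M with hn | hn
    · exact h2 n hn
    · exact h3 n hn

theorem glue_fin (P : Data) (u : Fin P.m → ℝ) (v : ℕ → ℝ) (i : Fin P.m) :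
    P.glue u v i = u i := dif_pos i.2

theorem glue_add_of_le (P : Data) (u : Fin P.m → ℝ) (v : ℕ → ℝ) {n : ℕ} (hn : n ≤ P.M) :
    P.glue u v (P.m + n) = v n := by
  rw [glue, dif_neg (by omega), if_pos (by omega), Nat.add_sub_cancel_left]

theorem glue_add_of_gt (P : Data) (u : Fin P.m → ℝ) (v : ℕ → ℝ) {n : ℕ} (hn : P.M < n) :
    P.glue u v (P.m + n) = v P.M * wt P.s (P.m + P.M) / wt P.s (P.m + n) := by
  rw [glue, dif_neg (by omega), if_neg (by omega)]

theorem abs_A_fin_le (P : Data) (y : ℕ → ℝ) (i : Fin P.m) :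
    |P.A y i| ≤ |P.Am.mulVec (finPart P.m y) i|
      + |P.beta (P.m - 1)| * |P.tailInv (infPart P.m y) 0| * |P.Am i P.last| := by
  rw [A, dif_pos i.2]
  refine (abs_sub _ _).trans_eq ?_
  rw [abs_mul, abs_mul]

namespace Regular

variable {P : Data} {C₂ : ℝ}

theorem abs_lam_mul_wI_le (H : P.Regular C₂) (n : ℕ) :
    |P.lam P.m * P.wI n| ≤ P.η * P.θ ^ n * (|P.lam P.m| / |P.mu P.m|) := by
  rw [abs_mul]
  refine (mul_le_mul_of_nonneg_left (H.abs_wI_le n) (abs_nonneg _)).trans_eq ?_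
  ring

theorem abs_A_tail_le (H : P.Regular C₂) (y : ℕ → ℝ) (n : ℕ) :
    |P.A y (P.m + n)| ≤ (|P.Am.mulVec (finPart P.m y) P.last|
        + |P.beta (P.m - 1) * P.Am P.last P.last| * |P.tailInv (infPart P.m y) 0|)
          * (P.η * P.θ ^ n * (|P.lam P.m| / |P.mu P.m|))
      + |P.tailInv (infPart P.m y) n| := by
  rw [A, dif_neg (by omega), Nat.add_sub_cancel_left]
  set t := P.tailInv (infPart P.m y) 0
  set v := P.Am.mulVec (finPart P.m y) P.last
  -- The two multiples of `w` are merged, so that `λ_m w_n` is estimated once.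
  have e : -P.lam P.m * v * P.wI n + P.tailInv (infPart P.m y) n
      + P.beta (P.m - 1) * P.lam P.m * P.Am P.last P.last * t * P.wI n
      = (P.beta (P.m - 1) * P.Am P.last P.last * t - v) * (P.lam P.m * P.wI n)
        + P.tailInv (infPart P.m y) n := by ring
  rw [e]
  refine (abs_add_le _ _).trans (add_le_add_left ?_ _)
  rw [abs_mul]
  refine mul_le_mul ?_ (H.abs_lam_mul_wI_le n) (abs_nonneg _) (by positivity)
  refine (abs_sub _ _).trans_eq ?_
  rw [abs_mul _ t, add_comm]

/-! ### The bound `Y` -/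

theorem xbar_of_le (P : Data) {k : ℕ} (hk : P.m ≤ k) : P.xbar k = 0 := extend_of_le _ hk

/-- If `k ≥ 2 m - 1`, then `|j|` and `|k - j|` cannot both be below `m`. -/
theorem f_xbar_eq_zero (hg : ∀ k, 2 * P.m - 1 ≤ k → P.g k = 0) (hm : 6 ≤ P.m) {k : ℕ}
    (hk : 2 * P.m - 1 ≤ k) : P.f P.xbar k = 0 := by
  have hc : conv P.xbar P.xbar k = 0 := by
    unfold conv
    refine (tsum_congr fun j => ?_).trans tsum_zero
    rcases lt_or_ge j.natAbs P.m with hj | hj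
    · rw [xbar_of_le P (k := ((k : ℤ) - j).natAbs) (by omega), mul_zero]
    · rw [xbar_of_le P hj, zero_mul]
  rw [f, nonlin, hc, hg k hk, lin_eq, xbar_of_le P (k := k - 1) (by omega),
    xbar_of_le P (k := k) (by omega), xbar_of_le P (k := k + 1) (by omega)]
  simp

theorem q_eq_zero (hg : ∀ k, 2 * P.m - 1 ≤ k → P.g k = 0) (hm : 6 ≤ P.m) {l : ℕ}
    (hl : P.m - 1 ≤ l) : P.q l = 0 := by
  rw [q, f_xbar_eq_zero hg hm (by omega), abs_zero, zero_div]

theorem abs_tailInv_f_xbar_le (H : P.Regular C₂) (hL : 1 ≤ P.L) (hm : 6 ≤ P.m)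
    (hg : ∀ k, 2 * P.m - 1 ≤ k → P.g k = 0) (k : ℕ) :
    |P.tailInv (infPart P.m (P.f P.xbar)) k| ≤ P.η * greenSum P.θ P.q k := by
  have e : P.f P.xbar = H.fMap hL hm P.xbarOmega :=
    funext fun k => (H.fMap_apply hL hm hg P.xbarOmega k).symm
  have hb := H.infPart_bdd (H.fMap hL hm P.xbarOmega)
  rw [← e] at hb
  exact H.abs_tailInv_le hb k

theorem greenSum_q_zero (hg : ∀ k, 2 * P.m - 1 ≤ k → P.g k = 0) (hm : 6 ≤ P.m) :
    greenSum P.θ P.q 0 = P.S := by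
  rw [greenSum_of_support (fun j => q_eq_zero hg hm)]
  simp only [Finset.range_zero, Finset.sum_empty, zero_add, Nat.sub_zero]
  exact Finset.sum_congr (by ext; simp; omega) fun _ _ => rfl

theorem abs_A_f_xbar_le_YI (H : P.Regular C₂) (hL : 1 ≤ P.L) (hm : 6 ≤ P.m)
    (hg : ∀ k, 2 * P.m - 1 ≤ k → P.g k = 0) (n : ℕ) :
    |P.A (P.f P.xbar) (P.m + n)| ≤ P.YI n := by
  have hη := H.η_pos
  have hθ := H.θ_pos
  have h0 := H.abs_tailInv_f_xbar_le hL hm hg 0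
  rw [greenSum_q_zero hg hm] at h0
  have hn := H.abs_tailInv_f_xbar_le hL hm hg n
  have hgr : P.η * greenSum P.θ P.q n = if n + 3 ≤ P.m then
      P.η * ∑ l ∈ Finset.Icc 0 n, P.θ ^ (n - l) * P.q l
        + P.η * ∑ l ∈ Finset.Icc (n + 1) (P.m - 2), P.θ ^ (l - n) * P.q l
    else
      P.η * P.θ ^ n * ∑ l ∈ Finset.Icc 0 (P.m - 2), P.q l / P.θ ^ l := by
    split_ifs with h
    · rw [greenSum_of_le (fun j => q_eq_zero hg hm) (by omega), ← mul_add,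
        show P.m - 1 - 1 = P.m - 2 by omega]
    · rw [greenSum_of_ge hθ.ne' (by omega) (fun j => q_eq_zero hg hm) (by omega), mul_assoc,
        show P.m - 1 - 1 = P.m - 2 by omega]
  rw [hgr] at hn
  refine (H.abs_A_tail_le _ n).trans (add_le_add ?_ hn)
  calc _ ≤ (|P.Am.mulVec (finPart P.m (P.f P.xbar)) P.last|
        + |P.beta (P.m - 1) * P.Am P.last P.last| * (P.η * P.S))
          * (P.η * P.θ ^ n * (|P.lam P.m| / |P.mu P.m|)) := by gcongr
    _ = _ := by ring

/-- Past the support of `f(x̄)` the bound is a pure multiple of `θ^n`, so the extrapolation beyond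
`M` reduces to monotonicity of `θ^n ω_{m+n}^s`. -/
theorem YI_of_ge (P : Data) {n : ℕ} (hn : P.m ≤ n + 2) :
    P.YI n = ((|P.Am.mulVec (finPart P.m (P.f P.xbar)) P.last|
      + |P.beta (P.m - 1) * P.Am P.last P.last| * P.η * P.S) * P.η * (|P.lam P.m| / |P.mu P.m|)
      + P.η * ∑ l ∈ Finset.Icc 0 (P.m - 2), P.q l / P.θ ^ l) * P.θ ^ n := by
  rw [YI, if_neg (by omega)]
  ring

theorem abs_A_f_xbar_le (H : P.Regular C₂) (hL : 1 ≤ P.L) (hm : 6 ≤ P.m)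
    (hg : ∀ k, 2 * P.m - 1 ≤ k → P.g k = 0) (hMA : P.CondMA) (hMY : P.CondMY) (k : ℕ) :
    |P.A (P.f P.xbar) k| ≤ P.Y k := by
  have hη := H.η_pos
  have hθ := H.θ_pos
  have hmM := m_le_M hMA
  refine P.forall_index (p := fun k => |P.A (P.f P.xbar) k| ≤ P.Y k) (fun i => ?_)
    (fun n hn => ?_) (fun n hn => ?_) k
  · rw [Y, glue_fin]
    have h0 := H.abs_tailInv_f_xbar_le hL hm hg 0
    rw [greenSum_q_zero hg hm] at h0
    refine (P.abs_A_fin_le _ i).trans (add_le_add_right ?_ _)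
    rw [mul_assoc |P.beta _| P.η]
    gcongr
  · rw [Y, glue_add_of_le _ _ _ hn]
    exact H.abs_A_f_xbar_le_YI hL hm hg n
  · rw [Y, glue_add_of_gt _ _ _ hn]
    have h1 := H.abs_A_f_xbar_le_YI hL hm hg n
    refine h1.trans ?_
    have h2 := (abs_nonneg _).trans h1
    rw [YI_of_ge P (by omega)] at h2 ⊢
    rw [YI_of_ge P (by omega), mul_assoc _ (P.θ ^ P.M), mul_div_assoc]
    -- The sign of the coefficient is read off from the fact that the whole expression dominates an
    -- absolute value.
    have h3 := nonneg_of_mul_nonneg_left h2 (pow_pos hθ n)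
    exact mul_le_mul_of_nonneg_left (geom_mul_wt_antitone hθ (by linarith [H.one_lt_s]) P.m_pos
      (H.s_div_le hMY) hn.le) h3

/-! ### The defect `I - A A†` -/

/-- `A† h`, where `A†` is the block operator approximated by the inverse of `A`. -/
def dagger (H : P.Regular C₂) (hL : 1 ≤ P.L) (hm : 6 ≤ P.m) (h : Omega P.s) :
    Omega (P.s - P.sL) :=
  H.linCLM h + (2 * P.σ) • extendCLM _ P.m (Omega.finCLM _ P.m
    (H.convCLM hL hm P.xbarOmega (extendCLM _ P.m (Omega.finCLM _ P.m h))))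

/-- The tail of `h` reaches the finite block only through the superdiagonal entry of the last row.
-/
theorem finPart_dagger (H : P.Regular C₂) (hL : 1 ≤ P.L) (hm : 6 ≤ P.m)
    (hg : ∀ k, 2 * P.m - 1 ≤ k → P.g k = 0) (h : Omega P.s) :
    finPart P.m (H.dagger hL hm h) = P.D.mulVec (finPart P.m h)
      + Pi.single P.last (P.beta (P.m - 1) * h P.m) := by
  funext i
  have e : finPart P.m (H.dagger hL hm h) i = P.lin h i + 2 * P.σ * extend
      (finPart P.m (conv P.xbar (extend (finPart P.m h)))) i := rfl
  have e3 : extend (finPart P.m (conv P.xbar (extend (finPart P.m h)))) i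
      = conv P.xbar (extend (finPart P.m h)) i := extend_of_lt _ i.2
  rw [e, e3, Pi.add_apply, H.D_mulVec hL hm hg, lin_eq, lin_eq]
  have h1 : extend (finPart P.m h) (i - 1) = h (i - 1) := extend_of_lt _ (by omega)
  have h2 : extend (finPart P.m h) i = h i := extend_of_lt _ i.2
  rw [h1, h2]
  by_cases hi : i = P.last
  · have hi' : (i : ℕ) = P.m - 1 := by rw [hi]; rfl
    rw [hi, Pi.single_eq_same, ← hi, hi', Nat.sub_add_cancel P.m_pos, extend_of_le _ le_rfl]
    ring
  · have hi' : (i : ℕ) ≠ P.m - 1 := fun hc => hi (Fin.ext hc)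
    rw [Pi.single_eq_of_ne hi, extend_of_lt _ (show (i : ℕ) + 1 < P.m by omega)]
    simp only [finPart]
    ring

theorem infPart_dagger (H : P.Regular C₂) (hL : 1 ≤ P.L) (hm : 6 ≤ P.m) (h : Omega P.s) :
    P.tri (infPart P.m h) = infPart P.m (H.dagger hL hm h)
      + (-(P.lam P.m * h (P.m - 1))) • Pi.single 0 1 := by
  funext n
  have e : infPart P.m (H.dagger hL hm h) n = P.lin h (P.m + n) + 2 * P.σ * extend
      (finPart P.m (conv P.xbar (extend (finPart P.m h)))) (P.m + n) := rfl
  have hm0 := P.m_pos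
  rw [Pi.add_apply, e, extend_of_le _ (by omega), lin_eq, if_neg (by omega)]
  rcases n with _ | n
  · simp [tri, infPart, b, c]
    ring
  · rw [show P.m + (n + 1) - 1 = P.m + n by omega]
    simp [tri, infPart, a, b, c, add_assoc]

/-- The tail of `A† h` is the tridiagonal tail of `h` plus `λ_m h_{m-1} e_0`; the left inverse `𝒯⁻¹`
turns the latter into a multiple of `w`. -/
theorem tailInv_dagger (H : P.Regular C₂) (hL : 1 ≤ P.L) (hm : 6 ≤ P.m) (h : Omega P.s) (n : ℕ) :
    P.tailInv (infPart P.m (H.dagger hL hm h)) n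
      = P.lam P.m * h (P.m - 1) * P.wI n + h (P.m + n) := by
  have hx : ∀ j, |infPart P.m h j| ≤ ‖h‖ := fun j => (h.abs_le _).trans
    (div_le_self (norm_nonneg _) (one_le_wt (by linarith [H.one_lt_s]) _))
  have hb : ∀ j, |((-(P.lam P.m * h (P.m - 1))) • Pi.single 0 1 : ℕ → ℝ) j| / |P.b (j + 1)|
      ≤ |-(P.lam P.m * h (P.m - 1))| * (1 / |P.mu P.m|) := fun j => by
    rw [Pi.smul_apply, smul_eq_mul, abs_mul, mul_div_assoc]
    exact mul_le_mul_of_nonneg_left (single_bdd P j) (abs_nonneg _)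
  have h1 := congrFun (H.tailInv_tri hx) n
  rw [infPart_dagger H hL hm, H.tailInv_add (H.infPart_bdd _) hb, tailInv_smul, Pi.add_apply,
    Pi.smul_apply, smul_eq_mul] at h1
  change _ + _ * P.wI n = h (P.m + n) at h1
  linarith

theorem KTilde_mulVec (P : Data) (v : Fin P.m → ℝ) :
    P.KTilde.mulVec v = P.D.mulVec v
      - Pi.single P.last (P.beta (P.m - 1) * P.lam P.m * P.wTilde * v P.last) := by
  rw [KTilde, Matrix.sub_mulVec, Matrix.smul_mulVec, Matrix.single_mulVec]
  congr 1
  funext i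
  by_cases hi : i = P.last
  · subst hi; simp; ring
  · simp [hi]

theorem mulVec_single_last (P : Data) (c : ℝ) (i : Fin P.m) :
    P.Am.mulVec (Pi.single P.last c) i = c * P.Am i P.last := by
  simp [Matrix.mulVec_single, mul_comm]

/-- The finite part of `(I - A A†) h`. -/
def _root_.TridiagNewton.Data.defect (P : Data) (h : ℕ → ℝ) (i : Fin P.m) : ℝ :=
  (1 - P.Am * P.KTilde).mulVec (finPart P.m h) i
    + P.beta (P.m - 1) * P.lam P.m * h (P.m - 1) * (P.wI 0 - P.wTilde) * P.Am i P.last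

/-- Exact elimination of the tail involves `w_0`, whereas `K̃` uses `w̃`; the correction with `w_0 -
w̃` makes `w̃` cancel. -/
theorem defect_eq (P : Data) (h : ℕ → ℝ) (i : Fin P.m) :
    P.defect h i = h i - P.Am.mulVec (P.D.mulVec (finPart P.m h)) i
      + P.beta (P.m - 1) * P.lam P.m * h (P.m - 1) * P.wI 0 * P.Am i P.last := by
  rw [defect, Matrix.sub_mulVec, Matrix.one_mulVec, ← Matrix.mulVec_mulVec, KTilde_mulVec,
    Matrix.mulVec_sub, Pi.sub_apply, Pi.sub_apply, mulVec_single_last,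
    show finPart P.m h P.last = h (P.m - 1) from rfl, show finPart P.m h i = h i from rfl]
  ring

theorem sub_A_dagger_fin (H : P.Regular C₂) (hL : 1 ≤ P.L) (hm : 6 ≤ P.m)
    (hg : ∀ k, 2 * P.m - 1 ≤ k → P.g k = 0) (h : Omega P.s) (i : Fin P.m) :
    h i - P.A (H.dagger hL hm h) i = P.defect h i := by
  rw [A, dif_pos i.2, H.finPart_dagger hL hm hg, H.tailInv_dagger, Matrix.mulVec_add,
    Pi.add_apply, mulVec_single_last, defect_eq, add_zero]
  ring

/-- `A` reconstructs the tail from the last finite entry, so the tail error is that entry's error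
propagated along `w`. This is why the tail of `Z¹` repeats the last row of its finite part. -/
theorem sub_A_dagger_tail (H : P.Regular C₂) (hL : 1 ≤ P.L) (hm : 6 ≤ P.m)
    (hg : ∀ k, 2 * P.m - 1 ≤ k → P.g k = 0) (h : Omega P.s) (n : ℕ) :
    h (P.m + n) - P.A (H.dagger hL hm h) (P.m + n)
      = -(P.lam P.m * P.wI n * P.defect h P.last) := by
  rw [A, dif_neg (by omega), H.finPart_dagger hL hm hg, H.tailInv_dagger, H.tailInv_dagger,
    Matrix.mulVec_add, Pi.add_apply, mulVec_single_last, defect_eq, add_zero,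
    Nat.add_sub_cancel_left, show h (P.last : ℕ) = h (P.m - 1) from rfl]
  ring

theorem abs_defect_le (H : P.Regular C₂) (hL : 1 ≤ P.L) {r : ℝ} {h : Omega P.s} (hr : ‖h‖ ≤ r)
    (i : Fin P.m) :
    |P.defect h i| ≤ (P.absDefect.mulVec P.WF i + P.ε * P.absAm i P.last) * r := by
  have hh : ∀ k, |h k| ≤ r * (1 / wt P.s k) := fun k => by
    rw [mul_one_div]
    exact (h.abs_le k).trans (div_le_div_of_nonneg_right hr (wt_pos _ _).le)
  have h1 : |(1 - P.Am * P.KTilde).mulVec (finPart P.m h) i| ≤ P.absDefect.mulVec P.WF i * r := by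
    refine (abs_mulVec_le _ (v := r • P.WF) (fun j => hh j) i).trans_eq ?_
    rw [Matrix.mulVec_smul, Pi.smul_apply, smul_eq_mul, mul_comm]
    rfl
  have h2 : |P.beta (P.m - 1) * P.lam P.m * h (P.m - 1) * (P.wI 0 - P.wTilde) * P.Am i P.last|
      ≤ P.ε * P.absAm i P.last * r := by
    have hw := wt_pos P.s (P.m - 1)
    have hr0 := (norm_nonneg h).trans hr
    simp only [abs_mul]
    calc _ ≤ |P.beta (P.m - 1)| * |P.lam P.m| * (r * (1 / wt P.s (P.m - 1)))
          * (P.θ ^ (2 * P.L) / (|P.mu P.m| * (1 - P.θ ^ 2))) * |P.Am i P.last| := by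
          gcongr
          · exact hh _
          · exact H.abs_wI_sub_wTilde_le hL
      _ = _ := by
          have e : P.absAm i P.last = |P.Am i P.last| := rfl
          rw [e, Data.ε]
          -- Making the denominator an atom lets `ring` treat its inverse as a single variable.
          generalize 1 - P.θ ^ 2 = d
          ring
  rw [add_mul]
  exact (abs_add_le _ _).trans (add_le_add h1 h2)

/-! ### The remainder `Df(x̄ + b₁) h - A† h` -/

/-- `Df(x̄ + b₁) h - A† h`. -/
def remainder (H : P.Regular C₂) (hL : 1 ≤ P.L) (hm : 6 ≤ P.m) (b₁ h : Omega P.s) :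
    Omega (P.s - P.sL) :=
  H.fDeriv hL hm (P.xbarOmega + b₁) h - H.dagger hL hm h

/-- The second factor lives on indices `≥ m`. With `0 ≤ i < m` and `|j| < m`, `|i - j| ≥ m` forces
`j = -l` with `i + l ≥ m`, so the sum is finite and one-sided. -/
theorem abs_conv_xbar_le {r : ℝ} {h : Omega P.s} (hr : ‖h‖ ≤ r) (i : Fin P.m) :
    |conv P.xbar (h - extendCLM P.s P.m (finPart P.m h) : Omega P.s) i|
      ≤ (∑ l ∈ Finset.Icc (P.m - i) (P.m - 1), |P.xbar l| / wt P.s (i + l)) * r := by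
  have hi := i.2
  set d : Omega P.s := h - extendCLM P.s P.m (finPart P.m h) with hd
  have hd1 : ∀ k, k < P.m → d k = 0 := fun k hk => by
    change h k - extend (finPart P.m h) k = 0
    rw [extend_of_lt _ hk]
    exact sub_self _
  have hd2 : ∀ k, P.m ≤ k → d k = h k := fun k hk => by
    change h k - extend (finPart P.m h) k = h k
    rw [extend_of_le _ hk, sub_zero]
  have hsum : conv P.xbar d i
      = ∑ l ∈ Finset.Icc (P.m - i) (P.m - 1), P.xbar l * d (i + l) := by
    unfold conv
    rw [tsum_eq_sum (s := (Finset.Icc (P.m - (i : ℕ)) (P.m - 1)).image fun l : ℕ => -(l : ℤ)),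
      Finset.sum_image (fun a _ b _ hab => by simpa using hab)]
    · refine Finset.sum_congr rfl fun l _ => ?_
      rw [show (-(l : ℤ)).natAbs = l by omega, show ((i : ℕ) - -(l : ℤ)).natAbs = i + l by omega]
    · intro j hj
      rcases lt_or_ge j.natAbs P.m with h1 | h1
      · rcases lt_or_ge (((i : ℕ) : ℤ) - j).natAbs P.m with h2 | h2
        · rw [hd1 _ h2, mul_zero]
        · exact absurd (Finset.mem_image.2 ⟨j.natAbs, Finset.mem_Icc.2 ⟨by omega, by omega⟩,
            by omega⟩) hj
      · rw [xbar_of_le P h1, zero_mul]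
  rw [hsum, Finset.sum_mul]
  refine (Finset.abs_sum_le_sum_abs _ _).trans (Finset.sum_le_sum fun l hl => ?_)
  rw [Finset.mem_Icc] at hl
  rw [hd2 _ (by omega), abs_mul, div_mul_eq_mul_div, mul_div_assoc]
  refine mul_le_mul_of_nonneg_left ((h.abs_le _).trans ?_) (abs_nonneg _)
  exact div_le_div_of_nonneg_right hr (wt_pos _ _).le

theorem conv_add_left (H : P.Regular C₂) (x y z : Omega P.s) (k : ℕ) :
    conv (x + y : Omega P.s) z k = conv x z k + conv y z k := by
  rw [conv_comm, conv_add_right H.one_lt_s, conv_comm z x, conv_comm z y]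

theorem abs_remainder_fin_le (H : P.Regular C₂) (hL : 1 ≤ P.L) (hm : 6 ≤ P.m) {r : ℝ}
    {b₁ h : Omega P.s} (hb : ‖b₁‖ ≤ r) (hr : ‖h‖ ≤ r) (i : Fin P.m) :
    |H.remainder hL hm b₁ h i| ≤ P.C1F i * r + P.C2F i * r ^ 2 := by
  have e : H.remainder hL hm b₁ h i
      = (P.lin h i + 2 * P.σ * conv (P.xbarOmega + b₁ : Omega P.s) h i)
        - (P.lin h i + 2 * P.σ * extend
          (finPart P.m (conv P.xbarOmega (extendCLM P.s P.m (finPart P.m h)))) i) := rfl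
  have e2 : conv P.xbar (h - extendCLM P.s P.m (finPart P.m h) : Omega P.s) i
      = conv P.xbarOmega h i - conv P.xbarOmega (extendCLM P.s P.m (finPart P.m h)) i := by
    have := conv_add_right H.one_lt_s P.xbarOmega (h - extendCLM P.s P.m (finPart P.m h))
      (extendCLM P.s P.m (finPart P.m h)) i
    rw [sub_add_cancel] at this
    rw [this]
    exact (add_sub_cancel_right _ _).symm
  have h1 := abs_conv_xbar_le hr i
  have h2 := H.abs_conv_le_alpha hL b₁ h i.2
  have hα : 0 ≤ alpha P.s P.L P.m i := by
    rw [← convWeight_add_zetaUp_eq_alpha _ _ i.2]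
    have h3 := tsum_convTerm_le H.one_lt_s hL i
    exact (tsum_nonneg fun j => convTerm_nonneg _ _ _).trans h3
  have hw := wt_pos P.s i
  have hr0 := (norm_nonneg h).trans hr
  have h3 : |conv b₁ h i| ≤ alpha P.s P.L P.m i / wt P.s i * r ^ 2 := by
    refine h2.trans ?_
    rw [pow_two, div_mul_eq_mul_div, mul_assoc]
    gcongr
  have e3 : H.remainder hL hm b₁ h i = 2 * P.σ *
      (conv P.xbar (h - extendCLM P.s P.m (finPart P.m h) : Omega P.s) i + conv b₁ h i) := by
    rw [e, e2, H.conv_add_left, extend_of_lt _ i.2]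
    simp only [finPart]
    ring
  rw [e3, abs_mul, abs_mul, abs_two, C1F, C2F]
  calc _ ≤ 2 * |P.σ| * ((∑ l ∈ Finset.Icc (P.m - i) (P.m - 1), |P.xbar l| / wt P.s (i + l)) * r
        + alpha P.s P.L P.m i / wt P.s i * r ^ 2) :=
        mul_le_mul_of_nonneg_left ((abs_add_le _ _).trans (add_le_add h1 h3)) (by positivity)
    _ = _ := by ring

/-- In the tail `A†` contains no part of the nonlinearity, so the whole convolution with `x̄ + b₁`
remains. -/
theorem abs_remainder_tail_le (H : P.Regular C₂) (hL : 1 ≤ P.L) (hm : 6 ≤ P.m) {r : ℝ}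
    {b₁ h : Omega P.s} (hb : ‖b₁‖ ≤ r) (hr : ‖h‖ ≤ r) (n : ℕ) :
    |infPart P.m (H.remainder hL hm b₁ h) n|
      ≤ 2 * |P.σ| * P.αm * (seqNorm P.s P.xbar * r + r ^ 2) / wt P.s (P.m + n) := by
  have e : infPart P.m (H.remainder hL hm b₁ h) n
      = (P.lin h (P.m + n) + 2 * P.σ * conv (P.xbarOmega + b₁ : Omega P.s) h (P.m + n))
        - (P.lin h (P.m + n) + 2 * P.σ * extend
          (finPart P.m (conv P.xbarOmega (extendCLM P.s P.m (finPart P.m h)))) (P.m + n)) := rfl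
  have hα : 0 ≤ P.αm := by
    have h3 := tsum_convTerm_le H.one_lt_s hL P.m
    exact (tsum_nonneg fun j => convTerm_nonneg _ _ _).trans
      (h3.trans (convWeight_add_zetaUp_le_alpha H.one_lt_s hL hm le_rfl))
  have hw := wt_pos P.s (P.m + n)
  have hr0 := (norm_nonneg h).trans hr
  have h1 := H.abs_conv_le_αm hL hm P.xbarOmega h (show P.m ≤ P.m + n by omega)
  have h2 := H.abs_conv_le_αm hL hm b₁ h (show P.m ≤ P.m + n by omega)
  have hx : ‖P.xbarOmega‖ = seqNorm P.s P.xbar := rfl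
  have h3 : |conv P.xbarOmega h (P.m + n)| ≤ P.αm * (seqNorm P.s P.xbar * r) / wt P.s (P.m + n) := by
    refine h1.trans ?_
    rw [← hx, mul_assoc]
    gcongr
  have h4 : |conv b₁ h (P.m + n)| ≤ P.αm * r ^ 2 / wt P.s (P.m + n) := by
    refine h2.trans ?_
    rw [pow_two, mul_assoc]
    gcongr
  rw [e, extend_of_le _ (by omega), H.conv_add_left, mul_zero, add_zero, add_sub_cancel_left,
    abs_mul, abs_mul, abs_two]
  calc _ ≤ 2 * |P.σ| * (P.αm * (seqNorm P.s P.xbar * r) / wt P.s (P.m + n)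
        + P.αm * r ^ 2 / wt P.s (P.m + n)) :=
        mul_le_mul_of_nonneg_left ((abs_add_le _ _).trans (add_le_add h3 h4)) (by positivity)
    _ = _ := by ring

/-! ### The bound `Z` -/

/-- The constant in the bound of the tail of the remainder. -/
def _root_.TridiagNewton.Data.tailConst (P : Data) (r : ℝ) : ℝ :=
  2 * |P.σ| * P.αm * (seqNorm P.s P.xbar * r + r ^ 2)

theorem tailConst_nonneg (H : P.Regular C₂) (hL : 1 ≤ P.L) (hm : 6 ≤ P.m) {r : ℝ} (hr : 0 ≤ r) :
    0 ≤ P.tailConst r := by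
  -- With `b₁ = h = 0` the tail bound is still an upper bound of an absolute value.
  have h1 := H.abs_remainder_tail_le hL hm (b₁ := 0) (h := 0) (by simpa using hr)
    (by simpa using hr) 0
  have h2 := (abs_nonneg _).trans h1
  rw [le_div_iff₀ (wt_pos _ _), zero_mul] at h2
  exact h2

theorem abs_tailInv_remainder_le (H : P.Regular C₂) (hL : 1 ≤ P.L) (hm : 6 ≤ P.m) {r : ℝ}
    {b₁ h : Omega P.s} (hb : ‖b₁‖ ≤ r) (hr : ‖h‖ ≤ r) (n : ℕ) :
    |P.tailInv (infPart P.m (H.remainder hL hm b₁ h)) n|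
      ≤ P.η * (P.tailConst r / P.C₁) * (1 / wt (P.s + P.sL) (P.m + n)
        * (geomWeight P.θ (P.s + P.sL) P.m n + P.θ / (1 - P.θ))) := by
  have hp : 0 ≤ P.s + P.sL := by linarith [H.one_lt_s, H.sL_pos]
  have hC := H.tailConst_nonneg hL hm ((norm_nonneg h).trans hr)
  have hC₁ := H.C₁_pos
  have hη := H.η_pos
  refine (H.abs_tailInv_le_of_le hp (H.abs_remainder_tail_le hL hm hb hr) hC n).trans ?_
  exact mul_le_mul_of_nonneg_left (greenSum_wt_le H.θ_pos.le H.θ_lt_one hp P.m_pos n)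
    (by positivity)

theorem abs_tailInv_remainder_zero_le (H : P.Regular C₂) (hL : 1 ≤ P.L) (hm : 6 ≤ P.m) {r : ℝ}
    {b₁ h : Omega P.s} (hb : ‖b₁‖ ≤ r) (hr : ‖h‖ ≤ r) :
    |P.tailInv (infPart P.m (H.remainder hL hm b₁ h)) 0|
      ≤ P.η * (P.tailConst r / P.C₁) * (1 / (wt (P.s + P.sL) P.m * (1 - P.θ))) := by
  have hp : 0 ≤ P.s + P.sL := by linarith [H.one_lt_s, H.sL_pos]
  have hC := H.tailConst_nonneg hL hm ((norm_nonneg h).trans hr)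
  have hC₁ := H.C₁_pos
  have hη := H.η_pos
  refine (H.abs_tailInv_le_of_le hp (H.abs_remainder_tail_le hL hm hb hr) hC 0).trans ?_
  exact mul_le_mul_of_nonneg_left (greenSum_wt_zero_le H.θ_pos.le H.θ_lt_one hp P.m_pos)
    (by positivity)

theorem abs_mulVec_remainder_le (H : P.Regular C₂) (hL : 1 ≤ P.L) (hm : 6 ≤ P.m) {r : ℝ}
    {b₁ h : Omega P.s} (hb : ‖b₁‖ ≤ r) (hr : ‖h‖ ≤ r) (i : Fin P.m) :
    |P.Am.mulVec (finPart P.m (H.remainder hL hm b₁ h)) i|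
      ≤ P.absAm.mulVec P.C1F i * r + P.absAm.mulVec P.C2F i * r ^ 2 := by
  refine (abs_mulVec_le P.Am (v := r • P.C1F + r ^ 2 • P.C2F) (fun j => ?_) i).trans_eq ?_
  · refine (H.abs_remainder_fin_le hL hm hb hr j).trans_eq ?_
    simp only [Pi.add_apply, Pi.smul_apply, smul_eq_mul]
    ring
  · rw [Matrix.mulVec_add, Matrix.mulVec_smul, Matrix.mulVec_smul, Pi.add_apply, Pi.smul_apply,
      Pi.smul_apply, smul_eq_mul, smul_eq_mul, mul_comm r, mul_comm (r ^ 2)]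
    rfl

theorem newton_deriv_eq (H : P.Regular C₂) (hL : 1 ≤ P.L) (hm : 6 ≤ P.m) (b₁ h : Omega P.s)
    (k : ℕ) : fderiv ℝ (H.newton hL hm) (P.xbarOmega + b₁) h k
      = (h k - P.A (H.dagger hL hm h) k) - P.A (H.remainder hL hm b₁ h) k := by
  rw [(H.hasFDerivAt_newton hL hm _).fderiv, ← H.ACLM_apply, ← H.ACLM_apply, remainder, map_sub]
  change h k - H.ACLM (H.fDeriv hL hm (P.xbarOmega + b₁) h) k
    = (h k - H.ACLM (H.dagger hL hm h) k) - (H.ACLM (H.fDeriv hL hm (P.xbarOmega + b₁) h) k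
      - H.ACLM (H.dagger hL hm h) k)
  ring

/-- The factor of `θ^n` in the bound of the entries of `DT(x̄ + b₁) b₂` of index `m + n`. -/
def _root_.TridiagNewton.Data.geomConst (P : Data) (r : ℝ) : ℝ :=
  ((P.absDefect.mulVec P.WF P.last + P.ε * P.absAm P.last P.last) * r
    + (P.absAm.mulVec P.C1F P.last * r + P.absAm.mulVec P.C2F P.last * r ^ 2
      + |P.beta (P.m - 1) * P.Am P.last P.last|
        * (P.η * (P.tailConst r / P.C₁) * (1 / (wt (P.s + P.sL) P.m * (1 - P.θ))))))
    * (P.η * (|P.lam P.m| / |P.mu P.m|))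

theorem abs_newton_deriv_fin_le (H : P.Regular C₂) (hL : 1 ≤ P.L) (hm : 6 ≤ P.m)
    (hg : ∀ k, 2 * P.m - 1 ≤ k → P.g k = 0) {r : ℝ}
    {b₁ h : Omega P.s} (hb : ‖b₁‖ ≤ r) (hr : ‖h‖ ≤ r) (i : Fin P.m) :
    |fderiv ℝ (H.newton hL hm) (P.xbarOmega + b₁) h i| ≤ P.Z r i := by
  have h0 := H.abs_tailInv_remainder_zero_le hL hm hb hr
  rw [H.newton_deriv_eq, H.sub_A_dagger_fin hL hm hg]
  have hA : |P.A (H.remainder hL hm b₁ h) i|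
      ≤ (P.absAm.mulVec P.C1F i * r + P.absAm.mulVec P.C2F i * r ^ 2)
        + |P.beta (P.m - 1)| * (P.η * (P.tailConst r / P.C₁) *
          (1 / (wt (P.s + P.sL) P.m * (1 - P.θ)))) * |P.Am i P.last| := by
    refine (P.abs_A_fin_le _ i).trans (add_le_add (H.abs_mulVec_remainder_le hL hm hb hr i) ?_)
    gcongr
  refine (abs_sub _ _).trans ((add_le_add (H.abs_defect_le hL hr i) hA).trans_eq ?_)
  rw [Z, Z2, Z1, D1, D2, glue_fin, glue_fin, glue_fin, Z1F, DF, DF, tailConst,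
    show P.absAm i P.last = |P.Am i P.last| from rfl]
  generalize 1 - P.θ = d
  ring

theorem abs_newton_deriv_tail_le (H : P.Regular C₂) (hL : 1 ≤ P.L) (hm : 6 ≤ P.m)
    (hg : ∀ k, 2 * P.m - 1 ≤ k → P.g k = 0) {r : ℝ}
    {b₁ h : Omega P.s} (hb : ‖b₁‖ ≤ r) (hr : ‖h‖ ≤ r) (n : ℕ) :
    |fderiv ℝ (H.newton hL hm) (P.xbarOmega + b₁) h (P.m + n)|
      ≤ P.geomConst r * P.θ ^ n + P.η * (P.tailConst r / P.C₁) * (1 / wt (P.s + P.sL) (P.m + n)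
        * (geomWeight P.θ (P.s + P.sL) P.m n + P.θ / (1 - P.θ))) := by
  have h0 := H.abs_tailInv_remainder_zero_le hL hm hb hr
  have hη := H.η_pos
  have hθ := H.θ_pos
  have hd := H.abs_defect_le hL hr P.last
  rw [H.newton_deriv_eq, H.sub_A_dagger_tail hL hm hg]
  have h1 : |-(P.lam P.m * P.wI n * P.defect h P.last)|
      ≤ P.η * P.θ ^ n * (|P.lam P.m| / |P.mu P.m|)
        * ((P.absDefect.mulVec P.WF P.last + P.ε * P.absAm P.last P.last) * r) := by
    rw [abs_neg, abs_mul]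
    exact mul_le_mul (H.abs_lam_mul_wI_le n) hd (abs_nonneg _) (by positivity)
  have h2 : |P.A (H.remainder hL hm b₁ h) (P.m + n)|
      ≤ (P.absAm.mulVec P.C1F P.last * r + P.absAm.mulVec P.C2F P.last * r ^ 2
        + |P.beta (P.m - 1) * P.Am P.last P.last| * (P.η * (P.tailConst r / P.C₁) *
          (1 / (wt (P.s + P.sL) P.m * (1 - P.θ)))))
          * (P.η * P.θ ^ n * (|P.lam P.m| / |P.mu P.m|))
        + P.η * (P.tailConst r / P.C₁) * (1 / wt (P.s + P.sL) (P.m + n)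
          * (geomWeight P.θ (P.s + P.sL) P.m n + P.θ / (1 - P.θ))) := by
    refine (H.abs_A_tail_le _ n).trans
      (add_le_add ?_ (H.abs_tailInv_remainder_le hL hm hb hr n))
    have := H.abs_mulVec_remainder_le hL hm hb hr P.last
    gcongr
  refine (abs_sub _ _).trans ((add_le_add h1 h2).trans_eq ?_)
  rw [geomConst]
  ring

theorem geomConst_nonneg (H : P.Regular C₂) (hL : 1 ≤ P.L) (hm : 6 ≤ P.m) {r : ℝ} (hr : 0 ≤ r) :
    0 ≤ P.geomConst r := by
  have hz : ‖(0 : Omega P.s)‖ ≤ r := by simpa using hr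
  have h1 := (abs_nonneg _).trans (H.abs_defect_le hL hz P.last)
  have h2 := (abs_nonneg _).trans (H.abs_mulVec_remainder_le hL hm hz hz P.last)
  have h3 := (abs_nonneg _).trans (H.abs_tailInv_remainder_zero_le hL hm hz hz)
  have hη := H.η_pos
  unfold geomConst
  positivity

/-- The factor `X_n` of `D¹` and `D²`. -/
def _root_.TridiagNewton.Data.tailWeight (P : Data) (n : ℕ) : ℝ :=
  if n < P.M then ∑ l ∈ Finset.Icc 0 n,
      P.θ ^ (n - l) * (((P.m : ℝ) + n) / ((P.m : ℝ) + l)) ^ (P.s + P.sL)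
    else P.χ

theorem geomWeight_le_tailWeight (H : P.Regular C₂) (hm : 6 ≤ P.m) (hMA : P.CondMA) (n : ℕ) :
    geomWeight P.θ (P.s + P.sL) P.m n ≤ P.tailWeight n := by
  unfold tailWeight
  split_ifs with h
  · rw [show Finset.Icc 0 n = Finset.range (n + 1) from Finset.ext fun _ => by simp]
    exact le_rfl
  · exact H.geomWeight_le_χ hm hMA (not_lt.1 h)

/-- `Z` is regrouped into a multiple of `θ^n` and an algebraically weighted part, as the two are
extrapolated beyond `M` for different reasons. -/
theorem Z_tail_eq (P : Data) (r : ℝ) (n : ℕ) :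
    P.Z1I r n + (P.DI P.C1F (seqNorm P.s P.xbar) n * r + P.DI P.C2F 1 n * r ^ 2)
      = P.geomConst r * P.θ ^ n + P.η * (P.tailConst r / P.C₁)
        * (1 / wt (P.s + P.sL) (P.m + n) * (P.tailWeight n + P.θ / (1 - P.θ))) := by
  rw [Z1I, DI, DI, geomConst, tailConst, abs_mul,
    show P.absAm P.last P.last = |P.Am P.last P.last| from rfl, tailWeight]
  generalize 1 - P.θ = d
  ring

theorem abs_newton_deriv_le (H : P.Regular C₂) (hL : 1 ≤ P.L) (hm : 6 ≤ P.m)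
    (hg : ∀ k, 2 * P.m - 1 ≤ k → P.g k = 0) (hMA : P.CondMA) (hMY : P.CondMY) {r : ℝ}
    {b₁ h : Omega P.s} (hb : ‖b₁‖ ≤ r) (hr : ‖h‖ ≤ r) (k : ℕ) :
    |fderiv ℝ (H.newton hL hm) (P.xbarOmega + b₁) h k| ≤ P.Z r k := by
  have hθ := H.θ_pos
  have hη := H.η_pos
  have hC₁ := H.C₁_pos
  have hr0 := (norm_nonneg h).trans hr
  have hC := H.tailConst_nonneg hL hm hr0
  have hG := H.geomConst_nonneg hL hm hr0
  have htail : ∀ n, |fderiv ℝ (H.newton hL hm) (P.xbarOmega + b₁) h (P.m + n)|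
      ≤ P.geomConst r * P.θ ^ n + P.η * (P.tailConst r / P.C₁)
        * (1 / wt (P.s + P.sL) (P.m + n) * (P.tailWeight n + P.θ / (1 - P.θ))) := fun n => by
    have hw := wt_pos (P.s + P.sL) (P.m + n)
    have := H.geomWeight_le_tailWeight hm hMA n
    refine (H.abs_newton_deriv_tail_le hL hm hg hb hr n).trans ?_
    gcongr
  refine P.forall_index
    (p := fun k => |fderiv ℝ (H.newton hL hm) (P.xbarOmega + b₁) h k| ≤ P.Z r k)
    (fun i => H.abs_newton_deriv_fin_le hL hm hg hb hr i) (fun n hn => ?_) (fun n hn => ?_) k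
  · rw [Z, Z2, Z1, D1, D2, glue_add_of_le _ _ _ hn, glue_add_of_le _ _ _ hn,
      glue_add_of_le _ _ _ hn, Z_tail_eq]
    exact htail n
  · have e : P.Z r (P.m + n) = (P.Z1I r P.M + (P.DI P.C1F (seqNorm P.s P.xbar) P.M * r
        + P.DI P.C2F 1 P.M * r ^ 2)) * (wt P.s (P.m + P.M) / wt P.s (P.m + n)) := by
      rw [Z, Z2, Z1, D1, D2, glue_add_of_gt _ _ _ hn, glue_add_of_gt _ _ _ hn,
        glue_add_of_gt _ _ _ hn]
      ring
    have hwn := wt_pos P.s (P.m + n)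
    have hwM := wt_pos P.s (P.m + P.M)
    have hθn := geom_mul_wt_antitone hθ (by linarith [H.one_lt_s]) P.m_pos
      (H.s_div_le hMY) hn.le
    -- The algebraic part decays with exponent `s + s_L`, faster than the `s` of the continuation,
    -- because `ω^{s_L}` is nondecreasing.
    have hwt : 1 / wt (P.s + P.sL) (P.m + n)
        ≤ 1 / wt (P.s + P.sL) (P.m + P.M) * (wt P.s (P.m + P.M) / wt P.s (P.m + n)) := by
      have h1 := wt_pos P.sL (P.m + P.M)
      have h2 := wt_mono H.sL_pos.le (show P.m + P.M ≤ P.m + n by omega)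
      rw [wt_add, wt_add, one_div_mul_eq_div, div_div,
        div_le_div_iff₀ (mul_pos hwn (wt_pos _ _)) (by positivity)]
      nlinarith [mul_pos hwM hwn]
    have hX : 0 ≤ P.χ + P.θ / (1 - P.θ) := by
      have h1 := H.geomWeight_le_χ hm hMA le_rfl
      have h2 : 0 ≤ geomWeight P.θ (P.s + P.sL) P.m P.M :=
        Finset.sum_nonneg fun _ _ => by positivity
      have h3 := H.one_sub_θ_pos
      have : 0 ≤ P.θ / (1 - P.θ) := by positivity
      linarith
    have hXn : P.tailWeight n = P.χ := if_neg (by omega)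
    have hXM : P.tailWeight P.M = P.χ := if_neg (lt_irrefl _)
    have h := htail n
    rw [e, Z_tail_eq, hXM, add_mul]
    rw [hXn] at h
    refine h.trans (add_le_add ?_ ?_)
    · rw [mul_assoc, ← mul_div_assoc]
      exact mul_le_mul_of_nonneg_left hθn hG
    · rw [mul_assoc _ _ (_ / _)]
      refine mul_le_mul_of_nonneg_left ?_ (by positivity)
      rw [mul_right_comm]
      exact mul_le_mul_of_nonneg_right hwt hX

end Regular

/-- The ratio bounds become products only where `μ_k ≠ 0`; for `k ≥ m ≥ k₀` this follows from the
lower bound on the diagonal. -/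
theorem regular_of_bounds {P : Data} {C₂ : ℝ} {k₀ : ℕ}
    (hs : 1 < P.s) (hsL : 0 < P.sL) (hC₁ : 0 < P.C₁)
    (hupper : ∀ k, |P.lam k / wt P.sL k| ≤ C₂ ∧ |P.mu k / wt P.sL k| ≤ C₂ ∧
      |P.beta k / wt P.sL k| ≤ C₂)
    (hlower : ∀ k, k₀ ≤ k → P.C₁ ≤ |P.mu k / wt P.sL k|)
    (hδ : 0 < P.δ) (hδ' : P.δ < 1 / 2)
    (hratio : ∀ k, k₀ ≤ k → |P.lam k / P.mu k| ≤ P.δ ∧ |P.beta k / P.mu k| ≤ P.δ)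
    (hmk : k₀ ≤ P.m) : P.Regular C₂ := by
  have hle : ∀ (c : ℝ) (k : ℕ), |c / wt P.sL k| ≤ C₂ → |c| ≤ C₂ * wt P.sL k := fun c k h => by
    rwa [abs_div, abs_of_pos (wt_pos _ _), div_le_iff₀ (wt_pos _ _)] at h
  have hmu : ∀ k, P.m ≤ k → P.C₁ * wt P.sL k ≤ |P.mu k| := fun k hk => by
    have h := hlower k (hmk.trans hk)
    rwa [abs_div, abs_of_pos (wt_pos _ _), le_div_iff₀ (wt_pos _ _)] at h
  have hrat : ∀ (c : ℝ) (k : ℕ), P.m ≤ k → |c / P.mu k| ≤ P.δ → |c| ≤ P.δ * |P.mu k| :=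
    fun c k hk h => by
      rwa [abs_div, div_le_iff₀ ((mul_pos hC₁ (wt_pos _ _)).trans_le (hmu k hk))] at h
  exact
    { one_lt_s := hs
      sL_pos := hsL
      C₁_pos := hC₁
      δ_pos := hδ
      δ_lt := hδ'
      lam_le := fun k => hle _ k (hupper k).1
      mu_le := fun k => hle _ k (hupper k).2.1
      beta_le := fun k => hle _ k (hupper k).2.2
      le_mu := hmu
      lam_le_mu := fun k hk => hrat _ k hk (hratio k (hmk.trans hk)).1
      beta_le_mu := fun k hk => hrat _ k hk (hratio k (hmk.trans hk)).2 }

end Data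

end TridiagNewton
end

theorem mainTheorem1 (P : TridiagNewton.Data) (C₂ : ℝ) (k₀ : ℕ)
    (hs : 1 < P.s) (hsL : 0 < P.sL)
    (hC₁ : 0 < P.C₁) (hC₁₂ : P.C₁ ≤ C₂)
    (hupper : ∀ k, |P.lam k / TridiagNewton.wt P.sL k| ≤ C₂ ∧
      |P.mu k / TridiagNewton.wt P.sL k| ≤ C₂ ∧ |P.beta k / TridiagNewton.wt P.sL k| ≤ C₂)
    (hlower : ∀ k, k₀ ≤ k → P.C₁ ≤ |P.mu k / TridiagNewton.wt P.sL k|)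
    (hδ : 0 < P.δ) (hδ' : P.δ < 1 / 2)
    (hratio : ∀ k, k₀ ≤ k → |P.lam k / P.mu k| ≤ P.δ ∧ |P.beta k / P.mu k| ≤ P.δ)
    (hg : ∀ k, 2 * P.m - 1 ≤ k → P.g k = 0)
    (hm : 6 ≤ P.m) (hmk : k₀ ≤ P.m)
    (hMA : P.CondMA) (hMY : P.CondMY) (hL : 1 ≤ P.L) :
    ∃ T : TridiagNewton.Omega P.s → TridiagNewton.Omega P.s,
      (∀ (x : TridiagNewton.Omega P.s) (k : ℕ), T x k = x k - P.A (P.f x) k) ∧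
      Differentiable ℝ T ∧
      (∀ k, |(T P.xbarOmega - P.xbarOmega) k| ≤ P.Y k) ∧
      (∀ r : ℝ, 0 < r → ∀ b₁ b₂ : TridiagNewton.Omega P.s, ‖b₁‖ ≤ r → ‖b₂‖ ≤ r →
        ∀ k, |fderiv ℝ T (P.xbarOmega + b₁) b₂ k| ≤ P.Z r k) := by
  have H := TridiagNewton.Data.regular_of_bounds hs hsL hC₁ hupper hlower hδ hδ' hratio hmk
  refine ⟨H.newton hL hm, H.newton_apply hL hm hg,
    fun x => (H.hasFDerivAt_newton hL hm x).differentiableAt, fun k => ?_,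
    fun r _ b₁ b₂ hb₁ hb₂ k => H.abs_newton_deriv_le hL hm hg hMA hMY hb₁ hb₂ k⟩
  rw [TridiagNewton.Omega.sub_apply, H.newton_apply hL hm hg, sub_sub_cancel_left, abs_neg]
  exact H.abs_A_f_xbar_le hL hm hg hMA hMY k
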